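/- **Setting.** Let $k$ be a field, $n,m>0$, and let $B=B_{n,m}$ be the bipath poset: the disjoint union of two chains $1<\dots<n$ and $1'<\dots<m'$ with a global minimum $\hat 0$ and a global maximum $\hat 1$ added. Let $U=\{\hat0<1<\dots<n<\hat1\}$ and $D=\{\hat0<1'<\dots<m'<\hat1\}$ be its upper and lower path. A persistence module over a poset $P$ is a functor from $P$ to finite-dimensional $k$-vector spaces. An interval is a nonempty convex connected subset $I\subseteq P$, and $k_I$ is its interval module ($k$ on $I$ with identity maps, $0$ elsewhere). A finite multiset $\mathcal D$ of intervals is an interval decomposition of $V$ if $V\cong\bigoplus_{I\in\mathcal D}k_I$; if there is exactly one, it is the persistence diagram $\mathcal D(V)$. The intervals of $U$ and $D$ are the sets $[b,d]$ with $b\le d$; call them bars. **Block matrix problem.** Suppose given finite families of bars of $U$ (forming $X=\bigoplus k_I$) and of $D$ (forming $Y=\bigoplus k_I$), a matrix $\Lambda$ with columns indexed by the bars of $X$ containing $\hat0$ and rows indexed by the bars of $Y$ containing $\hat0$, and a matrix $\Gamma$ indexed likewise by the bars containing $\hat1$. List the bars of $X$ that contain $\hat0$ or $\hat1$ as columns,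 and those of $Y$ as rows, each in the order $[\hat0,\hat0],[\hat0,1],\dots,[\hat0,\hat1],[1,\hat1],\dots,[\hat1,\hat1]$ (for $Y$ with primes; equal bars in any order). The block matrix has the entry of $\Lambda$ where row and column both contain $\hat0$, otherwise the entry of $\Gamma$ where both contain $\hat1$; the remaining positions are strongly zero, that is, they stay $0$ under every operation. Write $I\vartriangleleft J$ if $I\neq J$ and $\operatorname{Hom}(k_J,k_I)\neq0$. Permissible operations are: elementary operations among rows, or among columns, with the same label; adding multiples of columns labelled $I$ to columns labelled $J$, and of rows labelled $J$ to rows labelled $I$, whenever $I\vartriangleleft J$. A normal form is a block diagonal matrix with blocks $P_\ell$, $E$, $P_r$ on the bars $[\hat0,?]\ne[\hat0,\hat1]$, on the bars $[\hat0,\hat1]$, and on the bars $[?,\hat1]\neq[\hat0,\hat1]$, where $P_\ell,P_r$ are permutation matrices and $E$ is an identity matrix. **Reduction procedure.** (i) Make the central block an identity matrix by elementary operations on the central rows and columns. (ii) Zero out the blocks to the right of and above it. (iii) Apply OneWayReduce to the $[\hat0,?]$-block and to the $[?,\hat1]$-block: for each column from left to right, take the lowest row with a nonzero entry in it, scale that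 row so that the entry becomes $1$, and clear everything to the right of the entry by column operations and everything above it by row operations. **Output.** From a matrix in normal form, return: $B$ for each matched pair $[\hat0,\hat1],[\hat0,\hat1]$; $[\hat0,i]\cup[\hat0,j']$ for each matched pair $[\hat0,i],[\hat0,j']$ (ends $\neq\hat1$); $[i,\hat1]\cup[j',\hat1]$ for each matched pair $[i,\hat1],[j',\hat1]$ (ends $\ne\hat0$); and every bar of $X$ or $Y$ that contains neither $\hat0$ nor $\hat1$. **Theorem.** (1) (IntervalDecompose.) Let $V$ be a persistence module over $B$. Then $V|_U$ and $V|_D$ have interval decompositions. Let $\phi\colon V|_U\to X$ and $\psi\colon V|_D\to Y$ be any interval decompositions, with $\Lambda=\psi_{\hat0}\phi_{\hat0}^{-1}$ and $\Gamma=\psi_{\hat1}\phi_{\hat1}^{-1}$ in the standard bases. Then an ordering of rows and columns as above exists, and for every such ordering: the reduction procedure can be carried out; each of its results is obtained from the block matrix by finitely many permissible operations and is in normal form; and for every normal form obtained by finitely many permissible operations (in particular for each result of the procedure), the returned multiset of intervals is an interval decomposition of $V$, and it is the only one. (2) (Bipath filtrations.) Let $S$ be a bipath filtration, that is, a functor from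 $B$ to topological spaces all of whose maps are inclusions, and let $q\ge0$ be such that the singular homology $H_q(S;k)$ is pointwise finite-dimensional. Let $C$ be the diagram of singular chain complexes of $S$, or any other $B$-diagram of chain complexes of $k$-vector spaces with a natural isomorphism $H_q(C)\cong H_q(S;k)$. Then there are standard $q$-th persistence diagrams with representative cycles for $C|_U$ and $C|_D$, that is, finite families of bars $[b,d]$ with cycles $z\in Z_q(C(b))$ such that the class of $z$ vanishes at all points after $d$, and such that at each point $a$ the classes of the cycles of the bars containing $a$ form a basis of $H_q(C(a))$. For any such choice, there are change-of-basis matrices $\Lambda$ at $\hat0$ and $\Gamma$ at $\hat1$ which express, modulo boundaries, the representative cycles of the upper path by those of the lower path, and an ordering of rows and columns as above exists. For all such matrices and orderings, the reduction procedure can be carried out; each of its results is obtained by finitely many permissible operations and is in normal form; and for every normal form obtained by finitely many permissible operations, the returned multiset is the $q$-th bipath persistence diagram $\mathcal D_q(S)=\mathcal D(H_q(S;k))$, the unique interval decomposition of $H_q(S;k)$. -/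

import Mathlib

open CategoryTheory

universe u v w

/-! ### Posets, intervals, persistence modules -/

/-- Intervals of a poset: nonempty, convex and connected subsets. -/
@[ext]
structure PosetInterval (P : Type*) [PartialOrder P] where
  carrier : Set P
  nonempty : carrier.Nonempty
  convex : ∀ a ∈ carrier, ∀ b ∈ carrier, ∀ z, a < z → z < b → z ∈ carrier
  connected : ∀ a ∈ carrier, ∀ b ∈ carrier,
    Relation.ReflTransGen (fun x y => x ∈ carrier ∧ y ∈ carrier ∧ (x ≤ y ∨ y ≤ x)) a b

/-- A set that is convex in the sense of `Set.OrdConnected` and in which every element is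
comparable to a fixed element `c` is an interval. -/
def PosetInterval.ofCone {P : Type*} [PartialOrder P] (s : Set P) (c : P) (hc : c ∈ s)
    (hconv : s.OrdConnected) (hcone : ∀ x ∈ s, x ≤ c ∨ c ≤ x) : PosetInterval P where
  carrier := s
  nonempty := ⟨c, hc⟩
  convex := fun _ ha _ hb _ h1 h2 => hconv.out ha hb ⟨h1.le, h2.le⟩
  connected := fun a ha b hb =>
    (Relation.ReflTransGen.single ⟨ha, hc, hcone a ha⟩).tail ⟨hc, hb, (hcone b hb).symm⟩

/-- The interval `[b, d]`. -/
def PosetInterval.icc {P : Type*} [PartialOrder P] (b d : P) (h : b ≤ d) : PosetInterval P :=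
  .ofCone (Set.Icc b d) b ⟨le_rfl, h⟩ inferInstance fun _ hx => Or.inr hx.1

/-- The interval `[⊥, s] ∪ [⊥, t]`. -/
def PosetInterval.fromBot {P : Type*} [PartialOrder P] [OrderBot P] (s t : P) : PosetInterval P :=
  .ofCone (Set.Icc ⊥ s ∪ Set.Icc ⊥ t) ⊥ (Or.inl ⟨le_rfl, bot_le⟩)
    ⟨fun _ _ _ hy _ hz => hy.imp (fun h => ⟨bot_le, hz.2.trans h.2⟩)
      (fun h => ⟨bot_le, hz.2.trans h.2⟩)⟩
    fun _ _ => Or.inr bot_le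

/-- The interval `[s, ⊤] ∪ [t, ⊤]`. -/
def PosetInterval.toTop {P : Type*} [PartialOrder P] [OrderTop P] (s t : P) : PosetInterval P :=
  .ofCone (Set.Icc s ⊤ ∪ Set.Icc t ⊤) ⊤ (Or.inl ⟨le_top, le_rfl⟩)
    ⟨fun _ hx _ _ _ hz => hx.imp (fun h => ⟨h.1.trans hz.1, le_top⟩)
      (fun h => ⟨h.1.trans hz.1, le_top⟩)⟩
    fun _ _ => Or.inl le_top

/-- The whole poset. -/
def PosetInterval.whole (P : Type*) [PartialOrder P] [OrderBot P] : PosetInterval P :=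
  .ofCone Set.univ ⊥ trivial Set.ordConnected_univ fun _ _ => Or.inr bot_le

/-- An isomorphism of persistence modules: a natural family of linear isomorphisms. (The vector
spaces of the two modules may live in different universes.) -/
structure PersIso {k : Type u} [Field k] {P : Type*} [PartialOrder P]
    (V : P ⥤ ModuleCat.{v} k) (W : P ⥤ ModuleCat.{w} k) where
  equiv : ∀ a, V.obj a ≃ₗ[k] W.obj a
  natural : ∀ {a b : P} (f : a ⟶ b) (x : V.obj a),
    equiv b ((V.map f).hom x) = (W.map f).hom (equiv a x)

/-- The identity isomorphism. -/
def PersIso.refl {k : Type u} [Field k] {P : Type*} [PartialOrder P]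
    (V : P ⥤ ModuleCat.{v} k) : PersIso V V where
  equiv := fun _ => LinearEquiv.refl _ _
  natural := fun _ _ => rfl

open Classical in
/-- The interval module `k_I`. Its value at `a` is the space of functions from the type
`PLift (a ∈ I)` to `k`, which is `k` if `a ∈ I` and `0` otherwise; the map from `a` to `b` is the
identity of `k` if `a, b ∈ I` and `0` otherwise. -/
noncomputable def intervalModule (k : Type u) [Field k] {P : Type*} [PartialOrder P]
    (I : PosetInterval P) : P ⥤ ModuleCat.{u} k where
  obj a := ModuleCat.of k (PLift (a ∈ I.carrier) → k)
  map {a b} _ := ModuleCat.ofHom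
    { toFun := fun x _ => if h : a ∈ I.carrier then x ⟨h⟩ else 0
      map_add' := fun x y => by
        funext t
        by_cases h : a ∈ I.carrier <;> simp [h]
      map_smul' := fun c x => by
        funext t
        by_cases h : a ∈ I.carrier <;> simp [h] }
  map_id a := by
    refine ModuleCat.hom_ext (LinearMap.ext fun x => funext fun t => ?_)
    simp [t.down]
  map_comp {a b c} f g := by
    refine ModuleCat.hom_ext (LinearMap.ext fun x => funext fun t => ?_)
    by_cases h : a ∈ I.carrier
    · have hb : b ∈ I.carrier := by
        rcases (leOfHom f).eq_or_lt with e | hab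
        · exact e ▸ h
        rcases (leOfHom g).eq_or_lt with e | hbc
        · exact e ▸ t.down
        exact I.convex a h c t.down b hab hbc
      simp [h, hb]
    · simp [h]

/-- The direct sum of a finite family of persistence modules. -/
noncomputable def directSumModule {k : Type u} [Field k] {P : Type*} [PartialOrder P] {N : ℕ}
    (F : Fin N → (P ⥤ ModuleCat.{v} k)) : P ⥤ ModuleCat.{v} k where
  obj a := ModuleCat.of k (∀ i, (F i).obj a)
  map f := ModuleCat.ofHom (LinearMap.pi fun i => ((F i).map f).hom ∘ₗ LinearMap.proj i)
  map_id a := by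
    refine ModuleCat.hom_ext (LinearMap.ext fun x => funext fun i => ?_)
    simp
  map_comp f g := by
    refine ModuleCat.hom_ext (LinearMap.ext fun x => funext fun i => ?_)
    simp

/-- `V` is isomorphic to the direct sum of the interval modules `k_J`, where `J` runs through the
multiset `D` (with multiplicities). -/
def IsIntervalDecomposition {k : Type u} [Field k] {P : Type*} [PartialOrder P]
    (V : P ⥤ ModuleCat.{v} k) (D : Multiset (PosetInterval P)) : Prop :=
  ∃ (N : ℕ) (I : Fin N → PosetInterval P), Finset.univ.val.map I = D ∧
    Nonempty (PersIso V (directSumModule fun i => intervalModule k (I i)))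

open Classical in
/-- The persistence diagram of `V`: the multiset of the intervals of an interval decomposition
(the empty multiset if there is none). -/
noncomputable def persistenceDiagram {k : Type u} [Field k] {P : Type*} [PartialOrder P]
    (V : P ⥤ ModuleCat.{v} k) : Multiset (PosetInterval P) :=
  if h : ∃ D, IsIntervalDecomposition V D then h.choose else 0

/-! ### Bipath posets -/

/-- The chain `0̂ < 1 < ⋯ < n < 1̂`. -/
abbrev PathPoset (n : ℕ) : Type := WithBot (WithTop (Fin n))

/-- The bipath poset: a global minimum `⊥` and a global maximum `⊤` are added to the disjoint union
of two chains with `n` and `m` elements. -/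
abbrev BipathPoset (n m : ℕ) : Type := WithBot (WithTop (Fin n ⊕ Fin m))

/-- The upper path `0̂ → 1 → ⋯ → n → 1̂`. -/
def upperPath (n m : ℕ) : PathPoset n →o BipathPoset n m :=
  ⟨WithBot.map (WithTop.map Sum.inl), (Sum.inl_mono.withTop_map).withBot_map⟩

/-- The lower path `0̂ → 1' → ⋯ → m' → 1̂`. -/
def lowerPath (n m : ℕ) : PathPoset m →o BipathPoset n m :=
  ⟨WithBot.map (WithTop.map Sum.inr), (Sum.inr_mono.withTop_map).withBot_map⟩

/-- Restriction of a diagram to the upper path. -/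
abbrev restrictUpper {n m : ℕ} {C : Type*} [Category C] (V : BipathPoset n m ⥤ C) :
    PathPoset n ⥤ C :=
  (upperPath n m).monotone.functor ⋙ V

/-- Restriction of a diagram to the lower path. -/
abbrev restrictLower {n m : ℕ} {C : Type*} [Category C] (V : BipathPoset n m ⥤ C) :
    PathPoset m ⥤ C :=
  (lowerPath n m).monotone.functor ⋙ V

/-- Intervals `[b, d]` of a path, given by their end points `b = fst ≤ snd = d`. -/
abbrev Bar (n : ℕ) : Type := NonemptyInterval (PathPoset n)

/-- A bar as an interval of the path. -/
def Bar.toInterval {n : ℕ} (I : Bar n) : PosetInterval (PathPoset n) :=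
  .icc I.fst I.snd I.fst_le_snd

/-- The indices of the bars that contain the point `a`. -/
abbrev Alive {n N : ℕ} (bar : Fin N → Bar n) (a : PathPoset n) : Type :=
  {i : Fin N // a ∈ Set.Icc (bar i).fst (bar i).snd}

/-! ### The block matrix problem -/

/-- `DomRel k I J` means `I ⊵ J`: there is a nonzero morphism from `k_I` to `k_J`. -/
def DomRel (k : Type u) [Field k] {n : ℕ} (I J : Bar n) : Prop :=
  ∃ f : intervalModule k I.toInterval ⟶ intervalModule k J.toInterval, f ≠ 0

/-- `I ◁ J`, that is, `J ⊵ I` and `J ≠ I`. -/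
def StrictSub (k : Type u) [Field k] {n : ℕ} (I J : Bar n) : Prop :=
  DomRel k J I ∧ J ≠ I

/-- Bars of the form `[0̂, ?]`, not equal to `[0̂, 1̂]`. -/
def Bar.IsLeft {n : ℕ} (I : Bar n) : Prop := I.fst = ⊥ ∧ I.snd ≠ ⊤

/-- The bar `[0̂, 1̂]`. -/
def Bar.IsCentral {n : ℕ} (I : Bar n) : Prop := I.fst = ⊥ ∧ I.snd = ⊤

/-- Bars of the form `[?, 1̂]`, not equal to `[0̂, 1̂]`. -/
def Bar.IsRight {n : ℕ} (I : Bar n) : Prop := I.fst ≠ ⊥ ∧ I.snd = ⊤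

/-- Bars which contain neither `0̂` nor `1̂`. -/
def Bar.IsOther {n : ℕ} (I : Bar n) : Prop := I.fst ≠ ⊥ ∧ I.snd ≠ ⊤

/-- A listing of those bars that contain `0̂` or `1̂`, in the order
`[0̂,0̂], [0̂,1], …, [0̂,n], [0̂,1̂], [1,1̂], …, [n,1̂], [1̂,1̂]` and in an arbitrary order among equal
bars. On these bars, this total order is the componentwise order of the end points. -/
structure EndListing {n N : ℕ} (bar : Fin N → Bar n) where
  num : ℕ
  idx : Fin num ≃ {i : Fin N // ¬ (bar i).IsOther}
  sorted : ∀ p q, p ≤ q →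
    (bar (idx p)).fst ≤ (bar (idx q)).fst ∧ (bar (idx p)).snd ≤ (bar (idx q)).snd

/-- The bar at position `p` of the listing. -/
def EndListing.label {n N : ℕ} {bar : Fin N → Bar n} (L : EndListing bar) (p : Fin L.num) : Bar n :=
  bar (L.idx p)

/-- The input of the matrix reduction: the bars of the decompositions `X` and `Y` of the upper and
of the lower path, the matrix `Λ` at `0̂` and the matrix `Γ` at `1̂` (columns: bars of `X`,
rows: bars of `Y`), and the order of the columns and rows. -/
structure BlockProblem (k : Type u) [Field k] (n m : ℕ) where
  sizeU : ℕ
  barU : Fin sizeU → Bar n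
  sizeD : ℕ
  barD : Fin sizeD → Bar m
  Lam : Matrix (Alive barD ⊥) (Alive barU ⊥) k
  Gam : Matrix (Alive barD ⊤) (Alive barU ⊤) k
  cols : EndListing barU
  rows : EndListing barD

namespace BlockProblem

variable {k : Type u} [Field k] {n m : ℕ} (M : BlockProblem k n m)

/-- The matrices of the block matrix problem. -/
abbrev Mat : Type u := Matrix (Fin M.rows.num) (Fin M.cols.num) k

/-- The position `(p, q)` is strongly zero: it lies in neither `Λ` nor `Γ`. -/
def StronglyZero (p : Fin M.rows.num) (q : Fin M.cols.num) : Prop :=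
  ¬ ((M.rows.label p).fst = ⊥ ∧ (M.cols.label q).fst = ⊥) ∧
  ¬ ((M.rows.label p).snd = ⊤ ∧ (M.cols.label q).snd = ⊤)

open Classical in
/-- The block matrix glued from `Λ` and `Γ` along the central block; strongly zero positions
hold `0`. -/
noncomputable def initial : M.Mat := fun p q =>
  if h : (M.rows.label p).fst = ⊥ ∧ (M.cols.label q).fst = ⊥ then
    M.Lam ⟨M.rows.idx p, h.1.le, bot_le⟩ ⟨M.cols.idx q, h.2.le, bot_le⟩
  else if h : (M.rows.label p).snd = ⊤ ∧ (M.cols.label q).snd = ⊤ then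
    M.Gam ⟨M.rows.idx p, le_top, h.1.ge⟩ ⟨M.cols.idx q, le_top, h.2.ge⟩
  else 0

open Classical in
/-- Elementary operations on block matrices. Adding multiples of column `s` to column `t` is allowed
if `okC s t`, adding multiples of row `s` to row `t` is allowed if `okR s t`. Strongly zero
positions are not changed by any operation. -/
inductive Op (okC : Fin M.cols.num → Fin M.cols.num → Prop)
    (okR : Fin M.rows.num → Fin M.rows.num → Prop) : M.Mat → M.Mat → Prop
  | scaleCol (A : M.Mat) (t : Fin M.cols.num) (c : k) (hc : c ≠ 0) (h : okC t t) :
      Op okC okR A (fun p q => if q = t then c * A p q else A p q)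
  | swapCol (A : M.Mat) (s t : Fin M.cols.num) (h : okC s t) (h' : okC t s) :
      Op okC okR A (fun p q => A p (Equiv.swap s t q))
  | addCol (A : M.Mat) (s t : Fin M.cols.num) (c : k) (hst : s ≠ t) (h : okC s t) :
      Op okC okR A
        (fun p q => if q = t ∧ ¬ M.StronglyZero p q then A p q + c * A p s else A p q)
  | scaleRow (A : M.Mat) (t : Fin M.rows.num) (c : k) (hc : c ≠ 0) (h : okR t t) :
      Op okC okR A (fun p q => if p = t then c * A p q else A p q)
  | swapRow (A : M.Mat) (s t : Fin M.rows.num) (h : okR s t) (h' : okR t s) :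
      Op okC okR A (fun p q => A (Equiv.swap s t p) q)
  | addRow (A : M.Mat) (s t : Fin M.rows.num) (c : k) (hst : s ≠ t) (h : okR s t) :
      Op okC okR A
        (fun p q => if p = t ∧ ¬ M.StronglyZero p q then A p q + c * A s q else A p q)

/-- Permissible operations: all elementary operations among columns, or rows, with equal labels,
additions from columns labelled `I` to columns labelled `J`, and additions from rows labelled `J`
to rows labelled `I`, where `I ◁ J`. -/
def Permissible : M.Mat → M.Mat → Prop :=
  M.Op
    (fun s t => M.cols.label s = M.cols.label t ∨ StrictSub k (M.cols.label s) (M.cols.label t))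
    (fun s t => M.rows.label s = M.rows.label t ∨ StrictSub k (M.rows.label t) (M.rows.label s))

/-- Elementary operations among the central rows and among the central columns. -/
def CentralOp : M.Mat → M.Mat → Prop :=
  M.Op (fun s t => (M.cols.label s).IsCentral ∧ (M.cols.label t).IsCentral)
    (fun s t => (M.rows.label s).IsCentral ∧ (M.rows.label t).IsCentral)

/-- `A` is obtained from the block matrix by finitely many permissible operations. -/
def Reachable (A : M.Mat) : Prop := Relation.ReflTransGen M.Permissible M.initial A

open Classical in
/-- The central block of `A` is an identity matrix. -/
def CentralIdentity (A : M.Mat) : Prop :=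
  ∃ e : {q // (M.cols.label q).IsCentral} ≃o {p // (M.rows.label p).IsCentral},
    ∀ (p : {p // (M.rows.label p).IsCentral}) (q : {q // (M.cols.label q).IsCentral}),
      A p q = if e q = p then 1 else 0

open Classical in
/-- The normal form: block diagonal with diagonal blocks a permutation matrix (bars `[0̂, ?]`), an
identity matrix (bars `[0̂, 1̂]`) and a permutation matrix (bars `[?, 1̂]`). -/
def IsNormalForm (A : M.Mat) : Prop :=
  M.CentralIdentity A ∧
  ∃ e : Fin M.cols.num ≃ Fin M.rows.num,
    (∀ q, ((M.rows.label (e q)).IsLeft ↔ (M.cols.label q).IsLeft) ∧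
      ((M.rows.label (e q)).IsCentral ↔ (M.cols.label q).IsCentral) ∧
      ((M.rows.label (e q)).IsRight ↔ (M.cols.label q).IsRight)) ∧
    ∀ p q, A p q = if e q = p then 1 else 0

end BlockProblem

open Classical in
/-- The part of the loop of `oneWayReduce` that treats column `col`: choose the lowest row `row`
with a nonzero entry in this column, scale the row, clear the entries to the right of the
position `(row, col)` by column operations and those above it by row operations. -/
noncomputable def oneWayStep {k : Type u} [Field k] {ρ κ : Type} [Fintype ρ] [LinearOrder ρ]
    [LinearOrder κ] (A : Matrix ρ κ k) (col : κ) : Matrix ρ κ k :=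
  if h : (Finset.univ.filter fun i => A i col ≠ 0).Nonempty then
    let row := (Finset.univ.filter fun i => A i col ≠ 0).max' h
    let A₁ : Matrix ρ κ k := fun i j => if i = row then (A row col)⁻¹ * A i j else A i j
    let A₂ : Matrix ρ κ k := fun i j => if col < j then A₁ i j - A₁ row j * A₁ i col else A₁ i j
    fun i j => if i < row then A₂ i j - A₂ i col * A₂ row j else A₂ i j
  else A

/-- Reduction to a permutation matrix, column after column from left to right. -/
noncomputable def oneWayReduce {k : Type u} [Field k] {ρ κ : Type} [Fintype ρ] [LinearOrder ρ]
    [Fintype κ] [LinearOrder κ] (A : Matrix ρ κ k) : Matrix ρ κ k :=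
  (Finset.univ.sort (· ≤ ·) : List κ).foldl oneWayStep A

open Classical in
/-- Apply `oneWayReduce` to the submatrix with the rows in `R` and the columns in `C`. -/
noncomputable def reduceSubmatrix {k : Type u} [Field k] {r c : ℕ} (R : Fin r → Prop)
    (C : Fin c → Prop) (A : Matrix (Fin r) (Fin c) k) : Matrix (Fin r) (Fin c) k :=
  fun p q => if h : R p ∧ C q then
    oneWayReduce (fun (i : {i // R i}) (j : {j // C j}) => A i j) ⟨p, h.1⟩ ⟨q, h.2⟩
  else A p q

namespace BlockProblem

variable {k : Type u} [Field k] {n m : ℕ} (M : BlockProblem k n m)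

open Classical in
/-- Zero out the blocks to the right of and above the central block. -/
noncomputable def clearBesideCentral (A : M.Mat) : M.Mat := fun p q =>
  if ((M.rows.label p).IsCentral ∧ (M.cols.label q).IsRight) ∨
      ((M.rows.label p).IsLeft ∧ (M.cols.label q).IsCentral) then 0 else A p q

/-- `A` is a possible result of the reduction procedure: transform the central block to an identity
matrix by elementary operations on the central rows and columns, clear the blocks to the right of
it and above it, and apply `oneWayReduce` to the blocks on the upper left and on the lower right. -/
def ProcedureResult (A : M.Mat) : Prop :=
  ∃ A₁ : M.Mat, Relation.ReflTransGen M.CentralOp M.initial A₁ ∧ M.CentralIdentity A₁ ∧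
    A = reduceSubmatrix (fun p => (M.rows.label p).IsRight) (fun q => (M.cols.label q).IsRight)
      (reduceSubmatrix (fun p => (M.rows.label p).IsLeft) (fun q => (M.cols.label q).IsLeft)
        (M.clearBesideCentral A₁))

open Classical in
/-- The interval of the bipath poset glued from a bar `I` of the upper path and a bar `J` of the
lower path, where both are `[0̂, 1̂]`, or both are of the form `[0̂, ?]`, or both are of the
form `[?, 1̂]`. -/
noncomputable def glue (I : Bar n) (J : Bar m) : PosetInterval (BipathPoset n m) :=
  if I.IsCentral then .whole _
  else if I.IsLeft then .fromBot (upperPath n m I.snd) (lowerPath n m J.snd)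
  else .toTop (upperPath n m I.fst) (lowerPath n m J.fst)

open Classical in
/-- The intervals returned by the algorithm, read off from the matrix `A` (in normal form): the glued
matched pairs of bars, and the bars of both paths which contain neither `0̂` nor `1̂`. -/
noncomputable def output (A : M.Mat) : Multiset (PosetInterval (BipathPoset n m)) :=
  (Finset.univ.filter fun x : Fin M.rows.num × Fin M.cols.num => A x.1 x.2 ≠ 0).val.map
      (fun x => glue (M.cols.label x.2) (M.rows.label x.1)) +
  (Finset.univ.filter fun i => (M.barU i).IsOther).val.map
      (fun i => .icc (upperPath n m (M.barU i).fst) (upperPath n m (M.barU i).snd)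
        ((upperPath n m).monotone (M.barU i).fst_le_snd)) +
  (Finset.univ.filter fun j => (M.barD j).IsOther).val.map
      (fun j => .icc (lowerPath n m (M.barD j).fst) (lowerPath n m (M.barD j).snd)
        ((lowerPath n m).monotone (M.barD j).fst_le_snd))

end BlockProblem

/-! ### The block matrix problem of a bipath persistence module -/

/-- The direct sum of the interval modules of a finite family of bars. -/
noncomputable abbrev barModule (k : Type u) [Field k] {n N : ℕ} (bar : Fin N → Bar n) :
    PathPoset n ⥤ ModuleCat.{u} k :=
  directSumModule fun i => intervalModule k (bar i).toInterval

/-- An interval decomposition of a persistence module over a path, with the isomorphism. -/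
structure PathDecomposition {k : Type u} [Field k] {n : ℕ} (V : PathPoset n ⥤ ModuleCat.{v} k) where
  size : ℕ
  bar : Fin size → Bar n
  iso : PersIso V (barModule k bar)

/-- The standard basis vector of `⨁ k_I` at the point `a` which belongs to the summand `i`. -/
def stdVector (k : Type u) [Field k] {n N : ℕ} (bar : Fin N → Bar n) (a : PathPoset n)
    (i : Alive bar a) : (barModule k bar).obj a :=
  fun j _ => if j = i.1 then (1 : k) else 0

/-- The coordinate of a vector of `⨁ k_I` at the point `a` which belongs to the summand `i`. -/
def stdCoord (k : Type u) [Field k] {n N : ℕ} (bar : Fin N → Bar n) (a : PathPoset n)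
    (x : (barModule k bar).obj a) (i : Alive bar a) : k :=
  x i.1 ⟨i.2⟩

/-- The block matrix problem associated to interval decompositions `φ` and `ψ` of the upper and the
lower path; `Λ` is the matrix of `ψ φ⁻¹` at `0̂` and `Γ` is the matrix of `ψ φ⁻¹` at `1̂`. -/
noncomputable def associatedProblem {k : Type u} [Field k] {n m : ℕ}
    {V : BipathPoset n m ⥤ ModuleCat.{v} k}
    (φ : PathDecomposition (restrictUpper V)) (ψ : PathDecomposition (restrictLower V))
    (cols : EndListing φ.bar) (rows : EndListing ψ.bar) : BlockProblem k n m where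
  sizeU := φ.size
  barU := φ.bar
  sizeD := ψ.size
  barD := ψ.bar
  Lam := fun j i => stdCoord k ψ.bar ⊥
    (ψ.iso.equiv ⊥ ((φ.iso.equiv ⊥).symm (stdVector k φ.bar ⊥ i) : V.obj ⊥)) j
  Gam := fun j i => stdCoord k ψ.bar ⊤
    (ψ.iso.equiv ⊤ ((φ.iso.equiv ⊤).symm (stdVector k φ.bar ⊤ i) : V.obj ⊤)) j
  cols := cols
  rows := rows

/-! ### Bipath filtrations -/

/-- A filtration: a diagram of topological spaces in which every map is an inclusion (a continuous
injection; inclusions of subspaces are a special case). -/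
def IsSpaceFiltration {P : Type*} [PartialOrder P] (S : P ⥤ TopCat.{w}) : Prop :=
  ∀ (a b : P) (f : a ⟶ b), Function.Injective (S.map f)

/-- The diagram of singular chain complexes with coefficients in `k`. -/
noncomputable def singularChains (k : Type u) [Field k] {P : Type*} [PartialOrder P]
    (S : P ⥤ TopCat.{w}) : P ⥤ ChainComplex (ModuleCat.{max u w} k) ℕ :=
  S ⋙ (AlgebraicTopology.singularChainComplexFunctor (ModuleCat.{max u w} k)).obj
    (ModuleCat.of k (ULift.{w} k))

/-- The persistence module of the `q`-th homology of a diagram of chain complexes. -/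
noncomputable def chainHomology {k : Type u} [Field k] {P : Type*} [PartialOrder P]
    (C : P ⥤ ChainComplex (ModuleCat.{v} k) ℕ) (q : ℕ) : P ⥤ ModuleCat.{v} k :=
  C ⋙ HomologicalComplex.homologyFunctor (ModuleCat.{v} k) (ComplexShape.down ℕ) q

/-- The persistence module `H_q(S; k)` of singular homology. -/
noncomputable def persistentHomology (k : Type u) [Field k] {P : Type*} [PartialOrder P]
    (S : P ⥤ TopCat.{w}) (q : ℕ) : P ⥤ ModuleCat.{max u w} k :=
  S ⋙ (AlgebraicTopology.singularHomologyFunctor (ModuleCat.{max u w} k) q).obj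
    (ModuleCat.of k (ULift.{w} k))

/-- A chain level description of `H_q(S; k)`: a diagram of chain complexes with a natural
isomorphism from its homology to the singular homology of `S`. -/
structure ChainModel (k : Type u) [Field k] {P : Type*} [PartialOrder P]
    (S : P ⥤ TopCat.{w}) (q : ℕ) where
  chains : P ⥤ ChainComplex (ModuleCat.{v} k) ℕ
  iso : PersIso (chainHomology chains q) (persistentHomology k S q)

/-- The chain model given by the singular chains. -/
noncomputable def ChainModel.singular (k : Type u) [Field k] {P : Type*} [PartialOrder P]
    (S : P ⥤ TopCat.{w}) (q : ℕ) : ChainModel.{u, max u w, w} k S q where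
  chains := singularChains k S
  iso := PersIso.refl _

/-- The image in degree `q` cycles at the point `a` of a cycle at the point `b ≤ a`. -/
noncomputable def pushCycle {k : Type u} [Field k] {P : Type*} [PartialOrder P]
    (C : P ⥤ ChainComplex (ModuleCat.{v} k) ℕ) (q : ℕ) {b a : P} (h : b ≤ a)
    (z : (C.obj b).cycles q) : (C.obj a).cycles q :=
  (HomologicalComplex.cyclesMap (C.map (homOfLE h)) q).hom z

/-- The homology class of a cycle. -/
noncomputable def homologyClass {k : Type u} [Field k] (K : ChainComplex (ModuleCat.{v} k) ℕ)
    (q : ℕ) (z : K.cycles q) : K.homology q :=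
  (K.homologyπ q).hom z

/-- The standard `q`-th persistence diagram of a filtration along a path, with representative cycles:
every bar `[b, d]` comes with a cycle at `b` whose homology class vanishes after `d`, and at
every point the classes of the cycles of the bars containing that point are a basis of the
homology. -/
structure CycleDiagram {k : Type u} [Field k] {n : ℕ}
    (C : PathPoset n ⥤ ChainComplex (ModuleCat.{v} k) ℕ) (q : ℕ) where
  size : ℕ
  bar : Fin size → Bar n
  cycle : ∀ i, (C.obj (bar i).fst).cycles q
  dies : ∀ (i : Fin size) (a : PathPoset n) (h : (bar i).fst ≤ a), ¬ a ≤ (bar i).snd →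
    homologyClass (C.obj a) q (pushCycle C q h (cycle i)) = 0
  linearIndependent : ∀ a : PathPoset n, LinearIndependent k (fun i : Alive bar a =>
    homologyClass (C.obj a) q (pushCycle C q i.2.1 (cycle i.1)))
  span : ∀ a : PathPoset n, Submodule.span k (Set.range fun i : Alive bar a =>
    homologyClass (C.obj a) q (pushCycle C q i.2.1 (cycle i.1))) = ⊤

/-- The representative cycles at the point `a` of the bars which contain `a`. -/
noncomputable def CycleDiagram.cycleAt {k : Type u} [Field k] {n : ℕ}
    {C : PathPoset n ⥤ ChainComplex (ModuleCat.{v} k) ℕ} {q : ℕ} (Z : CycleDiagram C q)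
    (a : PathPoset n) (i : Alive Z.bar a) : (C.obj a).cycles q :=
  pushCycle C q i.2.1 (Z.cycle i.1)

/-- `L` is the change of basis matrix from the cycles `z` to the cycles `y`: modulo the image of
the boundary map, column `i` of `L` expresses `z i` by the cycles `y j`. -/
def IsChangeOfBasis {k : Type u} [Field k] (K : ChainComplex (ModuleCat.{v} k) ℕ) (q : ℕ)
    {ι κ : Type} [Fintype κ] (z : ι → K.cycles q) (y : κ → K.cycles q) (L : Matrix κ ι k) : Prop :=
  ∀ i, z i - ∑ j, L j i • y j ∈ LinearMap.range (K.toCycles (q + 1) q).hom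

/-- The block matrix problem constructed from diagrams with representative cycles of the upper and
the lower path, and from the change of basis matrices `Λ` at `0̂` and `Γ` at `1̂`. -/
def cycleProblem {k : Type u} [Field k] {n m : ℕ}
    {C : BipathPoset n m ⥤ ChainComplex (ModuleCat.{v} k) ℕ} {q : ℕ}
    (Z : CycleDiagram (restrictUpper C) q) (Y : CycleDiagram (restrictLower C) q)
    (Lam : Matrix (Alive Y.bar ⊥) (Alive Z.bar ⊥) k)
    (Gam : Matrix (Alive Y.bar ⊤) (Alive Z.bar ⊤) k)
    (cols : EndListing Z.bar) (rows : EndListing Y.bar) : BlockProblem k n m where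
  sizeU := Z.size
  barU := Z.bar
  sizeD := Y.size
  barD := Y.bar
  Lam := Lam
  Gam := Gam
  cols := cols
  rows := rows

/-! A decomposition into interval modules is the same as an interval basis: sections supported on
intervals, compatible with the maps, which form a basis at every point (`IsIntervalBasis`,
`of_persIso`, `isIntervalDecomposition`). Over a finite chain such bases exist by elimination in
which a dying combination replaces its youngest generator. Given interval bases `x` of the upper and
`y` of the lower path, the block matrix expresses `x` by `y` at both ends of the bipath poset
(`Realises`). The two ends are linked by the map from 0̂ to 1̂, and this forces Λ and Γ to agree on
the central block and the blocks to the left of it and below it to vanish (`Realises.eq_zero`). A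
nonzero morphism between bars means that the end points are ordered componentwise, and this is
exactly what allows a multiple of one section to be added to another without destroying its support.
Hence a permissible operation on columns is a change of `x`, one on rows is an inverse change of
`y`, and every reachable matrix is again realised by interval bases (`Realises.permissible`). This
gives both halves of the theorem. In a normal form the matched sections agree at 0̂ and at 1̂, so
they glue to sections over the bipath poset, and together with the sections that vanish at both ends
they form an interval basis of `V` (`Realises.isIntervalBasis`). Conversely, a realised matrix
cannot have a zero column in a left or central diagonal block, nor in the right one once the central
rows vanish there, since a basis vector would vanish at an end. So the one-way reduction always
finds a pivot, and counting dimensions at the two ends shows that the blocks are square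
(`Realises.card_eq`, `reachable_and_isNormalForm`). Uniqueness is a Krull–Schmidt argument: two
morphisms between interval modules of different intervals compose to zero, so the transition
matrices between two interval bases restrict to mutually inverse ones for each interval
(`IsIntervalBasis.card_le`). The topological statement follows because representative cycles give
interval bases of homology, and changes of basis modulo boundaries are changes of basis of homology
classes. -/

/-! ### Interval bases -/

/-- The map of a persistence module for `a ≤ b`. -/
noncomputable abbrev push {k : Type u} [Field k] {P : Type*} [PartialOrder P]
    (V : P ⥤ ModuleCat.{v} k) {a b : P} (h : a ≤ b) : V.obj a →ₗ[k] V.obj b :=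
  (V.map (homOfLE h)).hom

theorem push_push {k : Type u} [Field k] {P : Type*} [PartialOrder P]
    (V : P ⥤ ModuleCat.{v} k) {a b c : P} (h : a ≤ b) (h' : b ≤ c) (x : V.obj a) :
    push V h' (push V h x) = push V (h.trans h') x := by
  have : V.map (homOfLE (h.trans h')) = V.map (homOfLE h) ≫ V.map (homOfLE h') := by
    rw [← V.map_comp]; rfl
  simp [push, this]

theorem push_refl {k : Type u} [Field k] {P : Type*} [PartialOrder P]
    (V : P ⥤ ModuleCat.{v} k) {a : P} (h : a ≤ a) (x : V.obj a) : push V h x = x := by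
  simp [push]

/-- A family of sections `z i`, supported on intervals `I i`, which are compatible with the maps of
`V` and which form a basis at every point. -/
structure IsIntervalBasis {k : Type u} [Field k] {P : Type*} [PartialOrder P]
    (V : P ⥤ ModuleCat.{v} k) {ι : Type*} (I : ι → PosetInterval P)
    (z : ι → ∀ a, V.obj a) : Prop where
  zero : ∀ i a, a ∉ (I i).carrier → z i a = 0
  map : ∀ i {a b : P} (h : a ≤ b), a ∈ (I i).carrier → push V h (z i a) = z i b
  linInd : ∀ a, LinearIndependent k (fun i : {i // a ∈ (I i).carrier} => z i.1 a)
  span : ∀ a, Submodule.span k (Set.range fun i => z i a) = ⊤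

namespace IsIntervalBasis

variable {k : Type u} [Field k] {P : Type*} [PartialOrder P] {V : P ⥤ ModuleCat.{v} k}
  {ι : Type*} {I : ι → PosetInterval P} {z : ι → ∀ a, V.obj a}

theorem span_alive (hz : IsIntervalBasis V I z) (a : P) :
    ⊤ ≤ Submodule.span k (Set.range fun i : {i // a ∈ (I i).carrier} => z i.1 a) := by
  rw [← hz.span a, Submodule.span_le]
  rintro _ ⟨i, rfl⟩
  by_cases h : a ∈ (I i).carrier
  · exact Submodule.subset_span ⟨⟨i, h⟩, rfl⟩
  · simp [hz.zero i a h]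

/-- The basis of `V.obj a` given by the sections which are alive at `a`. -/
noncomputable def basis (hz : IsIntervalBasis V I z) (a : P) :
    Module.Basis {i // a ∈ (I i).carrier} k (V.obj a) :=
  Module.Basis.mk (hz.linInd a) (hz.span_alive a)

@[simp]
theorem basis_apply (hz : IsIntervalBasis V I z) (a : P) (i : {i // a ∈ (I i).carrier}) :
    hz.basis a i = z i.1 a := by
  simp [basis]

open Classical in
/-- The coordinate at `a` which belongs to the section `z i`; it is `0` if `a ∉ I i`. -/
noncomputable def coord (hz : IsIntervalBasis V I z) (a : P) (i : ι) : V.obj a →ₗ[k] k :=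
  if h : a ∈ (I i).carrier then (hz.basis a).coord ⟨i, h⟩ else 0

theorem coord_of_notMem (hz : IsIntervalBasis V I z) {a : P} {i : ι}
    (h : a ∉ (I i).carrier) (x : V.obj a) : hz.coord a i x = 0 := by
  simp [coord, h]

theorem coord_self (hz : IsIntervalBasis V I z) {a : P} {i : ι} (h : a ∈ (I i).carrier) :
    hz.coord a i (z i a) = 1 := by
  have := (hz.basis a).repr_self ⟨i, h⟩
  rw [basis_apply] at this
  simp [coord, h, this]

theorem coord_of_ne (hz : IsIntervalBasis V I z) (a : P) {i j : ι} (h : i ≠ j) :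
    hz.coord a i (z j a) = 0 := by
  by_cases hj : a ∈ (I j).carrier
  · by_cases hi : a ∈ (I i).carrier
    · have := (hz.basis a).repr_self ⟨j, hj⟩
      rw [basis_apply] at this
      simp [coord, hi, this, h.symm]
    · exact hz.coord_of_notMem hi _
  · simp [hz.zero j a hj]

theorem coord_sum [Fintype ι] (hz : IsIntervalBasis V I z) {a : P} (c : ι → k) {j : ι}
    (h : a ∈ (I j).carrier) : hz.coord a j (∑ i, c i • z i a) = c j := by
  rw [map_sum, Finset.sum_eq_single j]
  · simp [hz.coord_self h]
  · intro i _ hi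
    simp [hz.coord_of_ne a hi.symm]
  · simp

theorem sum_coord [Fintype ι] (hz : IsIntervalBasis V I z) {a : P} (x : V.obj a) :
    ∑ i, hz.coord a i x • z i a = x := by
  have hx : x ∈ Submodule.span k (Set.range fun i => z i a) := by simp [hz.span a]
  obtain ⟨c, rfl⟩ := (Submodule.mem_span_range_iff_exists_fun k).1 hx
  refine Finset.sum_congr rfl fun i _ => ?_
  by_cases h : a ∈ (I i).carrier
  · rw [hz.coord_sum c h]
  · simp [hz.zero i a h]

/-- The coordinates form a morphism from `V` to the interval module of `I j`. Membership of the
target point is enough: if `a` is outside the interval, then `z j` does not occur among the sections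
pushed from `a`, and both sides are zero. -/
theorem coord_push [Fintype ι] (hz : IsIntervalBasis V I z) {a b : P} (h : a ≤ b) {j : ι}
    (hj : b ∈ (I j).carrier) (x : V.obj a) :
    hz.coord b j (push V h x) = hz.coord a j x := by
  have : push V h x = ∑ i, hz.coord a i x • z i b := by
    conv_lhs => rw [← hz.sum_coord x, map_sum]
    refine Finset.sum_congr rfl fun i _ => ?_
    rw [map_smul]
    by_cases hi : a ∈ (I i).carrier
    · rw [hz.map i h hi]
    · simp [hz.coord_of_notMem hi]
  rw [this, hz.coord_sum _ hj]

theorem finrank_eq [Fintype ι] (hz : IsIntervalBasis V I z) (a : P)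
    [Fintype {i // a ∈ (I i).carrier}] :
    Module.finrank k (V.obj a) = Fintype.card {i // a ∈ (I i).carrier} :=
  Module.finrank_eq_card_basis (hz.basis a)

/-- Sections which span at every point form an interval basis if there is another interval basis
with the same intervals. -/
theorem of_span [Fintype ι] (hz : IsIntervalBasis V I z) {z' : ι → ∀ a, V.obj a}
    (zero : ∀ i a, a ∉ (I i).carrier → z' i a = 0)
    (map : ∀ i {a b : P} (h : a ≤ b), a ∈ (I i).carrier → push V h (z' i a) = z' i b)
    (span : ∀ i a, z i a ∈ Submodule.span k (Set.range fun i => z' i a)) :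
    IsIntervalBasis V I z' := by
  classical
  have hs : ∀ a, Submodule.span k (Set.range fun i => z' i a) = ⊤ := by
    intro a
    rw [eq_top_iff, ← hz.span a, Submodule.span_le]
    rintro _ ⟨i, rfl⟩
    exact span i a
  refine ⟨zero, map, fun a => ?_, hs⟩
  refine linearIndependent_of_top_le_span_of_card_eq_finrank ?_ (hz.finrank_eq a).symm
  rw [← hs a, Submodule.span_le]
  rintro _ ⟨i, rfl⟩
  by_cases h : a ∈ (I i).carrier
  · exact Submodule.subset_span ⟨⟨i, h⟩, rfl⟩
  · simp [zero i a h]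

theorem reindex {κ : Type*} (hz : IsIntervalBasis V I z) (e : κ ≃ ι) :
    IsIntervalBasis V (I ∘ e) (z ∘ e) where
  zero i a h := hz.zero (e i) a h
  map i _ _ h ha := hz.map (e i) h ha
  linInd a := by
    have := (hz.linInd a).comp (fun i : {i // a ∈ (I (e i)).carrier} =>
      (⟨e i.1, i.2⟩ : {i // a ∈ (I i).carrier})) fun i j h => by
        simpa [Subtype.ext_iff] using h
    exact this
  span a := by
    rw [← hz.span a]
    congr 1
    exact e.surjective.range_comp fun i => z i a

/-- The linear equivalence between the coordinates at `a` and the value of `⨁ k_I` at `a`. -/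
noncomputable def sumObjEquiv {N : ℕ} (I : Fin N → PosetInterval P) (a : P) :
    ({i // a ∈ (I i).carrier} → k) ≃ₗ[k]
      (directSumModule fun i => intervalModule k (I i)).obj a where
  toFun w := fun i t => w ⟨i, t.down⟩
  invFun x := fun i => x i.1 ⟨i.2⟩
  map_add' _ _ := rfl
  map_smul' _ _ := rfl
  left_inv _ := rfl
  right_inv _ := rfl

open Classical in
theorem sum_map_apply {N : ℕ} (I : Fin N → PosetInterval P) {a b : P} (f : a ⟶ b)
    (x : (directSumModule fun i => intervalModule k (I i)).obj a) (i : Fin N)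
    (t : PLift (b ∈ (I i).carrier)) :
    ((directSumModule fun i => intervalModule k (I i)).map f).hom x i t =
      if h : a ∈ (I i).carrier then x i ⟨h⟩ else 0 := rfl

theorem sumObjEquiv_basis {N : ℕ} {I : Fin N → PosetInterval P} {z : Fin N → ∀ a, V.obj a}
    (hz : IsIntervalBasis V I z) {a : P} (x : V.obj a) (i : Fin N)
    (t : PLift (a ∈ (I i).carrier)) :
    ((hz.basis a).equivFun ≪≫ₗ sumObjEquiv I a) x i t = hz.coord a i x := by
  have h : hz.coord a i x = (hz.basis a).equivFun x ⟨i, t.down⟩ := by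
    simp [coord, t.down]
  rw [h]
  rfl

/-- The isomorphism with a direct sum of interval modules defined by an interval basis. -/
noncomputable def persIso {N : ℕ} {I : Fin N → PosetInterval P} {z : Fin N → ∀ a, V.obj a}
    (hz : IsIntervalBasis V I z) : PersIso V (directSumModule fun i => intervalModule k (I i)) where
  equiv a := (hz.basis a).equivFun ≪≫ₗ sumObjEquiv I a
  natural {a b} f x := by
    funext i t
    have h1 : (V.map f).hom x = push V (leOfHom f) x := rfl
    rw [sumObjEquiv_basis, h1, hz.coord_push _ t.down, sum_map_apply]
    by_cases ha : a ∈ (I i).carrier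
    · rw [dif_pos ha, sumObjEquiv_basis]
    · rw [dif_neg ha, hz.coord_of_notMem ha]

theorem isIntervalDecomposition [Fintype ι] (hz : IsIntervalBasis V I z) :
    IsIntervalDecomposition V (Finset.univ.val.map I) := by
  let e := (Fintype.equivFin ι).symm
  refine ⟨Fintype.card ι, I ∘ e, ?_, ⟨(hz.reindex e).persIso⟩⟩
  rw [← Multiset.map_map]
  congr 1
  have := congrArg Finset.val (Finset.map_univ_equiv e)
  exact this

/-- The standard vector of `⨁ k_I` at the point `a` which belongs to the summand `i`. -/
def sumVector (k : Type u) [Field k] {N : ℕ} (I : Fin N → PosetInterval P) (a : P) (i : Fin N) :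
    (directSumModule fun i => intervalModule k (I i)).obj a :=
  fun j _ => if j = i then (1 : k) else 0

theorem sumVector_eq_zero {N : ℕ} {I : Fin N → PosetInterval P} {a : P} {i : Fin N}
    (h : a ∉ (I i).carrier) : sumVector k I a i = 0 := by
  funext j t
  have : j ≠ i := fun e => h (e ▸ t.down)
  exact if_neg this

theorem sumObjEquiv_single {N : ℕ} {I : Fin N → PosetInterval P} {a : P}
    (i : {i // a ∈ (I i).carrier}) [DecidableEq {i // a ∈ (I i).carrier}] :
    sumObjEquiv I a (Pi.single i (1 : k)) = sumVector k I a i.1 := by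
  funext j t
  have h : sumObjEquiv I a (Pi.single i (1 : k)) j t =
    (Pi.single i (1 : k) : {i // a ∈ (I i).carrier} → k) ⟨j, t.down⟩ := rfl
  rw [h, Pi.single_apply]
  simp [sumVector, Subtype.ext_iff]

/-- The interval basis defined by an isomorphism with a direct sum of interval modules. -/
theorem of_persIso {N : ℕ} {I : Fin N → PosetInterval P}
    (φ : PersIso V (directSumModule fun i => intervalModule k (I i))) :
    IsIntervalBasis V I (fun i a => (φ.equiv a).symm (sumVector k I a i)) := by
  classical
  have hb : ∀ a, ((Pi.basisFun k {i // a ∈ (I i).carrier}).map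
      ((sumObjEquiv I a).trans (φ.equiv a).symm) : _ → V.obj a) =
      fun i => (φ.equiv a).symm (sumVector k I a i.1) := fun a => by
    funext i
    simp only [Module.Basis.map_apply, LinearEquiv.trans_apply, Pi.basisFun_apply]
    rw [sumObjEquiv_single]
  refine ⟨fun i a h => ?_, fun i a b h ha => ?_, fun a => ?_, fun a => ?_⟩
  · simp only [sumVector_eq_zero h, map_zero]
  · rw [LinearEquiv.eq_symm_apply]
    refine (φ.natural (homOfLE h) _).trans ?_
    rw [LinearEquiv.apply_symm_apply]
    funext j t
    rw [sum_map_apply]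
    by_cases hj : j = i
    · subst hj
      simp [sumVector, ha]
    · simp [sumVector, hj]
  · rw [← hb]
    exact Module.Basis.linearIndependent _
  · rw [eq_top_iff, ← Module.Basis.span_eq ((Pi.basisFun k {i // a ∈ (I i).carrier}).map
      ((sumObjEquiv I a).trans (φ.equiv a).symm)), hb]
    refine Submodule.span_mono ?_
    rintro _ ⟨i, rfl⟩
    exact ⟨i.1, rfl⟩

/-! ### Uniqueness of interval decompositions -/

/-- The two coordinates are scalars of morphisms from the module of `I i` to that of `J j` and back
to that of `I i'`, whose interval is again `I i`. If the comparable point `b` lay in only one of the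
two intervals, a naturality square between `a` and `b` would have a nonzero scalar on one side and
zero on the other. If it lies in both, naturality keeps the scalars. -/
theorem mem_of_comparable {ι' : Type*} [Fintype ι] [Fintype ι'] {J : ι' → PosetInterval P}
    {w : ι' → ∀ a, V.obj a} (hz : IsIntervalBasis V I z) (hw : IsIntervalBasis V J w)
    {i i' : ι} {j : ι'} (hi : I i = I i') {a b : P} (hF : hw.coord a j (z i a) ≠ 0)
    (hG : hz.coord a i' (w j a) ≠ 0) (hab : a ≤ b ∨ b ≤ a)
    (hb : b ∈ (I i).carrier ∨ b ∈ (J j).carrier) :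
    (b ∈ (I i).carrier ∧ b ∈ (J j).carrier) ∧
      hw.coord b j (z i b) ≠ 0 ∧ hz.coord b i' (w j b) ≠ 0 := by
  have hai : a ∈ (I i).carrier := by
    by_contra h; exact hF (by rw [hz.zero i a h, map_zero])
  have haj : a ∈ (J j).carrier := by
    by_contra h; exact hG (by rw [hw.zero j a h, map_zero])
  suffices hmem : b ∈ (I i).carrier ∧ b ∈ (J j).carrier by
    refine ⟨hmem, ?_⟩
    obtain h | h := hab
    · rw [← hz.map i h hai, ← hw.map j h haj, hw.coord_push h hmem.2,
        hz.coord_push h (hi ▸ hmem.1)]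
      exact ⟨hF, hG⟩
    · rw [← hz.map i h hmem.1, ← hw.map j h hmem.2, hw.coord_push h haj,
        hz.coord_push h (hi ▸ hai)] at *
      exact ⟨hF, hG⟩
  obtain h | h := hab
  · obtain hb | hb := hb
    · refine ⟨hb, ?_⟩
      by_contra hn
      refine hG ?_
      rw [← hz.coord_push h (hi ▸ hb), hw.map j h haj, hw.zero j b hn, map_zero]
    · refine ⟨?_, hb⟩
      by_contra hn
      refine hF ?_
      rw [← hw.coord_push h hb, hz.map i h hai, hz.zero i b hn, map_zero]
  · obtain hb | hb := hb
    · refine ⟨hb, ?_⟩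
      by_contra hn
      refine hF ?_
      rw [← hz.map i h hb, hw.coord_push h haj, hw.coord_of_notMem hn]
    · refine ⟨?_, hb⟩
      by_contra hn
      refine hG ?_
      rw [← hw.map j h hb, hz.coord_push h (hi ▸ hai), hz.coord_of_notMem (hi ▸ hn)]

/-- Intervals are connected, so nonvanishing spreads from `a` along zigzags through each of the two
intervals, and each zigzag stays inside the other one. -/
theorem eq_of_coord_ne_zero {ι' : Type*} [Fintype ι] [Fintype ι'] {J : ι' → PosetInterval P}
    {w : ι' → ∀ a, V.obj a} (hz : IsIntervalBasis V I z) (hw : IsIntervalBasis V J w)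
    {i i' : ι} {j : ι'} (hi : I i = I i') {a : P} (hF : hw.coord a j (z i a) ≠ 0)
    (hG : hz.coord a i' (w j a) ≠ 0) : I i = J j := by
  have hai : a ∈ (I i).carrier := by
    by_contra h; exact hF (by rw [hz.zero i a h, map_zero])
  have haj : a ∈ (J j).carrier := by
    by_contra h; exact hG (by rw [hw.zero j a h, map_zero])
  have key : ∀ b, (∃ K, (K = I i ∨ K = J j) ∧ Relation.ReflTransGen
      (fun x y => x ∈ K.carrier ∧ y ∈ K.carrier ∧ (x ≤ y ∨ y ≤ x)) a b) →
      (b ∈ (I i).carrier ∧ b ∈ (J j).carrier) ∧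
        hw.coord b j (z i b) ≠ 0 ∧ hz.coord b i' (w j b) ≠ 0 := by
    rintro b ⟨K, hK, h⟩
    induction h with
    | refl => exact ⟨⟨hai, haj⟩, hF, hG⟩
    | tail _ h ih =>
      refine mem_of_comparable hz hw hi ih.2.1 ih.2.2 h.2.2 ?_
      obtain rfl | rfl := hK
      · exact Or.inl h.2.1
      · exact Or.inr h.2.1
  ext b
  exact ⟨fun hb => (key b ⟨_, Or.inl rfl, (I i).connected a hai b hb⟩).1.2,
    fun hb => (key b ⟨_, Or.inr rfl, (J j).connected a haj b hb⟩).1.1⟩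

open Classical in
-- At a point of `K`, the blocks `F` and `G` of the two transition matrices satisfy `G * F = 1`: in
-- the full product the summands that pass through sections with another interval vanish by
-- `eq_of_coord_ne_zero`. A left inverse makes `F` injective, which bounds the number of its columns
-- by the number of its rows.
theorem card_le {ι' : Type*} [Fintype ι] [Fintype ι'] {J : ι' → PosetInterval P}
    {w : ι' → ∀ a, V.obj a} (hz : IsIntervalBasis V I z) (hw : IsIntervalBasis V J w)
    (K : PosetInterval P) : Fintype.card {i // I i = K} ≤ Fintype.card {j // J j = K} := by
  obtain ⟨a, ha⟩ := K.nonempty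
  let F : Matrix {j // J j = K} {i // I i = K} k := fun j i => hw.coord a j.1 (z i.1 a)
  let G : Matrix {i // I i = K} {j // J j = K} k := fun i j => hz.coord a i.1 (w j.1 a)
  have hGF : G * F = 1 := by
    ext i' i
    have h1 : hz.coord a i'.1 (z i.1 a) =
        ∑ j, hw.coord a j (z i.1 a) * hz.coord a i'.1 (w j a) := by
      conv_lhs => rw [← hw.sum_coord (z i.1 a), map_sum]
      simp
    have h2 : hz.coord a i'.1 (z i.1 a) = (1 : Matrix _ _ k) i' i := by
      by_cases h : i' = i
      · subst h
        rw [hz.coord_self (i'.2.symm ▸ ha), Matrix.one_apply_eq]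
      · rw [hz.coord_of_ne a fun e => h (Subtype.ext e), Matrix.one_apply_ne h]
    rw [← h2, h1, Matrix.mul_apply]
    refine (Finset.sum_congr rfl fun j _ => mul_comm (G i' j) (F j i)).trans ?_
    rw [← Finset.sum_filter_of_ne (p := fun j => J j = K)]
    · exact (Finset.sum_subtype _ (by simp)
        fun j => hw.coord a j (z i.1 a) * hz.coord a i'.1 (w j a)).symm
    · intro j _ hj
      rw [← hz.eq_of_coord_ne_zero hw (i.2.trans i'.2.symm) (left_ne_zero_of_mul hj)
        (right_ne_zero_of_mul hj)]
      exact i.2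
  have hinj : Function.Injective F.mulVecLin := by
    intro x y h
    have := congrArg G.mulVec h
    simpa [Matrix.mulVec_mulVec, hGF] using this
  simpa using LinearMap.finrank_le_finrank_of_injective hinj

end IsIntervalBasis

theorem isIntervalDecomposition_unique {k : Type u} [Field k] {P : Type*} [PartialOrder P]
    {V : P ⥤ ModuleCat.{v} k} {D E : Multiset (PosetInterval P)}
    (hD : IsIntervalDecomposition V D) (hE : IsIntervalDecomposition V E) : D = E := by
  classical
  obtain ⟨N, I, rfl, ⟨φ⟩⟩ := hD
  obtain ⟨M, J, rfl, ⟨ψ⟩⟩ := hE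
  have hz := IsIntervalBasis.of_persIso φ
  have hw := IsIntervalBasis.of_persIso ψ
  ext K
  have := (hz.card_le hw K).antisymm (hw.card_le hz K)
  rw [Multiset.count_map, Multiset.count_map]
  rw [Fintype.card_subtype, Fintype.card_subtype] at this
  simpa [Finset.card, Finset.filter, eq_comm] using this

/-! ### Interval decompositions over finite chains -/

section Chain

variable {k : Type u} [Field k] {P : Type*} [LinearOrder P] (V : P ⥤ ModuleCat.{v} k)
  {ι : Type} (b : ι → P)

/-- The section generated by the vector `x i` at the point `b i`. -/
noncomputable def genSection (x : ∀ i, V.obj (b i)) (i : ι) (a : P) : V.obj a :=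
  if h : b i ≤ a then push V h (x i) else 0

variable {V b}

theorem push_genSection (x : ∀ i, V.obj (b i)) {i : ι} {a a' : P} (h : a ≤ a') (hi : b i ≤ a) :
    push V h (genSection V b x i a) = genSection V b x i a' := by
  rw [genSection, dif_pos hi, genSection, dif_pos (hi.trans h), push_push]

theorem genSection_of_not_le (x : ∀ i, V.obj (b i)) {i : ι} {a : P} (hi : ¬ b i ≤ a) :
    genSection V b x i a = 0 := dif_neg hi

theorem genSection_ne_zero_of_le (x : ∀ i, V.obj (b i)) {i : ι} {a a' : P} (h : a ≤ a')
    (hi : b i ≤ a) (h0 : genSection V b x i a' ≠ 0) : genSection V b x i a ≠ 0 := fun h1 =>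
  h0 (by rw [← push_genSection x h hi, h1, map_zero])

open Classical in
/-- The nonzero vectors of the finite family `v` form a basis. -/
def NonzeroIsBasis {W : Type*} [AddCommGroup W] [Module k W] [Fintype ι] (v : ι → W) : Prop :=
  Submodule.span k (Set.range v) = ⊤ ∧
    (Finset.univ.filter fun i => v i ≠ 0).card ≤ Module.finrank k W

theorem span_range_subtype_ne_zero {W : Type*} [AddCommGroup W] [Module k W] (v : ι → W) :
    Submodule.span k (Set.range fun i : {i // v i ≠ 0} => v i) =
      Submodule.span k (Set.range v) := by
  refine le_antisymm (Submodule.span_mono ?_) (Submodule.span_le.2 ?_)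
  · rintro _ ⟨i, rfl⟩
    exact ⟨i.1, rfl⟩
  · rintro _ ⟨i, rfl⟩
    by_cases h : v i = 0
    · simp [h]
    · exact Submodule.subset_span ⟨⟨i, h⟩, rfl⟩

/-- A spanning family cannot have fewer members than the dimension, so the upper bound in
`NonzeroIsBasis` already forces a basis. -/
theorem NonzeroIsBasis.linearIndependent {W : Type*} [AddCommGroup W] [Module k W] [Fintype ι]
    {v : ι → W} (h : NonzeroIsBasis (k := k) v) :
    LinearIndependent k (fun i : {i // v i ≠ 0} => v i) := by
  classical
  have hs := (span_range_subtype_ne_zero (k := k) v).trans h.1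
  refine linearIndependent_of_top_le_span_of_card_eq_finrank hs.ge (le_antisymm ?_ ?_)
  · rw [Fintype.card_subtype]
    convert h.2
  · have := finrank_range_le_card (R := k) (fun i : {i // v i ≠ 0} => v i)
    rwa [Set.finrank, hs, finrank_top] at this

/-- Replacing the generator `i₀` by a linear combination of generators which are not born
later. -/
theorem genSection_update [DecidableEq ι] [Fintype ι] (x : ∀ i, V.obj (b i)) (c : ι → k) (i₀ : ι)
    (hc : ∀ i, c i ≠ 0 → b i ≤ b i₀) (a : P) (ha : b i₀ ≤ a) (i : ι) :
    genSection V b (Function.update x i₀ (∑ i, c i • genSection V b x i (b i₀))) i a =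
      if i = i₀ then ∑ i, c i • genSection V b x i a else genSection V b x i a := by
  split_ifs with h
  · subst h
    rw [genSection, dif_pos ha, Function.update_self, map_sum]
    refine Finset.sum_congr rfl fun j _ => ?_
    rw [map_smul]
    by_cases hj : c j = 0
    · simp [hj]
    · rw [push_genSection x ha (hc j hj)]
  · simp [genSection, Function.update_of_ne h]

theorem genSection_update_of_not_le [DecidableEq ι] (x : ∀ i, V.obj (b i)) (i₀ : ι)
    (y : V.obj (b i₀)) {a : P} (ha : ¬ b i₀ ≤ a) (i : ι) :
    genSection V b (Function.update x i₀ y) i a = genSection V b x i a := by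
  by_cases h : i = i₀
  · subst h
    rw [genSection_of_not_le _ ha, genSection_of_not_le _ ha]
  · simp [genSection, Function.update_of_ne h]

/-- As long as the nonzero images at `a` satisfy a relation, the generator born last among those
involved is replaced by the related combination. It dies at `a`, so the number of nonzero images
drops, while the bases at earlier points survive since the replaced generator has a nonzero
coefficient. -/
theorem exists_linearIndependent_genSection [Fintype ι] (s : Finset P) (a : P)
    (hs : ∀ a' ∈ s, a' < a) (hb : ∀ i, b i ∈ s) (x : ∀ i, V.obj (b i))
    (hx : ∀ a' ∈ s, NonzeroIsBasis (k := k) (fun i => genSection V b x i a')) :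
    ∃ y : ∀ i, V.obj (b i), (∀ a' ∈ s, NonzeroIsBasis (k := k) (fun i => genSection V b y i a')) ∧
      LinearIndependent k (fun i : {i // genSection V b y i a ≠ 0} => genSection V b y i a) := by
  classical
  induction hn : (Finset.univ.filter fun i => genSection V b x i a ≠ 0).card using
    Nat.strong_induction_on generalizing x with
  | _ n ih =>
  by_cases hli : LinearIndependent k
    (fun i : {i // genSection V b x i a ≠ 0} => genSection V b x i a)
  · exact ⟨x, hx, hli⟩
  obtain ⟨g, hg, i₁, hi₁⟩ := Fintype.not_linearIndependent_iff.1 hli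
  let c : ι → k := fun i => if h : genSection V b x i a ≠ 0 then g ⟨i, h⟩ else 0
  have hc : ∀ i, c i ≠ 0 → genSection V b x i a ≠ 0 := fun i hi h => hi (by simp [c, h])
  have hsum : ∑ i, c i • genSection V b x i a = 0 := by
    rw [← hg, ← Finset.sum_filter_of_ne (p := fun i => genSection V b x i a ≠ 0)]
    · rw [Finset.sum_subtype (p := fun i => genSection V b x i a ≠ 0) _ (by simp)]
      exact Finset.sum_congr rfl fun i _ => by simp only [c, dif_pos i.2]
    · intro i _ hi h
      exact hi (by rw [h, smul_zero])
  -- The combination has to be formed at the birth of the replaced generator, where all others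
  -- involved must already exist; hence the maximal birth.
  obtain ⟨i₀, hi₀, hmax⟩ := Finset.exists_max_image (Finset.univ.filter fun i => c i ≠ 0) b
    ⟨i₁.1, by simpa [c, dif_pos i₁.2] using ⟨i₁.2, hi₁⟩⟩
  simp only [Finset.mem_filter, Finset.mem_univ, true_and] at hi₀ hmax
  have hle : ∀ i, b i ≤ a := fun i => (hs _ (hb i)).le
  refine ih _ ?_ (Function.update x i₀ (∑ i, c i • genSection V b x i (b i₀))) ?_ rfl
  · rw [← hn]
    refine Finset.card_lt_card ⟨fun i => ?_, fun h => ?_⟩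
    · simp only [Finset.mem_filter, Finset.mem_univ, true_and,
        genSection_update x c i₀ hmax a (hle i₀)]
      split_ifs
      · simp [hsum]
      · exact id
    · have := h (Finset.mem_filter.2 ⟨Finset.mem_univ i₀, hc i₀ hi₀⟩)
      simp [genSection_update x c i₀ hmax a (hle i₀), hsum] at this
  · intro a' ha'
    by_cases h : b i₀ ≤ a'
    -- The old generator is still nonzero here because it is nonzero at the later point `a`, so the
    -- replacement cannot increase the number of nonzero sections.
    · have hne : genSection V b x i₀ a' ≠ 0 :=
        genSection_ne_zero_of_le x (hs a' ha').le h (hc i₀ hi₀)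
      simp only [genSection_update x c i₀ hmax a' h]
      obtain ⟨h1, h2⟩ := hx a' ha'
      refine ⟨?_, le_trans (Finset.card_le_card fun i => ?_) h2⟩
      · set w : ι → V.obj a' := fun i =>
          if i = i₀ then ∑ i, c i • genSection V b x i a' else genSection V b x i a' with hw
        rw [eq_top_iff, ← h1, Submodule.span_le]
        rintro _ ⟨i, rfl⟩
        have hmem : ∀ j, w j ∈ Submodule.span k (Set.range w) :=
          fun j => Submodule.subset_span ⟨j, rfl⟩
        have hother : ∀ j, j ≠ i₀ → genSection V b x j a' ∈ Submodule.span k (Set.range w) := by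
          intro j hj
          simpa [hw, hj] using hmem j
        by_cases hi : i = i₀
        · subst hi
          -- The old section is recovered from the new one and the unchanged others, up to the
          -- nonzero factor `c i`.
          have h3 : w i - ∑ j ∈ Finset.univ.erase i, c j • genSection V b x j a' =
              c i • genSection V b x i a' := by
            simp only [hw, if_true]
            rw [← Finset.add_sum_erase _ _ (Finset.mem_univ i)]
            simp
          have h4 : c i • genSection V b x i a' ∈ Submodule.span k (Set.range w) := by
            rw [← h3]
            exact Submodule.sub_mem _ (hmem i) (Submodule.sum_mem _ fun j hj =>
              Submodule.smul_mem _ _ (hother j (Finset.ne_of_mem_erase hj)))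
          exact (Submodule.smul_mem_iff _ hi₀).1 h4
        · exact hother i hi
      · simp only [Finset.mem_filter, Finset.mem_univ, true_and]
        split_ifs with h
        · subst h
          exact fun _ => hne
        · exact id
    · simp only [genSection_update_of_not_le x i₀ _ h]
      exact hx a' ha'

/-- Induction over the points in increasing order: after the generators have been made independent
at the new maximum, a basis of a complement of their span is added as generators born there. -/
theorem exists_genSection_basis [∀ a, FiniteDimensional k (V.obj a)] (s : Finset P) :
    ∃ (ι : Type) (_ : Fintype ι) (b : ι → P) (x : ∀ i, V.obj (b i)), (∀ i, b i ∈ s) ∧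
      ∀ a ∈ s, NonzeroIsBasis (k := k) (fun i => genSection V b x i a) := by
  classical
  induction s using Finset.induction_on_max with
  | empty => exact ⟨Empty, inferInstance, Empty.elim, fun i => i.elim, fun i => i.elim, by simp⟩
  | insert a s hs ih =>
    obtain ⟨ι, _, b, x₀, hb, hx₀⟩ := ih
    obtain ⟨x, hx, hli⟩ := exists_linearIndependent_genSection s a hs hb x₀ hx₀
    set W := Submodule.span k (Set.range fun i => genSection V b x i a) with hW
    obtain ⟨W', hW'⟩ := W.exists_isCompl
    let B := Module.finBasis k W'
    let b' : ι ⊕ Fin (Module.finrank k W') → P := Sum.elim b fun _ => a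
    let x' : ∀ i, V.obj (b' i) := fun i => match i with
      | .inl i => x i
      | .inr j => (B j : V.obj a)
    have hl : ∀ i a', genSection V b' x' (.inl i) a' = genSection V b x i a' := fun i a' => rfl
    refine ⟨ι ⊕ Fin (Module.finrank k W'), inferInstance, b', x', ?_, ?_⟩
    · rintro (i | j)
      · exact Finset.mem_insert_of_mem (hb i)
      · exact Finset.mem_insert_self _ _
    intro a' ha'
    have hcard : (Finset.univ.filter fun i => genSection V b' x' i a' ≠ 0).card =
        (Finset.univ.filter fun i => genSection V b x i a' ≠ 0).card +
        (Finset.univ.filter fun j => genSection V b' x' (.inr j) a' ≠ 0).card := by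
      simp only [Finset.card_filter, Fintype.sum_sum_type, hl]
    obtain rfl | ha' := Finset.mem_insert.1 ha'
    · have hr : ∀ j, genSection V b' x' (.inr j) a' = B j := fun j => by
        rw [genSection]
        exact (dif_pos le_rfl).trans (push_refl V _ _)
      constructor
      · rw [eq_top_iff, ← hW'.sup_eq_top, sup_le_iff]
        constructor
        · refine Submodule.span_mono ?_
          rintro _ ⟨i, rfl⟩
          exact ⟨.inl i, rfl⟩
        · have h1 : W' = (Submodule.span k (Set.range B)).map W'.subtype := by
            simp [B.span_eq]
          refine h1.le.trans ?_
          rw [Submodule.map_span, ← Set.range_comp]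
          refine Submodule.span_mono ?_
          rintro _ ⟨j, rfl⟩
          exact ⟨.inr j, hr j⟩
      · rw [hcard, ← Submodule.finrank_add_eq_of_isCompl hW']
        refine add_le_add ?_ ?_
        · have := finrank_span_eq_card hli
          rw [span_range_subtype_ne_zero (fun i => genSection V b x i a')] at this
          rw [hW, this, Fintype.card_subtype]
        · exact (Finset.card_le_univ _).trans (by simp)
    -- At earlier points the new generators are not yet born, so nothing changes.
    · have hr : ∀ j, genSection V b' x' (.inr j) a' = 0 := fun j =>
        genSection_of_not_le x' (hs a' ha').not_ge
      obtain ⟨h1, h2⟩ := hx a' ha'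
      constructor
      · rw [eq_top_iff, ← h1]
        refine Submodule.span_mono ?_
        rintro _ ⟨i, rfl⟩
        exact ⟨.inl i, rfl⟩
      · rw [hcard]
        simpa [hr] using h2

theorem exists_bars_isIntervalBasis [Finite P] [∀ a, FiniteDimensional k (V.obj a)] :
    ∃ (ι : Type) (_ : Fintype ι) (bar : ι → NonemptyInterval P) (z : ι → ∀ a, V.obj a),
      IsIntervalBasis V (fun i => .icc (bar i).fst (bar i).snd (bar i).fst_le_snd) z := by
  classical
  cases nonempty_fintype P
  obtain ⟨ι, _, b, x, -, hx⟩ := exists_genSection_basis (V := V) Finset.univ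
  -- A generator lives from its birth to the last point where its image is nonzero. Zero generators
  -- have no such point and are discarded.
  have hd : ∀ i : {i // x i ≠ 0}, ∃ d, genSection V b x i d ≠ 0 ∧
      ∀ a, genSection V b x i a ≠ 0 → a ≤ d := by
    intro i
    obtain ⟨d, hd, hmax⟩ := Finset.exists_max_image
      (Finset.univ.filter fun a => genSection V b x i a ≠ 0) id
      ⟨b i, by simpa [genSection, push_refl] using i.2⟩
    exact ⟨d, by simpa using hd, by simpa using hmax⟩
  choose d hd hmax using hd
  have hbd : ∀ i, b i.1 ≤ d i := fun i => by
    by_contra h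
    exact hd i (genSection_of_not_le x h)
  have hmem : ∀ i a, (b i.1 ≤ a ∧ a ≤ d i) ↔ genSection V b x i a ≠ 0 := fun i a =>
    ⟨fun h => genSection_ne_zero_of_le x h.2 h.1 (hd i), fun h =>
      ⟨by_contra fun h' => h (genSection_of_not_le x h'), hmax i a h⟩⟩
  have hli : ∀ a, LinearIndependent k (fun i : {i : {i // x i ≠ 0} // b i.1 ≤ a ∧ a ≤ d i} =>
      genSection V b x i.1.1 a) := fun a => by
    have h := (hx a (Finset.mem_univ a)).linearIndependent
    have hinj : Function.Injective
        (fun i : {i : {i // x i ≠ 0} // b i.1 ≤ a ∧ a ≤ d i} =>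
          (⟨i.1.1, (hmem i.1 a).1 i.2⟩ : {i // genSection V b x i a ≠ 0})) := fun i j h => by
      have := congrArg Subtype.val h
      exact Subtype.ext (Subtype.ext this)
    exact h.comp _ hinj
  refine ⟨{i // x i ≠ 0}, inferInstance, fun i => ⟨⟨b i, d i⟩, hbd i⟩,
    fun i a => genSection V b x i a, ?_, ?_, hli, fun a => ?_⟩
  · intro i a h
    by_contra h0
    exact h ((hmem i a).2 h0)
  · intro i a a' h ha
    exact push_genSection x h ha.1
  · rw [eq_top_iff, ← (hx a (Finset.mem_univ a)).1, Submodule.span_le]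
    rintro _ ⟨i, rfl⟩
    by_cases h : x i = 0
    · simp [genSection, h]
    · exact Submodule.subset_span ⟨⟨i, h⟩, rfl⟩

end Chain

theorem exists_bar_isIntervalBasis {k : Type u} [Field k] {n : ℕ}
    (V : PathPoset n ⥤ ModuleCat.{v} k) [∀ a, FiniteDimensional k (V.obj a)] :
    ∃ (N : ℕ) (bar : Fin N → Bar n) (z : Fin N → ∀ a, V.obj a),
      IsIntervalBasis V (fun i => (bar i).toInterval) z := by
  obtain ⟨ι, _, bar, z, h⟩ := exists_bars_isIntervalBasis (V := V)
  let e := (Fintype.equivFin ι).symm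
  exact ⟨Fintype.card ι, bar ∘ e, z ∘ e, h.reindex e⟩

theorem nonempty_pathDecomposition {k : Type u} [Field k] {n : ℕ}
    (V : PathPoset n ⥤ ModuleCat.{v} k) (h : ∀ a, FiniteDimensional k (V.obj a)) :
    Nonempty (PathDecomposition V) := by
  obtain ⟨N, bar, z, hz⟩ := exists_bar_isIntervalBasis V
  exact ⟨⟨N, bar, hz.persIso⟩⟩

/-! ### Morphisms between interval modules of bars -/

section DomRel

variable {k : Type u} [Field k] {n : ℕ}

/-- Take a point `a` where the morphism is nonzero; it lies in both bars. If `I` began before `J`,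
the vector at `a` would come from a point where the target is zero. If `I` ended before `J`, the
vector would die in the source while its nonzero image survives up to the end of `J`. -/
theorem le_of_domRel {I J : Bar n} (h : DomRel k I J) : J.fst ≤ I.fst ∧ J.snd ≤ I.snd := by
  obtain ⟨f, hf⟩ := h
  have hnat : ∀ {a b : PathPoset n} (hab : a ≤ b) (x : (intervalModule k I.toInterval).obj a),
      (f.app b).hom (push _ hab x) = push _ hab ((f.app a).hom x) := fun hab x => by
    have := congrArg (fun g => g.hom x) (f.naturality (homOfLE hab))
    exact this
  obtain ⟨a, x, hx⟩ : ∃ a, ∃ x : (intervalModule k I.toInterval).obj a,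
      (f.app a).hom x ≠ 0 := by
    by_contra! h
    refine hf (NatTrans.ext (funext fun a => ModuleCat.hom_ext (LinearMap.ext fun x => ?_)))
    exact h a x
  obtain ⟨t, ht⟩ : ∃ t, (f.app a).hom x t ≠ 0 := by
    by_contra! h
    exact hx (funext h)
  have haJ : J.fst ≤ a ∧ a ≤ J.snd := t.down
  have haI : I.fst ≤ a ∧ a ≤ I.snd := by
    by_contra h
    have : x = 0 := funext fun s => (h s.down).elim
    exact hx (by rw [this, map_zero])
  constructor
  · by_contra! hlt
    let y : (intervalModule k I.toInterval).obj I.fst := fun _ => x ⟨haI⟩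
    have hy : push (intervalModule k I.toInterval) haI.1 y = x := by
      funext s
      exact dif_pos (show I.fst ∈ I.toInterval.carrier from ⟨le_rfl, I.fst_le_snd⟩)
    have h0 : (f.app I.fst).hom y = 0 :=
      funext fun s => ((show J.fst ≤ I.fst from s.down.1).not_gt hlt).elim
    have := hnat haI.1 y
    rw [hy, h0, map_zero] at this
    exact hx this
  · by_contra! hlt
    have h0 : push (intervalModule k I.toInterval) haJ.2 x = 0 :=
      funext fun s => ((show J.snd ≤ I.snd from s.down.2).not_gt hlt).elim
    have := hnat haJ.2 x
    rw [h0, map_zero] at this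
    have h1 : push (intervalModule k J.toInterval) haJ.2 ((f.app a).hom x)
        ⟨J.fst_le_snd, le_rfl⟩ = (f.app a).hom x t := dif_pos t.down
    rw [← this] at h1
    exact ht h1.symm

open Classical in
-- The morphism is the identity on the overlap, which runs from `I.fst` to `J.snd`. It is natural
-- because the overlap is an upper part of `J` and a lower part of `I`.
theorem domRel_of_le {I J : Bar n} (h₁ : J.fst ≤ I.fst) (h₂ : I.fst ≤ J.snd)
    (h₃ : J.snd ≤ I.snd) : DomRel k I J := by
  let g : ∀ a, (PLift (a ∈ I.toInterval.carrier) → k) →ₗ[k]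
      (PLift (a ∈ J.toInterval.carrier) → k) := fun a =>
    LinearMap.pi fun _ => if h : a ∈ I.toInterval.carrier then LinearMap.proj ⟨h⟩ else 0
  have hg : ∀ a x t, g a x t = if h : a ∈ I.toInterval.carrier then x ⟨h⟩ else 0 := by
    intro a x t
    by_cases h : a ∈ I.toInterval.carrier <;> simp [g, h]
  refine ⟨⟨fun a => ModuleCat.ofHom (g a), fun a b f =>
    ModuleCat.hom_ext (LinearMap.ext fun x => funext fun t => ?_)⟩, fun h0 => ?_⟩
  · have hab := leOfHom f
    have hbJ : J.fst ≤ b ∧ b ≤ J.snd := t.down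
    have hL : g b (((intervalModule k I.toInterval).map f).hom x) t =
        if hb : b ∈ I.toInterval.carrier then
          if ha : a ∈ I.toInterval.carrier then x ⟨ha⟩ else 0 else 0 := hg b _ t
    have hR : ((intervalModule k J.toInterval).map f).hom (g a x) t =
        if haJ : a ∈ J.toInterval.carrier then g a x ⟨haJ⟩ else 0 := rfl
    refine hL.trans (Eq.trans ?_ hR.symm)
    by_cases ha : a ∈ I.toInterval.carrier
    · have ha' : I.fst ≤ a ∧ a ≤ I.snd := ha
      have hb : b ∈ I.toInterval.carrier :=
        (⟨ha'.1.trans hab, hbJ.2.trans h₃⟩ : I.fst ≤ b ∧ b ≤ I.snd)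
      have haJ : a ∈ J.toInterval.carrier :=
        (⟨h₁.trans ha'.1, hab.trans hbJ.2⟩ : J.fst ≤ a ∧ a ≤ J.snd)
      rw [dif_pos hb, dif_pos ha, dif_pos haJ]
      exact ((hg a x ⟨haJ⟩).trans (dif_pos ha)).symm
    · rw [dif_neg ha, dite_eq_ite, ite_self]
      split_ifs with haJ
      · exact ((hg a x ⟨haJ⟩).trans (dif_neg ha)).symm
      · rfl
  · have hI : I.fst ∈ I.toInterval.carrier := (⟨le_rfl, I.fst_le_snd⟩ : I.fst ≤ I.fst ∧ _)
    have hJ : I.fst ∈ J.toInterval.carrier := (⟨h₁, h₂⟩ : J.fst ≤ I.fst ∧ _)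
    have h := hg I.fst (fun _ => 1) ⟨hJ⟩
    rw [dif_pos hI] at h
    have h' := congrArg (fun f => (f.app I.fst).hom (fun _ => 1) ⟨hJ⟩) h0
    exact one_ne_zero (h.symm.trans h')

theorem le_of_eq_or_strictSub {I J : Bar n} (h : I = J ∨ StrictSub k I J) :
    I.fst ≤ J.fst ∧ I.snd ≤ J.snd := by
  obtain rfl | h := h
  · exact ⟨le_rfl, le_rfl⟩
  · exact le_of_domRel h.1

/-- The condition that the bars overlap costs nothing in the reduction, where one of them always
begins at 0̂ or ends at 1̂ on the relevant side. -/
theorem eq_or_strictSub_of_le {I J : Bar n} (h₁ : I.fst ≤ J.fst) (h₂ : J.fst ≤ I.snd)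
    (h₃ : I.snd ≤ J.snd) : I = J ∨ StrictSub k I J := by
  by_cases h : I = J
  · exact Or.inl h
  · exact Or.inr ⟨domRel_of_le h₁ h₂ h₃, Ne.symm h⟩

end DomRel

/-! ### One-way reduction -/

section OneWay

variable {k : Type u} [Field k] {ρ κ : Type} [Fintype ρ] [LinearOrder ρ] [LinearOrder κ]

open Classical in
theorem oneWayStep_spec (B : Matrix ρ κ k) (c : κ) (h : ∃ i, B i c ≠ 0) :
    ∃ (row : ρ) (A₁ A₂ : Matrix ρ κ k), B row c ≠ 0 ∧ (∀ i, row < i → B i c = 0) ∧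
      (∀ i j, A₁ i j = if i = row then (B row c)⁻¹ * B i j else B i j) ∧
      (∀ i j, A₂ i j = if c < j then A₁ i j - A₁ row j * A₁ i c else A₁ i j) ∧
      ∀ i j, oneWayStep B c i j = if i < row then A₂ i j - A₂ i c * A₂ row j else A₂ i j := by
  have hN : (Finset.univ.filter fun i => B i c ≠ 0).Nonempty := by
    obtain ⟨i, hi⟩ := h
    exact ⟨i, by simpa using hi⟩
  refine ⟨(Finset.univ.filter fun i => B i c ≠ 0).max' hN, _, _, ?_, fun i hi => ?_,
    fun _ _ => rfl, fun _ _ => rfl, fun i j => ?_⟩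
  · simpa using Finset.max'_mem _ hN
  · by_contra h
    exact hi.not_ge (Finset.le_max' _ i (by simpa using h))
  · exact congrFun (congrFun (dif_pos hN : oneWayStep B c = _) i) j

open Classical in
theorem oneWayStep_of_eq_zero (B : Matrix ρ κ k) (c : κ) (h : ∀ i, B i c = 0) :
    oneWayStep B c = B := by
  have hN : ¬ (Finset.univ.filter fun i => B i c ≠ 0).Nonempty := by simp [h]
  exact dif_neg hN

/-- Invariant: each treated column, and the row of its pivot, is a unit vector. The predicate `Q`
stands for whatever guarantees that no column ever vanishes. A new pivot avoids the old pivot rows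
because these are zero in the current column, so the operations do not disturb the treated columns;
to the left of the new pivot its row is already zero, and below it the column is zero by the choice
of the lowest row. -/
theorem foldl_oneWayStep (Q : Matrix ρ κ k → Prop) (hstep : ∀ B c, Q B → Q (oneWayStep B c))
    (hne : ∀ B c, Q B → ∃ i, B i c ≠ 0) (l : List κ) (hl : l.Pairwise (· < ·))
    (hlt : ∀ d, d ∉ l → ∀ c ∈ l, d < c) (B : Matrix ρ κ k) (hB : Q B)
    (hf : ∃ f : κ → ρ, ∀ d, d ∉ l → (∀ i, B i d = if f d = i then 1 else 0) ∧
      ∀ j, B (f d) j = if d = j then 1 else 0) :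
    Q (l.foldl oneWayStep B) ∧ ∃ f : κ → ρ, ∀ d,
      (∀ i, l.foldl oneWayStep B i d = if f d = i then 1 else 0) ∧
        ∀ j, l.foldl oneWayStep B (f d) j = if d = j then 1 else 0 := by
  classical
  induction l generalizing B with
  | nil => exact ⟨hB, by simpa using hf⟩
  | cons c l ih =>
    obtain ⟨f, hf⟩ := hf
    rw [List.pairwise_cons] at hl
    have hcl : c ∉ l := fun h => lt_irrefl c (hl.1 c h)
    rw [List.foldl_cons]
    refine ih hl.2 ?_ _ (hstep B c hB) ?_
    · intro d hd c' hc'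
      by_cases h : d = c
      · exact h ▸ hl.1 c' hc'
      · exact hlt d (by simp [h, hd]) c' (by simp [hc'])
    obtain ⟨row, A₁, A₂, ha, hgt, hA₁, hA₂, hstep'⟩ := oneWayStep_spec B c (hne B c hB)
    have hdlt : ∀ d, d ∉ c :: l → d < c := fun d hd => hlt d hd c (by simp)
    have hfc : ∀ d, d ∉ c :: l → B (f d) c = 0 := fun d hd => by
      rw [(hf d hd).2, if_neg (hdlt d hd).ne]
    have hfr : ∀ d, d ∉ c :: l → f d ≠ row := fun d hd h => ha (h ▸ hfc d hd)
    have hrd : ∀ d, d ∉ c :: l → B row d = 0 := fun d hd => by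
      rw [(hf d hd).1, if_neg (hfr d hd)]
    simp only [hA₂, hA₁, lt_irrefl, if_true, if_false] at hstep'
    refine ⟨Function.update f c row, fun d hd => ?_⟩
    by_cases hdc : d = c
    · subst hdc
      rw [Function.update_self]
      constructor
      · intro i
        rw [hstep']
        rcases lt_trichotomy i row with h | h | h
        · simp [h, h.ne, h.ne', ha]
        · simp [h, ha]
        · simp [h.not_gt, h.ne, h.ne', hgt i h]
      · intro j
        rw [hstep']
        rcases lt_trichotomy d j with h | h | h
        · simp [h, h.ne, ha]
        · subst h
          simp [ha]
        · have : j ∉ d :: l := by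
            simp only [List.mem_cons, not_or]
            exact ⟨h.ne, fun hj => (hl.1 j hj).not_gt h⟩
          simp [h.not_gt, h.ne', hrd j this]
    · have hd' : d ∉ c :: l := by simp [hdc, hd]
      rw [Function.update_of_ne hdc]
      constructor
      · intro i
        rw [hstep', ← (hf d hd').1 i]
        by_cases hi : i = row
        · subst hi
          simp [hrd d hd', (hdlt d hd').not_gt]
        · simp [hrd d hd', (hdlt d hd').not_gt, hi]
      · intro j
        rw [hstep', ← (hf d hd').2 j]
        simp [hfc d hd', hfr d hd']

/-- The map of pivots is injective because each pivot row has its only nonzero entry in its own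
column. -/
theorem oneWayReduce_eq_permutation [Fintype κ] (Q : Matrix ρ κ k → Prop)
    (hstep : ∀ B c, Q B → Q (oneWayStep B c)) (hne : ∀ B c, Q B → ∃ i, B i c ≠ 0)
    (B : Matrix ρ κ k) (hB : Q B) : Q (oneWayReduce B) ∧ ∃ f : κ → ρ, Function.Injective f ∧
      ∀ i j, oneWayReduce B i j = if f j = i then 1 else 0 := by
  obtain ⟨h, f, hf⟩ := foldl_oneWayStep Q hstep hne (Finset.univ.sort (· ≤ ·) : List κ)
    (Finset.sortedLT_sort _).pairwise (by simp) B hB (by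
      -- No column has been treated yet, so every map from columns to rows will do; without rows
      -- there are no columns either, by `hne`.
      by_cases hρ : Nonempty ρ
      · exact ⟨fun _ => hρ.some, by simp⟩
      · exact ⟨fun c => (hρ ⟨(hne B c hB).choose⟩).elim, by simp⟩)
  refine ⟨h, f, fun c d hcd => ?_, fun i j => (hf j).1 i⟩
  have h1 := (hf c).2 d
  rw [(hf d).1, if_pos hcd.symm] at h1
  by_contra hne
  simp [hne] at h1

end OneWay

/-! ### Sequences of elementary operations on block matrices -/

namespace BlockProblem

variable {k : Type u} [Field k] {n m : ℕ} {M : BlockProblem k n m}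
  {okC : Fin M.cols.num → Fin M.cols.num → Prop} {okR : Fin M.rows.num → Fin M.rows.num → Prop}

theorem Op.mono {okC' : Fin M.cols.num → Fin M.cols.num → Prop}
    {okR' : Fin M.rows.num → Fin M.rows.num → Prop} (hC : ∀ s t, okC s t → okC' s t)
    (hR : ∀ s t, okR s t → okR' s t) {A B : M.Mat} (h : M.Op okC okR A B) :
    M.Op okC' okR' A B := by
  cases h with
  | scaleCol t c hc h => exact .scaleCol A t c hc (hC _ _ h)
  | swapCol s t h h' => exact .swapCol A s t (hC _ _ h) (hC _ _ h')
  | addCol s t c hst h => exact .addCol A s t c hst (hC _ _ h)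
  | scaleRow t c hc h => exact .scaleRow A t c hc (hR _ _ h)
  | swapRow s t h h' => exact .swapRow A s t (hR _ _ h) (hR _ _ h')
  | addRow s t c hst h => exact .addRow A s t c hst (hR _ _ h)

theorem reflTransGen_congr {A X Y : M.Mat} (h : ∀ p q, X p q = Y p q)
    (hY : Relation.ReflTransGen (M.Op okC okR) A Y) :
    Relation.ReflTransGen (M.Op okC okR) A X :=
  (Matrix.ext h : X = Y) ▸ hY

open Classical in
-- The condition `hc` says that a source column is never a target. The additions are then
-- independent of each other and can be carried out one at a time, with the source columns still
-- those of `A`.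
theorem reflTransGen_addCols (A : M.Mat) (c : Fin M.cols.num → Fin M.cols.num → k)
    (hok : ∀ s t, c s t ≠ 0 → s ≠ t ∧ okC s t) (hc : ∀ r s t, c s t ≠ 0 → c r s = 0) :
    Relation.ReflTransGen (M.Op okC okR) A (fun p q =>
      if M.StronglyZero p q then A p q else A p q + ∑ s, c s q * A p s) := by
  have key : ∀ F : Finset (Fin M.cols.num × Fin M.cols.num),
      Relation.ReflTransGen (M.Op okC okR) A (fun p q =>
        if M.StronglyZero p q then A p q else
          A p q + ∑ x ∈ F, if x.2 = q then c x.1 q * A p x.1 else 0) := by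
    intro F
    induction F using Finset.induction_on with
    | empty =>
      refine reflTransGen_congr (fun p q => ?_) .refl
      simp
    | insert x F hx ih =>
      obtain ⟨s, t⟩ := x
      by_cases h0 : c s t = 0
      · refine reflTransGen_congr (fun p q => ?_) ih
        rw [Finset.sum_insert hx]
        by_cases h : t = q
        · subst h; simp [h0]
        · simp [h]
      · obtain ⟨hst, hs⟩ := hok s t h0
        refine reflTransGen_congr (fun p q => ?_) (ih.tail (.addCol _ s t (c s t) hst hs))
        have h1 : ∑ x ∈ F, (if x.2 = s then c x.1 s * A p x.1 else 0) = 0 :=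
          Finset.sum_eq_zero fun x _ => by simp [hc x.1 s t h0]
        rw [h1, add_zero, ite_self, Finset.sum_insert hx]
        by_cases hz : M.StronglyZero p q
        · simp [hz]
        · by_cases h : q = t
          · subst h; simp [hz]; ring
          · simp [hz, h, Ne.symm h]
  refine reflTransGen_congr (fun p q => ?_) (key Finset.univ)
  rw [Fintype.sum_prod_type]
  simp

open Classical in
theorem reflTransGen_addRows (A : M.Mat) (c : Fin M.rows.num → Fin M.rows.num → k)
    (hok : ∀ s t, c s t ≠ 0 → s ≠ t ∧ okR s t) (hc : ∀ r s t, c s t ≠ 0 → c r s = 0) :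
    Relation.ReflTransGen (M.Op okC okR) A (fun p q =>
      if M.StronglyZero p q then A p q else A p q + ∑ s, c s p * A s q) := by
  have key : ∀ F : Finset (Fin M.rows.num × Fin M.rows.num),
      Relation.ReflTransGen (M.Op okC okR) A (fun p q =>
        if M.StronglyZero p q then A p q else
          A p q + ∑ x ∈ F, if x.2 = p then c x.1 p * A x.1 q else 0) := by
    intro F
    induction F using Finset.induction_on with
    | empty =>
      refine reflTransGen_congr (fun p q => ?_) .refl
      simp
    | insert x F hx ih =>
      obtain ⟨s, t⟩ := x
      by_cases h0 : c s t = 0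
      · refine reflTransGen_congr (fun p q => ?_) ih
        rw [Finset.sum_insert hx]
        by_cases h : t = p
        · subst h; simp [h0]
        · simp [h]
      · obtain ⟨hst, hs⟩ := hok s t h0
        refine reflTransGen_congr (fun p q => ?_) (ih.tail (.addRow _ s t (c s t) hst hs))
        have h1 : ∑ x ∈ F, (if x.2 = s then c x.1 s * A x.1 q else 0) = 0 :=
          Finset.sum_eq_zero fun x _ => by simp [hc x.1 s t h0]
        rw [h1, add_zero, ite_self, Finset.sum_insert hx]
        by_cases hz : M.StronglyZero p q
        · simp [hz]
        · by_cases h : p = t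
          · subst h; simp [hz]; ring
          · simp [hz, h, Ne.symm h]
  refine reflTransGen_congr (fun p q => ?_) (key Finset.univ)
  rw [Fintype.sum_prod_type]
  simp

/-- Permutations are products of transpositions, and these are among the operations. -/
theorem reflTransGen_permuteCols (A : M.Mat) (S : Fin M.cols.num → Prop)
    (hS : ∀ s t, S s → S t → okC s t) (σ : Equiv.Perm {q // S q}) [DecidablePred S] :
    Relation.ReflTransGen (M.Op okC okR) A (fun p q => A p (Equiv.Perm.ofSubtype σ q)) := by
  induction σ using Equiv.Perm.swap_induction_on' with
  | one => simpa using Relation.ReflTransGen.refl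
  | mul_swap σ s t _ ih =>
    convert ih.tail (.swapCol _ s.1 t.1 (hS _ _ s.2 t.2) (hS _ _ t.2 s.2)) using 4 with p q
    simp [map_mul, Equiv.Perm.ofSubtype_swap_eq]

open Classical in
/-- A step of the one-way reduction of a block can be carried out by elementary operations on the
whole matrix. These operations do not change anything outside of the block if there are only
zeros beside it. -/
theorem exists_reflTransGen_oneWayStep {R : Fin M.rows.num → Prop} {C : Fin M.cols.num → Prop}
    (hRC : ∀ p q, R p → C q → ¬ M.StronglyZero p q)
    (hC : ∀ s t, C s → C t → s < t → okC s t) (hR : ∀ s t, R s → R t → t ≤ s → okR s t)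
    (A : M.Mat) (B : Matrix {i // R i} {j // C j} k)
    (hAB : ∀ (i : {i // R i}) (j : {j // C j}), A i.1 j.1 = B i j) (col : {j // C j}) :
    ∃ A' : M.Mat, Relation.ReflTransGen (M.Op okC okR) A A' ∧
      (∀ (i : {i // R i}) (j : {j // C j}), A' i.1 j.1 = oneWayStep B col i j) ∧
      ((∀ p q, ¬ (R p ↔ C q) → A p q = 0) → ∀ p q, ¬ (R p ∧ C q) → A' p q = A p q) := by
  by_cases hB : ∃ i, B i col ≠ 0
  swap
  · push Not at hB
    rw [oneWayStep_of_eq_zero B col hB]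
    exact ⟨A, .refl, hAB, fun _ _ _ _ => rfl⟩
  obtain ⟨row, B₁, B₂, ha, -, hB₁, hB₂, hstep⟩ := oneWayStep_spec B col hB
  let A₁ : M.Mat := fun p q => if p = row.1 then (B row col)⁻¹ * A p q else A p q
  have h₁ : Relation.ReflTransGen (M.Op okC okR) A A₁ :=
    .single (.scaleRow A row.1 _ (inv_ne_zero ha) (hR _ _ row.2 row.2 le_rfl))
  let c : Fin M.cols.num → Fin M.cols.num → k := fun s t =>
    if s = col.1 then if col.1 < t ∧ C t then - A₁ row.1 t else 0 else 0
  let A₂ : M.Mat := fun p q => if M.StronglyZero p q then A₁ p q else A₁ p q + ∑ s, c s q * A₁ p s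
  have h₂ : Relation.ReflTransGen (M.Op okC okR) A₁ A₂ := by
    refine reflTransGen_addCols A₁ c (fun s t h => ?_) (fun r s t h => ?_)
    · have hs : s = col.1 := by by_contra h'; simp [c, h'] at h
      have ht : col.1 < t ∧ C t := by by_contra h'; simp [c, h'] at h
      subst hs
      exact ⟨ht.1.ne, hC _ _ col.2 ht.2 ht.1⟩
    · have hs : s = col.1 := by by_contra h'; simp [c, h'] at h
      simp [c, hs]
  have hA₂ : ∀ p q, A₂ p q = if ¬ M.StronglyZero p q ∧ col.1 < q ∧ C q then
      A₁ p q - A₁ row.1 q * A₁ p col.1 else A₁ p q := by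
    intro p q
    by_cases hz : M.StronglyZero p q
    · simp [A₂, hz]
    · by_cases hq : col.1 < q ∧ C q
      · simp [A₂, hz, c, hq, sub_eq_add_neg]
      · simp only [A₂, c, if_neg hz, hq, and_false, if_false, ite_self, zero_mul,
          Finset.sum_const_zero, add_zero]
  let d : Fin M.rows.num → Fin M.rows.num → k := fun s t =>
    if s = row.1 then if t < row.1 ∧ R t then - A₂ t col.1 else 0 else 0
  let A₃ : M.Mat := fun p q => if M.StronglyZero p q then A₂ p q else A₂ p q + ∑ s, d s p * A₂ s q
  have h₃ : Relation.ReflTransGen (M.Op okC okR) A₂ A₃ := by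
    refine reflTransGen_addRows A₂ d (fun s t h => ?_) (fun r s t h => ?_)
    · have hs : s = row.1 := by by_contra h'; simp [d, h'] at h
      have ht : t < row.1 ∧ R t := by by_contra h'; simp [d, h'] at h
      subst hs
      exact ⟨ht.1.ne', hR _ _ row.2 ht.2 ht.1.le⟩
    · have hs : s = row.1 := by by_contra h'; simp [d, h'] at h
      simp [d, hs]
  have hA₃ : ∀ p q, A₃ p q = if ¬ M.StronglyZero p q ∧ p < row.1 ∧ R p then
      A₂ p q - A₂ p col.1 * A₂ row.1 q else A₂ p q := by
    intro p q
    by_cases hz : M.StronglyZero p q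
    · simp [A₃, hz]
    · by_cases hp : p < row.1 ∧ R p
      · simp [A₃, hz, d, hp, sub_eq_add_neg]
      · simp only [A₃, d, if_neg hz, hp, and_false, if_false, ite_self, zero_mul,
          Finset.sum_const_zero, add_zero]
  refine ⟨A₃, (h₁.trans h₂).trans h₃, ?_, fun h0 p q hpq => ?_⟩
  · have e₁ : ∀ (i : {i // R i}) (j : {j // C j}), A₁ i.1 j.1 = B₁ i j := fun i j => by
      simp only [A₁, hAB, hB₁, Subtype.ext_iff]
    have e₂ : ∀ (i : {i // R i}) (j : {j // C j}), A₂ i.1 j.1 = B₂ i j := fun i j => by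
      rw [hA₂, hB₂]
      simp only [hRC _ _ i.2 j.2, j.2, e₁, not_false_eq_true, true_and, and_true,
        Subtype.coe_lt_coe]
    intro i j
    rw [hA₃, hstep]
    simp only [hRC _ _ i.2 j.2, i.2, e₂, not_false_eq_true, true_and, and_true,
      Subtype.coe_lt_coe]
  -- The pivot row and the pivot column vanish outside the block, so the row and column operations
  -- add only zeros there.
  · have z₁ : ∀ p q, ¬ (R p ↔ C q) → A₁ p q = 0 := fun p q h => by simp [A₁, h0 p q h]
    have z₂ : ∀ p q, ¬ (R p ↔ C q) → A₂ p q = 0 := fun p q h => by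
      rw [hA₂, z₁ p q h]
      split_ifs with h'
      · rw [z₁ p col.1 (fun h'' => h ⟨fun _ => h'.2.2, fun _ => h''.2 col.2⟩)]
        simp
      · rfl
    by_cases hp : R p
    · have hq : ¬ C q := fun hq => hpq ⟨hp, hq⟩
      have hn : ¬ (R p ↔ C q) := fun h => hq (h.1 hp)
      have hn' : ¬ (R row.1 ↔ C q) := fun h => hq (h.1 row.2)
      rw [hA₃, z₂ p q hn, z₂ _ q hn', h0 p q hn]
      simp
    · have hpr : p ≠ row.1 := fun h => hp (h ▸ row.2)
      have hn : ¬ (R p ↔ C col.1) := fun h => hp (h.2 col.2)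
      rw [hA₃, if_neg (fun h => hp h.2.2), hA₂, z₁ p _ hn]
      simp [A₁, hpr]

end BlockProblem

/-! ### Changing interval bases over paths -/

section BarBasis

variable {k : Type u} [Field k] {n N : ℕ} {V : PathPoset n ⥤ ModuleCat.{v} k}
  {bar : Fin N → Bar n} {z : Fin N → ∀ a, V.obj a}

open Classical in
/-- Replace the section `z t` by the section `c₁ • z t + c₂ • z s`. -/
noncomputable def combineSection (bar : Fin N → Bar n) (z : Fin N → ∀ a, V.obj a) (s t : Fin N)
    (c₁ c₂ : k) (i : Fin N) (a : PathPoset n) : V.obj a :=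
  -- The cut-off matters: `z s` may be born before `z t`, and its early part must not enter a
  -- section supported on the bar `t`.
  if i = t then if (bar t).fst ≤ a then c₁ • z t a + c₂ • z s a else 0 else z i a

theorem IsIntervalBasis.combineSection (hz : IsIntervalBasis V (fun i => (bar i).toInterval) z)
    {s t : Fin N} {c₁ c₂ : k} (h₁ : c₁ ≠ 0) (h₂ : c₂ ≠ 0 → s ≠ t)
    (hle : (bar s).fst ≤ (bar t).fst ∧ (bar s).snd ≤ (bar t).snd) :
    IsIntervalBasis V (fun i => (bar i).toInterval) (combineSection bar z s t c₁ c₂) := by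
  have hzero : ∀ i a, ¬ ((bar i).fst ≤ a ∧ a ≤ (bar i).snd) → z i a = 0 := fun i a h =>
    hz.zero i a h
  refine hz.of_span (fun i a h => ?_) (fun i a a' h ha => ?_) (fun i a => ?_)
  · by_cases hi : i = t
    · subst hi
      simp only [_root_.combineSection, if_true]
      split_ifs with ha
      · have ha' : ¬ a ≤ (bar i).snd := fun h' => h ⟨ha, h'⟩
        rw [hzero i a (fun h' => ha' h'.2), hzero s a (fun h' => ha' (h'.2.trans hle.2))]
        simp
      · rfl
    · simp only [_root_.combineSection, if_neg hi]
      exact hz.zero i a h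
  · have ha : (bar i).fst ≤ a ∧ a ≤ (bar i).snd := ha
    by_cases hi : i = t
    · subst hi
      simp only [_root_.combineSection, if_true, if_pos ha.1, if_pos (ha.1.trans h), map_add,
        map_smul]
      rw [hz.map i h ha]
      congr 2
      -- The bar `s` is already born at `a`; if it has died, its section is zero at both points.
      by_cases hs : a ≤ (bar s).snd
      · exact hz.map s h ⟨hle.1.trans ha.1, hs⟩
      · rw [hzero s a (fun h' => hs h'.2), hzero s a' (fun h' => hs (h.trans h'.2)), map_zero]
    · simp only [_root_.combineSection, if_neg hi]
      exact hz.map i h ha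
  · have hmem : ∀ i, _root_.combineSection bar z s t c₁ c₂ i a ∈ Submodule.span k
        (Set.range fun i => _root_.combineSection bar z s t c₁ c₂ i a) :=
      fun i => Submodule.subset_span ⟨i, rfl⟩
    have hother : ∀ i, i ≠ t → z i a ∈ Submodule.span k
        (Set.range fun i => _root_.combineSection bar z s t c₁ c₂ i a) := fun i hi => by
      have := hmem i
      rwa [_root_.combineSection, if_neg hi] at this
    by_cases hi : i = t
    · subst hi
      by_cases ha : (bar i).fst ≤ a
      · have h3 := hmem i
        rw [_root_.combineSection, if_pos rfl, if_pos ha] at h3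
        have h4 : c₂ • z s a ∈ Submodule.span k
            (Set.range fun j => _root_.combineSection bar z s i c₁ c₂ j a) := by
          by_cases hc : c₂ = 0
          · simp [hc]
          · exact Submodule.smul_mem _ _ (hother s (h₂ hc))
        exact (Submodule.smul_mem_iff _ h₁).1 ((Submodule.add_mem_iff_left _ h4).1 h3)
      · rw [hzero i a (fun h' => ha h'.1)]
        exact Submodule.zero_mem _
    · exact hother i hi

theorem IsIntervalBasis.swap (hz : IsIntervalBasis V (fun i => (bar i).toInterval) z)
    {s t : Fin N} (h : bar s = bar t) :
    IsIntervalBasis V (fun i => (bar i).toInterval) (fun i => z (Equiv.swap s t i)) := by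
  have h' : (fun i => (bar i).toInterval) ∘ Equiv.swap s t = fun i => (bar i).toInterval := by
    funext i
    simp only [Function.comp_apply]
    by_cases h1 : i = s
    · subst h1; rw [Equiv.swap_apply_left, h]
    · by_cases h2 : i = t
      · subst h2; rw [Equiv.swap_apply_right, h]
      · rw [Equiv.swap_apply_of_ne_of_ne h1 h2]
  have := hz.reindex (Equiv.swap s t)
  rw [h'] at this
  exact this

end BarBasis

/-! ### Bases at the two ends of a path -/

/-- The vectors `X₀ i` and `X₁ i` at the two ends which belong to the bars of an interval basis. -/
structure EndVectors {k : Type u} [Field k] {n N : ℕ} (bar : Fin N → Bar n) {W₀ W₁ : Type v}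
    [AddCommGroup W₀] [Module k W₀] [AddCommGroup W₁] [Module k W₁] (π : W₀ →ₗ[k] W₁)
    (X₀ : Fin N → W₀) (X₁ : Fin N → W₁) : Prop where
  zero₀ : ∀ i, (bar i).fst ≠ ⊥ → X₀ i = 0
  zero₁ : ∀ i, (bar i).snd ≠ ⊤ → X₁ i = 0
  map : ∀ i, (bar i).fst = ⊥ → π (X₀ i) = X₁ i
  coord₀ : ∀ i, (bar i).fst = ⊥ → ∃ f : W₀ →ₗ[k] k, ∀ j, f (X₀ j) = if j = i then 1 else 0
  coord₁ : ∀ i, (bar i).snd = ⊤ → ∃ f : W₁ →ₗ[k] k, ∀ j, f (X₁ j) = if j = i then 1 else 0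
  card₀ : Nat.card {i // (bar i).fst = ⊥} = Module.finrank k W₀
  card₁ : Nat.card {i // (bar i).snd = ⊤} = Module.finrank k W₁

theorem IsIntervalBasis.endVectors {k : Type u} [Field k] {n N : ℕ}
    {V : PathPoset n ⥤ ModuleCat.{v} k} {bar : Fin N → Bar n} {z : Fin N → ∀ a, V.obj a}
    (hz : IsIntervalBasis V (fun i => (bar i).toInterval) z) :
    EndVectors bar (push V bot_le : V.obj ⊥ →ₗ[k] V.obj ⊤) (fun i => z i ⊥) (fun i => z i ⊤) := by
  classical
  have h0 : ∀ i, ⊥ ∈ (bar i).toInterval.carrier ↔ (bar i).fst = ⊥ := fun i =>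
    ⟨fun h => le_bot_iff.1 h.1, fun h => ⟨h.le, bot_le⟩⟩
  have h1 : ∀ i, ⊤ ∈ (bar i).toInterval.carrier ↔ (bar i).snd = ⊤ := fun i =>
    ⟨fun h => top_le_iff.1 h.2, fun h => ⟨le_top, h.ge⟩⟩
  have hc : ∀ a i, a ∈ (bar i).toInterval.carrier → ∃ f : V.obj a →ₗ[k] k,
      ∀ j, f (z j a) = if j = i then 1 else 0 := by
    intro a i h
    refine ⟨hz.coord a i, fun j => ?_⟩
    split_ifs with hj
    · subst hj; exact hz.coord_self h
    · exact hz.coord_of_ne a (Ne.symm hj)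
  refine ⟨fun i h => hz.zero i ⊥ (mt (h0 i).1 h), fun i h => hz.zero i ⊤ (mt (h1 i).1 h),
    fun i h => hz.map i bot_le ((h0 i).2 h), fun i h => hc ⊥ i ((h0 i).2 h),
    fun i h => hc ⊤ i ((h1 i).2 h), ?_, ?_⟩
  · rw [hz.finrank_eq ⊥, ← Nat.card_eq_fintype_card]
    exact Nat.card_congr (Equiv.subtypeEquivRight fun i => (h0 i).symm)
  · rw [hz.finrank_eq ⊤, ← Nat.card_eq_fintype_card]
    exact Nat.card_congr (Equiv.subtypeEquivRight fun i => (h1 i).symm)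

/-- Only the coefficients of bars alive at 1̂ are determined, since the other vectors are zero
there. -/
theorem EndVectors.sum_eq₁ {k : Type u} [Field k] {n N : ℕ} {bar : Fin N → Bar n} {W₀ W₁ : Type v}
    [AddCommGroup W₀] [Module k W₀] [AddCommGroup W₁] [Module k W₁] {π : W₀ →ₗ[k] W₁}
    {X₀ : Fin N → W₀} {X₁ : Fin N → W₁} (h : EndVectors bar π X₀ X₁) {κ : Type} [Fintype κ]
    {σ : κ → Fin N} (hσ : Function.Injective σ) {c d : κ → k}
    (hcd : ∑ p, c p • X₁ (σ p) = ∑ p, d p • X₁ (σ p)) {p : κ} (hp : (bar (σ p)).snd = ⊤) :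
    c p = d p := by
  classical
  obtain ⟨f, hf⟩ := h.coord₁ _ hp
  simpa [map_sum, hf, hσ.eq_iff] using congrArg f hcd

theorem EndVectors.ne_zero₀ {k : Type u} [Field k] {n N : ℕ} {bar : Fin N → Bar n} {W₀ W₁ : Type v}
    [AddCommGroup W₀] [Module k W₀] [AddCommGroup W₁] [Module k W₁] {π : W₀ →ₗ[k] W₁}
    {X₀ : Fin N → W₀} {X₁ : Fin N → W₁} (h : EndVectors bar π X₀ X₁) {i : Fin N}
    (hi : (bar i).fst = ⊥) : X₀ i ≠ 0 := fun h0 => by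
  obtain ⟨f, hf⟩ := h.coord₀ _ hi
  simpa [h0] using hf i

theorem EndVectors.ne_zero₁ {k : Type u} [Field k] {n N : ℕ} {bar : Fin N → Bar n} {W₀ W₁ : Type v}
    [AddCommGroup W₀] [Module k W₀] [AddCommGroup W₁] [Module k W₁] {π : W₀ →ₗ[k] W₁}
    {X₀ : Fin N → W₀} {X₁ : Fin N → W₁} (h : EndVectors bar π X₀ X₁) {i : Fin N}
    (hi : (bar i).snd = ⊤) : X₁ i ≠ 0 := fun h0 => by
  obtain ⟨f, hf⟩ := h.coord₁ _ hi
  simpa [h0] using hf i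

namespace BlockProblem

variable {k : Type u} [Field k] {n m : ℕ} {M : BlockProblem k n m}

/-- The index of the bar at position `q` of the columns. -/
def colBar (M : BlockProblem k n m) (q : Fin M.cols.num) : Fin M.sizeU := (M.cols.idx q).1

/-- The index of the bar at position `p` of the rows. -/
def rowBar (M : BlockProblem k n m) (p : Fin M.rows.num) : Fin M.sizeD := (M.rows.idx p).1

theorem colBar_injective : Function.Injective M.colBar :=
  Subtype.val_injective.comp M.cols.idx.injective

theorem rowBar_injective : Function.Injective M.rowBar :=
  Subtype.val_injective.comp M.rows.idx.injective

/-- The values at `0̂` of sections over the upper path. -/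
def upBot {V : BipathPoset n m ⥤ ModuleCat.{v} k} {N : ℕ}
    (x : Fin N → ∀ a, (restrictUpper V).obj a) (i : Fin N) : V.obj ⊥ := x i ⊥

/-- The values at `1̂` of sections over the upper path. -/
def upTop {V : BipathPoset n m ⥤ ModuleCat.{v} k} {N : ℕ}
    (x : Fin N → ∀ a, (restrictUpper V).obj a) (i : Fin N) : V.obj ⊤ := x i ⊤

/-- The values at `0̂` of sections over the lower path. -/
def lowBot {V : BipathPoset n m ⥤ ModuleCat.{v} k} {N : ℕ}
    (y : Fin N → ∀ a, (restrictLower V).obj a) (i : Fin N) : V.obj ⊥ := y i ⊥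

/-- The values at `1̂` of sections over the lower path. -/
def lowTop {V : BipathPoset n m ⥤ ModuleCat.{v} k} {N : ℕ}
    (y : Fin N → ∀ a, (restrictLower V).obj a) (i : Fin N) : V.obj ⊤ := y i ⊤

/-- The matrix `A` describes the change between interval bases `x` and `y` of the restrictions of
`V` to the two paths. -/
structure Realises (M : BlockProblem k n m) (V : BipathPoset n m ⥤ ModuleCat.{v} k)
    (x : Fin M.sizeU → ∀ a, (restrictUpper V).obj a)
    (y : Fin M.sizeD → ∀ a, (restrictLower V).obj a) (A : M.Mat) : Prop where
  basisU : IsIntervalBasis (restrictUpper V) (fun i => (M.barU i).toInterval) x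
  basisD : IsIntervalBasis (restrictLower V) (fun j => (M.barD j).toInterval) y
  bot : ∀ q, (M.cols.label q).fst = ⊥ →
    upBot x (M.colBar q) = ∑ p, A p q • lowBot y (M.rowBar p)
  top : ∀ q, (M.cols.label q).snd = ⊤ →
    upTop x (M.colBar q) = ∑ p, A p q • lowTop y (M.rowBar p)
  zero : ∀ p q, M.StronglyZero p q → A p q = 0

namespace Realises

variable {V : BipathPoset n m ⥤ ModuleCat.{v} k} {x : Fin M.sizeU → ∀ a, (restrictUpper V).obj a}
  {y : Fin M.sizeD → ∀ a, (restrictLower V).obj a} {A : M.Mat}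

theorem endU (h : M.Realises V x y A) : EndVectors M.barU (push V (bot_le : ⊥ ≤ ⊤))
    (upBot x) (upTop x) :=
  h.basisU.endVectors

theorem endD (h : M.Realises V x y A) : EndVectors M.barD (push V (bot_le : ⊥ ≤ ⊤))
    (lowBot y) (lowTop y) :=
  h.basisD.endVectors

theorem row_zero₀ (h : M.Realises V x y A) {p : Fin M.rows.num} (hp : (M.rows.label p).fst ≠ ⊥) :
    lowBot y (M.rowBar p) = 0 := h.endD.zero₀ _ hp

theorem row_zero₁ (h : M.Realises V x y A) {p : Fin M.rows.num} (hp : (M.rows.label p).snd ≠ ⊤) :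
    lowTop y (M.rowBar p) = 0 := h.endD.zero₁ _ hp

/-- This carries the equation at 0̂ over to 1̂. Rows not born at 0̂ contribute nothing to it,
although they may be alive at 1̂, hence the coefficient zero. -/
theorem push_bot (h : M.Realises V x y A) {q : Fin M.cols.num} (hq : (M.cols.label q).fst = ⊥) :
    upTop x (M.colBar q) =
      ∑ p, (if (M.rows.label p).fst = ⊥ then A p q else 0) • lowTop y (M.rowBar p) := by
  have h1 := h.endU.map (M.colBar q) hq
  rw [← h1]
  simp only [h.bot q hq, map_sum, map_smul]
  refine Finset.sum_congr rfl fun p _ => ?_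
  split_ifs with hp
  · rw [← h.endD.map (M.rowBar p) hp]
  · rw [h.row_zero₀ hp]; simp

/-- The equation at 0̂, pushed to 1̂, is compared with what is known at 1̂: with the second equation
if the column reaches 1̂, and with zero if it has died. This is the lower triangular part of the
matrix, which no rule declares to be zero but which vanishes by naturality. -/
theorem eq_zero (h : M.Realises V x y A) {p : Fin M.rows.num} {q : Fin M.cols.num}
    (hq : (M.cols.label q).fst = ⊥) (hp : (M.rows.label p).snd = ⊤)
    (hpq : (M.rows.label p).fst ≠ ⊥ ∨ (M.cols.label q).snd ≠ ⊤) : A p q = 0 := by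
  by_cases hq' : (M.cols.label q).snd = ⊤
  · have hp' := hpq.resolve_right (not_not.2 hq')
    have := h.endD.sum_eq₁ rowBar_injective ((h.top q hq').symm.trans (h.push_bot hq)) (p := p) hp
    rwa [if_neg hp'] at this
  · by_cases hp' : (M.rows.label p).fst = ⊥
    · have h0 : upTop x (M.colBar q) = 0 := h.endU.zero₁ _ hq'
      have h1 : ∑ p, (0 : k) • lowTop y (M.rowBar p) = 0 := by simp
      have := h.endD.sum_eq₁ rowBar_injective
        ((h1.trans h0.symm).trans (h.push_bot hq)) (p := p) hp
      rw [if_pos hp'] at this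
      exact this.symm
    · exact h.zero p q ⟨fun h => hp' h.1, fun h => hq' h.2⟩

theorem not_other_col (q : Fin M.cols.num) :
    (M.cols.label q).fst = ⊥ ∨ (M.cols.label q).snd = ⊤ := by
  by_contra! h
  exact (M.cols.idx q).2 h

theorem not_other_row (p : Fin M.rows.num) :
    (M.rows.label p).fst = ⊥ ∨ (M.rows.label p).snd = ⊤ := by
  by_contra! h
  exact (M.rows.idx p).2 h

/-- For a column that has died before 1̂ both sides vanish, so operations can be checked at 1̂
without a case distinction on the columns. -/
theorem top' (h : M.Realises V x y A) (q : Fin M.cols.num) :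
    upTop x (M.colBar q) = ∑ p, A p q • lowTop y (M.rowBar p) := by
  by_cases hq : (M.cols.label q).snd = ⊤
  · exact h.top q hq
  · have h0 : upTop x (M.colBar q) = 0 := h.endU.zero₁ _ hq
    have hq' := (not_other_col q).resolve_right hq
    rw [h0, Finset.sum_eq_zero]
    intro p _
    by_cases hp : (M.rows.label p).snd = ⊤
    · rw [h.eq_zero hq' hp (Or.inr hq), zero_smul]
    · rw [h.row_zero₁ hp, smul_zero]

end Realises

end BlockProblem

/-! ### Permissible operations as changes of interval bases -/

namespace BlockProblem

variable {k : Type u} [Field k] {n m : ℕ} {M : BlockProblem k n m}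

theorem label_swap_col {s t : Fin M.cols.num} (h : M.cols.label s = M.cols.label t)
    (q : Fin M.cols.num) : M.cols.label (Equiv.swap s t q) = M.cols.label q := by
  by_cases h1 : q = s
  · subst h1; rw [Equiv.swap_apply_left, h]
  · by_cases h2 : q = t
    · subst h2; rw [Equiv.swap_apply_right, h]
    · rw [Equiv.swap_apply_of_ne_of_ne h1 h2]

theorem label_swap_row {s t : Fin M.rows.num} (h : M.rows.label s = M.rows.label t)
    (q : Fin M.rows.num) : M.rows.label (Equiv.swap s t q) = M.rows.label q := by
  by_cases h1 : q = s
  · subst h1; rw [Equiv.swap_apply_left, h]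
  · by_cases h2 : q = t
    · subst h2; rw [Equiv.swap_apply_right, h]
    · rw [Equiv.swap_apply_of_ne_of_ne h1 h2]

theorem eq_of_le_of_le {n : ℕ} {I J : Bar n} (h : I.fst ≤ J.fst ∧ I.snd ≤ J.snd)
    (h' : J.fst ≤ I.fst ∧ J.snd ≤ I.snd) : I = J :=
  NonemptyInterval.ext (Prod.ext (h.1.antisymm h'.1) (h.2.antisymm h'.2))

namespace Realises

variable {V : BipathPoset n m ⥤ ModuleCat.{v} k} {x : Fin M.sizeU → ∀ a, (restrictUpper V).obj a}
  {y : Fin M.sizeD → ∀ a, (restrictLower V).obj a} {A : M.Mat}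

theorem upBot_combineSection (s t i : Fin M.sizeU) (c₁ c₂ : k) :
    upBot (combineSection M.barU x s t c₁ c₂) i =
      if i = t then if (M.barU t).fst = ⊥ then c₁ • upBot x t + c₂ • upBot x s else 0
        else upBot x i := by
  simp only [upBot, combineSection, le_bot_iff]
  rfl

theorem upTop_combineSection (s t i : Fin M.sizeU) (c₁ c₂ : k) :
    upTop (combineSection M.barU x s t c₁ c₂) i =
      if i = t then c₁ • upTop x t + c₂ • upTop x s else upTop x i := by
  simp only [upTop, combineSection, le_top, if_true]
  rfl

theorem lowBot_combineSection (s t i : Fin M.sizeD) (c₁ c₂ : k) :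
    lowBot (combineSection M.barD y s t c₁ c₂) i =
      if i = t then if (M.barD t).fst = ⊥ then c₁ • lowBot y t + c₂ • lowBot y s else 0
        else lowBot y i := by
  simp only [lowBot, combineSection, le_bot_iff]
  rfl

theorem lowTop_combineSection (s t i : Fin M.sizeD) (c₁ c₂ : k) :
    lowTop (combineSection M.barD y s t c₁ c₂) i =
      if i = t then c₁ • lowTop y t + c₂ • lowTop y s else lowTop y i := by
  simp only [lowTop, combineSection, le_top, if_true]
  rfl

/-- Covers scaling (`s = t`, `c₂ = 0`) and addition of columns together: the section of column `t`
undergoes the same linear combination as the column. -/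
theorem combineCol (h : M.Realises V x y A) {s t : Fin M.cols.num} {c₁ c₂ : k} (h₁ : c₁ ≠ 0)
    (h₂ : c₂ ≠ 0 → s ≠ t)
    (hle : (M.cols.label s).fst ≤ (M.cols.label t).fst ∧
      (M.cols.label s).snd ≤ (M.cols.label t).snd) {A' : M.Mat}
    (hA' : ∀ p q, q ≠ t → A' p q = A p q)
    (hA't : ∀ p, ¬ M.StronglyZero p t → A' p t = c₁ * A p t + c₂ * A p s)
    (hz : ∀ p, M.StronglyZero p t → A' p t = 0) :
    M.Realises V (combineSection M.barU x (M.colBar s) (M.colBar t) c₁ c₂) y A' where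
  basisU := h.basisU.combineSection h₁ (fun hc e => h₂ hc (colBar_injective e)) hle
  basisD := h.basisD
  bot q hq := by
    rw [upBot_combineSection]
    by_cases hqt : q = t
    · subst hqt
      have hs : (M.cols.label s).fst = ⊥ := le_bot_iff.1 (hq ▸ hle.1)
      rw [if_pos rfl, if_pos (show (M.barU (M.colBar q)).fst = ⊥ from hq), h.bot q hq, h.bot s hs,
        Finset.smul_sum, Finset.smul_sum, ← Finset.sum_add_distrib]
      refine Finset.sum_congr rfl fun p _ => ?_
      -- Keeping a strongly zero entry at zero is harmless: its row vector vanishes at the end where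
      -- the equation is read.
      by_cases hsz : M.StronglyZero p q
      · rw [h.row_zero₀ (fun hp => hsz.1 ⟨hp, hq⟩)]
        simp
      · rw [hA't p hsz, add_smul, mul_smul, mul_smul]
    · rw [if_neg (fun e => hqt (colBar_injective e)), h.bot q hq]
      exact Finset.sum_congr rfl fun p _ => by rw [hA' p q hqt]
  top q hq := by
    rw [upTop_combineSection]
    by_cases hqt : q = t
    · subst hqt
      rw [if_pos rfl, h.top' q, h.top' s,
        Finset.smul_sum, Finset.smul_sum, ← Finset.sum_add_distrib]
      refine Finset.sum_congr rfl fun p _ => ?_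
      by_cases hsz : M.StronglyZero p q
      · rw [h.row_zero₁ (fun hp => hsz.2 ⟨hp, hq⟩)]
        simp
      · rw [hA't p hsz, add_smul, mul_smul, mul_smul]
    · rw [if_neg (fun e => hqt (colBar_injective e)), h.top q hq]
      exact Finset.sum_congr rfl fun p _ => by rw [hA' p q hqt]
  zero p q hpq := by
    by_cases hqt : q = t
    · subst hqt; exact hz p hpq
    · rw [hA' p q hqt, h.zero p q hpq]

/-- Rows are coefficients of `y`, so they change inversely to the basis. -/
theorem scaleRow (h : M.Realises V x y A) {t : Fin M.rows.num} {c : k} (hc : c ≠ 0) :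
    M.Realises V x (combineSection M.barD y (M.rowBar t) (M.rowBar t) c⁻¹ 0)
      (fun p q => if p = t then c * A p q else A p q) where
  basisU := h.basisU
  basisD := h.basisD.combineSection (inv_ne_zero hc) (fun h => (h rfl).elim) ⟨le_rfl, le_rfl⟩
  bot q hq := by
    rw [h.bot q hq]
    refine Finset.sum_congr rfl fun p _ => ?_
    rw [lowBot_combineSection]
    by_cases hpt : p = t
    · subst hpt
      by_cases hp : (M.rows.label p).fst = ⊥
      · rw [if_pos rfl, if_pos rfl, if_pos (show (M.barD (M.rowBar p)).fst = ⊥ from hp), zero_smul,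
          add_zero, smul_smul, mul_right_comm, mul_inv_cancel₀ hc, one_mul]
      · rw [h.row_zero₀ hp]
        simp
    · rw [if_neg hpt, if_neg (fun e => hpt (rowBar_injective e))]
  top q hq := by
    rw [h.top q hq]
    refine Finset.sum_congr rfl fun p _ => ?_
    rw [lowTop_combineSection]
    by_cases hpt : p = t
    · subst hpt
      rw [if_pos rfl, if_pos rfl, zero_smul,
          add_zero, smul_smul, mul_right_comm, mul_inv_cancel₀ hc, one_mul]
    · rw [if_neg hpt, if_neg (fun e => hpt (rowBar_injective e))]
  zero p q hpq := by simp [h.zero p q hpq]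

open Classical in
-- Adding `c` times row `s` to row `t` is compensated by subtracting `c` times section `t` from
-- section `s`. This exchange of source and target is why additions of rows go in the opposite
-- direction to those of columns.
theorem addRow (h : M.Realises V x y A) {s t : Fin M.rows.num} {c : k} (hst : s ≠ t)
    (hle : (M.rows.label t).fst ≤ (M.rows.label s).fst ∧
      (M.rows.label t).snd ≤ (M.rows.label s).snd) :
    M.Realises V x (combineSection M.barD y (M.rowBar t) (M.rowBar s) 1 (-c))
      (fun p q => if p = t ∧ ¬ M.StronglyZero p q then A p q + c * A s q else A p q) where
  basisU := h.basisU
  basisD := h.basisD.combineSection one_ne_zero (fun _ e => hst (rowBar_injective e.symm)) hle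
  bot q hq := by
    rw [h.bot q hq]
    by_cases hs : (M.rows.label s).fst = ⊥
    · have ht : (M.rows.label t).fst = ⊥ := le_bot_iff.1 (hs ▸ hle.1)
      have hsz : ¬ M.StronglyZero t q := fun hz => hz.1 ⟨ht, hq⟩
      have key : ∀ p, (if p = t ∧ ¬ M.StronglyZero p q then A p q + c * A s q else A p q) •
          lowBot (combineSection M.barD y (M.rowBar t) (M.rowBar s) 1 (-c)) (M.rowBar p) =
          A p q • lowBot y (M.rowBar p) + (if p = t then (c * A s q) • lowBot y (M.rowBar t) else 0)
          - (if p = s then (c * A s q) • lowBot y (M.rowBar t) else 0) := by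
        intro p
        simp only [lowBot_combineSection, rowBar_injective.eq_iff]
        by_cases hp : p = s
        · subst hp
          rw [if_neg (fun h => hst h.1), if_pos rfl, if_neg hst, if_pos rfl,
            if_pos (show (M.barD (M.rowBar p)).fst = ⊥ from hs)]
          module
        · rw [if_neg hp, if_neg hp]
          by_cases hpt : p = t
          · subst hpt
            simp [hsz, add_smul]
          · simp [hpt]
      rw [Finset.sum_congr rfl fun p _ => key p, Finset.sum_sub_distrib, Finset.sum_add_distrib]
      simp
    -- The new section `s` is cut off at 0̂, so the compensation fails there, but the entry that
    -- would be added is zero.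
    · have hs0 : A s q = 0 := h.eq_zero hq ((not_other_row s).resolve_left hs) (Or.inl hs)
      refine Finset.sum_congr rfl fun p _ => ?_
      simp only [lowBot_combineSection, rowBar_injective.eq_iff, hs0, mul_zero, add_zero, ite_self]
      by_cases hp : p = s
      · subst hp
        rw [hs0, zero_smul, zero_smul]
      · rw [if_neg hp]
  top q hq := by
    rw [h.top q hq]
    have hsz : (if ¬ M.StronglyZero t q then A t q + c * A s q else A t q) • lowTop y (M.rowBar t) =
        (A t q + c * A s q) • lowTop y (M.rowBar t) := by
      by_cases hz : M.StronglyZero t q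
      · rw [h.row_zero₁ (fun hp => hz.2 ⟨hp, hq⟩), smul_zero, smul_zero]
      · rw [if_pos hz]
    have key : ∀ p, (if p = t ∧ ¬ M.StronglyZero p q then A p q + c * A s q else A p q) •
        lowTop (combineSection M.barD y (M.rowBar t) (M.rowBar s) 1 (-c)) (M.rowBar p) =
        A p q • lowTop y (M.rowBar p) + (if p = t then (c * A s q) • lowTop y (M.rowBar t) else 0)
        - (if p = s then (c * A s q) • lowTop y (M.rowBar t) else 0) := by
      intro p
      simp only [lowTop_combineSection, rowBar_injective.eq_iff]
      by_cases hp : p = s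
      · subst hp
        rw [if_neg (fun h => hst h.1), if_pos rfl, if_neg hst, if_pos rfl]
        module
      · rw [if_neg hp, if_neg hp]
        by_cases hpt : p = t
        · subst hpt
          simp only [true_and, if_true, sub_zero]
          rw [hsz, add_smul]
        · simp [hpt]
    rw [Finset.sum_congr rfl fun p _ => key p, Finset.sum_sub_distrib, Finset.sum_add_distrib]
    simp
  zero p q hpq := by simp [hpq, h.zero p q hpq]

theorem swapCol (h : M.Realises V x y A) {s t : Fin M.cols.num}
    (hst : M.cols.label s = M.cols.label t) :
    M.Realises V (fun i => x (Equiv.swap (M.colBar s) (M.colBar t) i)) y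
      (fun p q => A p (Equiv.swap s t q)) where
  basisU := h.basisU.swap hst
  basisD := h.basisD
  bot q hq := by
    refine Eq.trans ?_ (h.bot (Equiv.swap s t q) (by rw [label_swap_col hst, hq]))
    rw [colBar_injective.map_swap]
    rfl
  top q hq := by
    refine Eq.trans ?_ (h.top (Equiv.swap s t q) (by rw [label_swap_col hst, hq]))
    rw [colBar_injective.map_swap]
    rfl
  zero p q hpq := h.zero p _ (by rwa [StronglyZero, label_swap_col hst])

theorem swapRow (h : M.Realises V x y A) {s t : Fin M.rows.num}
    (hst : M.rows.label s = M.rows.label t) :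
    M.Realises V x (fun i => y (Equiv.swap (M.rowBar s) (M.rowBar t) i))
      (fun p q => A (Equiv.swap s t p) q) where
  basisU := h.basisU
  basisD := h.basisD.swap hst
  bot q hq := by
    rw [h.bot q hq, ← Equiv.sum_comp (Equiv.swap s t)]
    refine Finset.sum_congr rfl fun p _ => ?_
    rw [rowBar_injective.map_swap]
    rfl
  top q hq := by
    rw [h.top q hq, ← Equiv.sum_comp (Equiv.swap s t)]
    refine Finset.sum_congr rfl fun p _ => ?_
    rw [rowBar_injective.map_swap]
    rfl
  zero p q hpq := h.zero _ q (by rwa [StronglyZero, label_swap_row hst])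

/-- Soundness of the operations: of the relation between labels only the componentwise order of end
points is used. -/
theorem permissible (h : M.Realises V x y A) {A' : M.Mat} (hA : M.Permissible A A') :
    ∃ x' y', M.Realises V x' y' A' := by
  cases hA with
  | scaleCol t c hc _ =>
    refine ⟨_, y, h.combineCol (s := t) (t := t) (c₁ := c) (c₂ := 0) hc (fun h => (h rfl).elim)
      ⟨le_rfl, le_rfl⟩ (fun p q hq => if_neg hq) (fun p _ => ?_) fun p hp => ?_⟩
    · simp
    · simp [h.zero p t hp]
  | swapCol s t hs ht =>
    -- Operations permitted in both directions force equal labels, as the order of end points is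
    -- antisymmetric.
    exact ⟨_, y, h.swapCol (eq_of_le_of_le (le_of_eq_or_strictSub hs) (le_of_eq_or_strictSub ht))⟩
  | addCol s t c hst hs =>
    refine ⟨_, y, h.combineCol (s := s) (t := t) (c₁ := 1) (c₂ := c) one_ne_zero (fun _ => hst)
      (le_of_eq_or_strictSub hs) (fun p q hq => ?_) (fun p hp => ?_) fun p hp => ?_⟩
    · simp [hq]
    · simp [hp]
    · simp [hp, h.zero p t hp]
  | scaleRow t c hc _ => exact ⟨x, _, h.scaleRow hc⟩
  | swapRow s t hs ht =>
    refine ⟨x, _, h.swapRow ?_⟩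
    exact eq_of_le_of_le (le_of_eq_or_strictSub (ht.imp_left Eq.symm))
      (le_of_eq_or_strictSub (hs.imp_left Eq.symm))
  | addRow s t c hst hs =>
    exact ⟨x, _, h.addRow hst (le_of_eq_or_strictSub (hs.imp_left Eq.symm))⟩

theorem reflTransGen (h : M.Realises V x y A) {A' : M.Mat}
    (hA : Relation.ReflTransGen M.Permissible A A') : ∃ x' y', M.Realises V x' y' A' := by
  induction hA with
  | refl => exact ⟨x, y, h⟩
  | tail _ hb ih =>
    obtain ⟨x', y', h'⟩ := ih
    exact h'.permissible hb

end Realises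

/-! ### The initial matrix -/

variable {V : BipathPoset n m ⥤ ModuleCat.{v} k} {x : Fin M.sizeU → ∀ a, (restrictUpper V).obj a}
  {y : Fin M.sizeD → ∀ a, (restrictLower V).obj a}

theorem notOther_of_fst {n : ℕ} {I : Bar n} (h : I.fst = ⊥) : ¬ I.IsOther := fun h' => h'.1 h

theorem notOther_of_snd {n : ℕ} {I : Bar n} (h : I.snd = ⊤) : ¬ I.IsOther := fun h' => h'.2 h

/-- The position of a bar in the listing of the rows. -/
def rowPos (M : BlockProblem k n m) (j : {j : Fin M.sizeD // ¬ (M.barD j).IsOther}) :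
    Fin M.rows.num := M.rows.idx.symm j

theorem rowBar_rowPos (j : {j : Fin M.sizeD // ¬ (M.barD j).IsOther}) :
    M.rowBar (M.rowPos j) = j.1 := by
  simp [rowBar, rowPos]

theorem rowPos_rowBar (p : Fin M.rows.num) : M.rowPos ⟨M.rowBar p, (M.rows.idx p).2⟩ = p := by
  simp [rowBar, rowPos]

theorem realises_initial
    (hx : IsIntervalBasis (restrictUpper V) (fun i => (M.barU i).toInterval) x)
    (hy : IsIntervalBasis (restrictLower V) (fun j => (M.barD j).toInterval) y)
    (hLam : ∀ i : Alive M.barU ⊥, upBot x i = ∑ j : Alive M.barD ⊥, M.Lam j i • lowBot y j)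
    (hGam : ∀ i : Alive M.barU ⊤, upTop x i = ∑ j : Alive M.barD ⊤, M.Gam j i • lowTop y j) :
    M.Realises V x y M.initial := by
  classical
  have hX : EndVectors M.barU (push V (bot_le : ⊥ ≤ ⊤)) (upBot x) (upTop x) := hx.endVectors
  have hY : EndVectors M.barD (push V (bot_le : ⊥ ≤ ⊤)) (lowBot y) (lowTop y) := hy.endVectors
  have e0 : ∀ p q (hp : (M.rows.label p).fst = ⊥) (hq : (M.cols.label q).fst = ⊥),
      M.initial p q = M.Lam ⟨M.rowBar p, hp.le, bot_le⟩ ⟨M.colBar q, hq.le, bot_le⟩ :=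
    fun p q hp hq => dif_pos ⟨hp, hq⟩
  -- Where Λ takes precedence in the block matrix, it has to be shown to agree with Γ: on the
  -- central block, push the equation at 0̂ to 1̂ and read off the coordinate of the row.
  have e1 : ∀ p q (hp : (M.rows.label p).snd = ⊤) (hq : (M.cols.label q).snd = ⊤),
      M.initial p q = M.Gam ⟨M.rowBar p, le_top, hp.ge⟩ ⟨M.colBar q, le_top, hq.ge⟩ := by
    intro p q hp hq
    by_cases h : (M.rows.label p).fst = ⊥ ∧ (M.cols.label q).fst = ⊥
    · rw [e0 p q h.1 h.2]
      have h1 := hX.map (M.colBar q) h.2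
      rw [hLam ⟨M.colBar q, h.2.le, bot_le⟩, hGam ⟨M.colBar q, le_top, hq.ge⟩, map_sum] at h1
      obtain ⟨f, hf⟩ := hY.coord₁ (M.rowBar p) hp
      have h2 := congrArg f h1
      have h3 : ∀ j : Alive M.barD ⊥, push V (bot_le : ⊥ ≤ ⊤) (lowBot y j) = lowTop y j :=
        fun j => hY.map j.1 (le_bot_iff.1 j.2.1)
      simp only [map_sum, map_smul, h3, hf, smul_eq_mul, mul_ite, mul_one, mul_zero] at h2
      rw [Finset.sum_eq_single ⟨M.rowBar p, h.1.le, bot_le⟩,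
        Finset.sum_eq_single ⟨M.rowBar p, le_top, hp.ge⟩] at h2
      · simpa using h2
      · exact fun j _ hj => if_neg fun e => hj (Subtype.ext e)
      · simp
      · exact fun j _ hj => if_neg fun e => hj (Subtype.ext e)
      · simp
    · exact (dif_neg h).trans (dif_pos ⟨hp, hq⟩)
  refine ⟨hx, hy, fun q hq => ?_, fun q hq => ?_, fun p q h => ?_⟩
  · rw [hLam ⟨M.colBar q, hq.le, bot_le⟩]
    refine Fintype.sum_of_injective
      (fun j : Alive M.barD ⊥ => M.rowPos ⟨j.1, notOther_of_fst (le_bot_iff.1 j.2.1)⟩)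
      (fun i j h => ?_) _ _ (fun p hp => ?_) fun j => ?_
    · have := congrArg M.rowBar h
      simpa [rowBar_rowPos, Subtype.ext_iff] using this
    · by_cases h : (M.rows.label p).fst = ⊥
      · exact (hp ⟨⟨M.rowBar p, h.le, bot_le⟩, rowPos_rowBar p⟩).elim
      · rw [hY.zero₀ (M.rowBar p) h, smul_zero]
    · have hj : (M.barD j.1).fst = ⊥ := le_bot_iff.1 j.2.1
      rw [e0 _ q (by
        change (M.barD (M.rowBar _)).fst = ⊥
        rw [rowBar_rowPos]; exact hj) hq]
      simp only [rowBar_rowPos]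
  · rw [hGam ⟨M.colBar q, le_top, hq.ge⟩]
    refine Fintype.sum_of_injective
      (fun j : Alive M.barD ⊤ => M.rowPos ⟨j.1, notOther_of_snd (top_le_iff.1 j.2.2)⟩)
      (fun i j h => ?_) _ _ (fun p hp => ?_) fun j => ?_
    · have := congrArg M.rowBar h
      simpa [rowBar_rowPos, Subtype.ext_iff] using this
    · by_cases h : (M.rows.label p).snd = ⊤
      · exact (hp ⟨⟨M.rowBar p, le_top, h.ge⟩, rowPos_rowBar p⟩).elim
      · rw [hY.zero₁ (M.rowBar p) h, smul_zero]
    · have hj : (M.barD j.1).snd = ⊤ := top_le_iff.1 j.2.2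
      rw [e1 _ q (by
        change (M.barD (M.rowBar _)).snd = ⊤
        rw [rowBar_rowPos]; exact hj) hq]
      simp only [rowBar_rowPos]
  · exact (dif_neg h.1).trans (dif_neg h.2)

end BlockProblem

/-! ### The reduction procedure -/

open Classical in
theorem reduceSubmatrix_of_mem {k : Type u} [Field k] {r c : ℕ} {R : Fin r → Prop}
    {C : Fin c → Prop} (A : Matrix (Fin r) (Fin c) k) {p : Fin r} {q : Fin c} (h : R p ∧ C q) :
    reduceSubmatrix R C A p q =
      oneWayReduce (fun (i : {i // R i}) (j : {j // C j}) => A i j) ⟨p, h.1⟩ ⟨q, h.2⟩ :=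
  dif_pos h

theorem reduceSubmatrix_of_not_mem {k : Type u} [Field k] {r c : ℕ} {R : Fin r → Prop}
    {C : Fin c → Prop} (A : Matrix (Fin r) (Fin c) k) {p : Fin r} {q : Fin c}
    (h : ¬ (R p ∧ C q)) : reduceSubmatrix R C A p q = A p q :=
  dif_neg h

namespace BlockProblem

variable {k : Type u} [Field k] {n m : ℕ} {M : BlockProblem k n m}

open Classical in
/-- The one-way reduction of a block can be carried out by elementary operations on the whole
matrix, and it gives a partial permutation matrix if no column of the block ever vanishes. -/
theorem exists_reflTransGen_reduceSubmatrix {okC : Fin M.cols.num → Fin M.cols.num → Prop}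
    {okR : Fin M.rows.num → Fin M.rows.num → Prop} {R : Fin M.rows.num → Prop}
    {C : Fin M.cols.num → Prop} (hRC : ∀ p q, R p → C q → ¬ M.StronglyZero p q)
    (hC : ∀ s t, C s → C t → s < t → okC s t) (hR : ∀ s t, R s → R t → t ≤ s → okR s t)
    (A : M.Mat)
    (hne : ∀ A' : M.Mat, Relation.ReflTransGen (M.Op okC okR) A A' →
      ((∀ p q, ¬ (R p ↔ C q) → A p q = 0) → ∀ p q, ¬ (R p ∧ C q) → A' p q = A p q) →
      ∀ q, C q → ∃ p, R p ∧ A' p q ≠ 0) :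
    ∃ A' : M.Mat, Relation.ReflTransGen (M.Op okC okR) A A' ∧
      ((∀ p q, ¬ (R p ↔ C q) → A p q = 0) → A' = reduceSubmatrix R C A) ∧
      ∃ f : {q // C q} → {p // R p}, Function.Injective f ∧
        ∀ p q, A' p.1 q.1 = if f q = p then 1 else 0 := by
  -- The invariant for the block is that it sits in a matrix reachable from `A`. Thus information
  -- about reachable matrices supplies the pivots.
  let Q : Matrix {p // R p} {q // C q} k → Prop := fun B => ∃ A' : M.Mat,
    Relation.ReflTransGen (M.Op okC okR) A A' ∧
      (∀ (i : {i // R i}) (j : {j // C j}), A' i.1 j.1 = B i j) ∧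
      ((∀ p q, ¬ (R p ↔ C q) → A p q = 0) → ∀ p q, ¬ (R p ∧ C q) → A' p q = A p q)
  have hstep : ∀ B c, Q B → Q (oneWayStep B c) := by
    rintro B c ⟨A', h1, h2, h3⟩
    obtain ⟨A'', g1, g2, g3⟩ := exists_reflTransGen_oneWayStep hRC hC hR A' B h2 c
    refine ⟨A'', h1.trans g1, g2, fun h0 p q hpq => ?_⟩
    rw [g3 (fun p q h => ?_) p q hpq, h3 h0 p q hpq]
    rw [h3 h0 p q (fun h' => h ⟨fun _ => h'.2, fun _ => h'.1⟩), h0 p q h]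
  have hne' : ∀ B c, Q B → ∃ i, B i c ≠ 0 := by
    rintro B c ⟨A', h1, h2, h3⟩
    obtain ⟨p, hp, hpc⟩ := hne A' h1 h3 c.1 c.2
    exact ⟨⟨p, hp⟩, by rwa [← h2]⟩
  obtain ⟨⟨A', h1, h2, h3⟩, f, hf, hf'⟩ := oneWayReduce_eq_permutation Q hstep hne'
    (fun i j => A i.1 j.1) ⟨A, .refl, fun _ _ => rfl, fun _ _ _ _ => rfl⟩
  refine ⟨A', h1, fun h0 => Matrix.ext fun p q => ?_, f, hf, fun p q => ?_⟩
  swap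
  · rw [h2, hf']
    congr
  by_cases h : R p ∧ C q
  · exact (h2 ⟨p, h.1⟩ ⟨q, h.2⟩).trans (reduceSubmatrix_of_mem A h).symm
  · exact (h3 h0 p q h).trans (reduceSubmatrix_of_not_mem A h).symm

theorem isLeft_or_isCentral_or_isRight_col (q : Fin M.cols.num) :
    (M.cols.label q).IsLeft ∨ (M.cols.label q).IsCentral ∨ (M.cols.label q).IsRight := by
  have := Realises.not_other_col q
  unfold Bar.IsLeft Bar.IsCentral Bar.IsRight
  tauto

theorem isLeft_or_isCentral_or_isRight_row (p : Fin M.rows.num) :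
    (M.rows.label p).IsLeft ∨ (M.rows.label p).IsCentral ∨ (M.rows.label p).IsRight := by
  have := Realises.not_other_row p
  unfold Bar.IsLeft Bar.IsCentral Bar.IsRight
  tauto

theorem col_le {s t : Fin M.cols.num} (h : s ≤ t) :
    (M.cols.label s).fst ≤ (M.cols.label t).fst ∧ (M.cols.label s).snd ≤ (M.cols.label t).snd :=
  M.cols.sorted s t h

theorem row_le {s t : Fin M.rows.num} (h : s ≤ t) :
    (M.rows.label s).fst ≤ (M.rows.label t).fst ∧ (M.rows.label s).snd ≤ (M.rows.label t).snd :=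
  M.rows.sorted s t h

theorem centralOp_permissible {A B : M.Mat} (h : M.CentralOp A B) : M.Permissible A B := by
  refine h.mono (fun s t h => Or.inl ?_) (fun s t h => Or.inl ?_)
  · exact NonemptyInterval.ext (Prod.ext (h.1.1.trans h.2.1.symm) (h.1.2.trans h.2.2.symm))
  · exact NonemptyInterval.ext (Prod.ext (h.1.1.trans h.2.1.symm) (h.1.2.trans h.2.2.symm))

theorem centralOps_permissible {A B : M.Mat} (h : Relation.ReflTransGen M.CentralOp A B) :
    Relation.ReflTransGen M.Permissible A B := by
  induction h with
  | refl => exact .refl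
  | tail _ h ih => exact ih.tail (centralOp_permissible h)

open Classical in
theorem card_subtype_add {α : Type*} [Fintype α] {p q r : α → Prop} (h : ∀ a, p a ↔ q a ∨ r a)
    (hd : ∀ a, q a → ¬ r a) :
    Fintype.card {a // p a} = Fintype.card {a // q a} + Fintype.card {a // r a} := by
  rw [← Fintype.card_subtype_or_disjoint]
  · exact Fintype.card_congr (Equiv.subtypeEquivRight h)
  · rw [disjoint_iff_inf_le]
    exact fun a ha => hd a ha.1 ha.2

/-! ### Existence of pivots, and block sizes -/

namespace Realises

variable {V : BipathPoset n m ⥤ ModuleCat.{v} k} {x : Fin M.sizeU → ∀ a, (restrictUpper V).obj a}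
  {y : Fin M.sizeD → ∀ a, (restrictLower V).obj a} {A : M.Mat}

/-- Otherwise the basis vector of the column at 0̂ would be zero: rows reaching 1̂ have coefficient
zero by `eq_zero`, and the remaining rows outside the block vanish at 0̂. -/
theorem exists_left (h : M.Realises V x y A) {q : Fin M.cols.num} (hq : (M.cols.label q).IsLeft) :
    ∃ p, (M.rows.label p).IsLeft ∧ A p q ≠ 0 := by
  by_contra! h0
  refine h.endU.ne_zero₀ (i := M.colBar q) hq.1 ?_
  rw [h.bot q hq.1]
  refine Finset.sum_eq_zero fun p _ => ?_
  by_cases hp : (M.rows.label p).fst = ⊥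
  · by_cases hp' : (M.rows.label p).snd = ⊤
    · rw [h.eq_zero hq.1 hp' (Or.inr hq.2), zero_smul]
    · rw [h0 p ⟨hp, hp'⟩, zero_smul]
  · rw [h.row_zero₀ hp, smul_zero]

/-- The same argument at 1̂, where left rows have died and right rows have coefficient zero. -/
theorem exists_central (h : M.Realises V x y A) {q : Fin M.cols.num}
    (hq : (M.cols.label q).IsCentral) : ∃ p, (M.rows.label p).IsCentral ∧ A p q ≠ 0 := by
  by_contra! h0
  refine h.endU.ne_zero₁ (i := M.colBar q) hq.2 ?_
  rw [h.top q hq.2]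
  refine Finset.sum_eq_zero fun p _ => ?_
  by_cases hp : (M.rows.label p).snd = ⊤
  · by_cases hp' : (M.rows.label p).fst = ⊥
    · rw [h0 p ⟨hp', hp⟩, zero_smul]
    · rw [h.eq_zero hq.1 hp (Or.inl hp'), zero_smul]
  · rw [h.row_zero₁ hp, smul_zero]

/-- At 1̂ central rows can contribute to a right column, so they must have been cleared beforehand;
this is why clearing precedes the reduction of the right block. -/
theorem exists_right (h : M.Realises V x y A) {q : Fin M.cols.num}
    (hq : (M.cols.label q).IsRight) (hc : ∀ p, (M.rows.label p).IsCentral → A p q = 0) :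
    ∃ p, (M.rows.label p).IsRight ∧ A p q ≠ 0 := by
  by_contra! h0
  refine h.endU.ne_zero₁ (i := M.colBar q) hq.2 ?_
  rw [h.top q hq.2]
  refine Finset.sum_eq_zero fun p _ => ?_
  by_cases hp : (M.rows.label p).snd = ⊤
  · by_cases hp' : (M.rows.label p).fst = ⊥
    · rw [hc p ⟨hp', hp⟩, zero_smul]
    · rw [h0 p ⟨hp', hp⟩, zero_smul]
  · rw [h.row_zero₁ hp, smul_zero]

open Classical in
-- The zeros beside the block are needed only to identify the result with `reduceSubmatrix`. The
-- injection of columns into rows needs no clearing and serves in `card_eq`.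
theorem exists_reduce_left (h : M.Realises V x y A) : ∃ A' : M.Mat,
    Relation.ReflTransGen M.Permissible A A' ∧
    ((∀ p q, ¬ ((M.rows.label p).IsLeft ↔ (M.cols.label q).IsLeft) → A p q = 0) →
      A' = reduceSubmatrix (fun p => (M.rows.label p).IsLeft)
        (fun q => (M.cols.label q).IsLeft) A) ∧
    ∃ f : {q // (M.cols.label q).IsLeft} → {p // (M.rows.label p).IsLeft}, Function.Injective f ∧
      ∀ p q, A' p.1 q.1 = if f q = p then 1 else 0 := by
  refine exists_reflTransGen_reduceSubmatrix (fun p q hp hq hz => hz.1 ⟨hp.1, hq.1⟩)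
    (fun s t hs ht hst => ?_) (fun s t hs ht hst => ?_) A fun A' hA' _ q hq => ?_
  · exact eq_or_strictSub_of_le (col_le hst.le).1 (ht.1.le.trans bot_le) (col_le hst.le).2
  · exact (eq_or_strictSub_of_le (row_le hst).1 (hs.1.le.trans bot_le) (row_le hst).2).imp_left
      Eq.symm
  · obtain ⟨x', y', h'⟩ := h.reflTransGen hA'
    exact h'.exists_left hq

open Classical in
theorem exists_reduce_right (h : M.Realises V x y A)
    (h0 : ∀ p q, ¬ ((M.rows.label p).IsRight ↔ (M.cols.label q).IsRight) → A p q = 0) :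
    ∃ A' : M.Mat, Relation.ReflTransGen M.Permissible A A' ∧
    A' = reduceSubmatrix (fun p => (M.rows.label p).IsRight)
      (fun q => (M.cols.label q).IsRight) A ∧
    ∃ f : {q // (M.cols.label q).IsRight} → {p // (M.rows.label p).IsRight},
      Function.Injective f ∧ ∀ p q, A' p.1 q.1 = if f q = p then 1 else 0 := by
  obtain ⟨A', h1, h2, h3⟩ := exists_reflTransGen_reduceSubmatrix (M := M)
    (R := fun p => (M.rows.label p).IsRight) (C := fun q => (M.cols.label q).IsRight)
    (okC := fun s t => M.cols.label s = M.cols.label t ∨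
      StrictSub k (M.cols.label s) (M.cols.label t))
    (okR := fun s t => M.rows.label s = M.rows.label t ∨
      StrictSub k (M.rows.label t) (M.rows.label s))
    (fun p q hp hq hz => hz.2 ⟨hp.2, hq.2⟩)
    (fun s t hs ht hst => eq_or_strictSub_of_le (col_le hst.le).1 (le_top.trans hs.2.ge)
      (col_le hst.le).2)
    (fun s t hs ht hst => (eq_or_strictSub_of_le (row_le hst).1 (le_top.trans ht.2.ge)
      (row_le hst).2).imp_left Eq.symm) A fun A' hA' hoff q hq => by
    obtain ⟨x', y', h'⟩ := h.reflTransGen hA'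
    refine h'.exists_right hq fun p hp => ?_
    -- The reduction leaves positions outside the right block untouched, so the central rows stay
    -- zero in right columns.
    rw [hoff h0 p q (fun h => h.1.1 hp.1), h0 p q fun h => (h.2 hq).1 hp.1]
  exact ⟨A', h1, h2 h0, h3⟩

open Classical in
theorem exists_reduce_central (h : M.Realises V x y A) : ∃ A' : M.Mat,
    Relation.ReflTransGen M.CentralOp A A' ∧
    ∃ f : {q // (M.cols.label q).IsCentral} → {p // (M.rows.label p).IsCentral},
      Function.Injective f ∧ ∀ p q, A' p.1 q.1 = if f q = p then 1 else 0 := by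
  obtain ⟨A', h1, -, h3⟩ := exists_reflTransGen_reduceSubmatrix (M := M)
    (R := fun p => (M.rows.label p).IsCentral) (C := fun q => (M.cols.label q).IsCentral)
    (okC := fun s t => (M.cols.label s).IsCentral ∧ (M.cols.label t).IsCentral)
    (okR := fun s t => (M.rows.label s).IsCentral ∧ (M.rows.label t).IsCentral)
    (fun p q hp hq hz => hz.1 ⟨hp.1, hq.1⟩) (fun s t hs ht _ => ⟨hs, ht⟩)
    (fun s t hs ht _ => ⟨hs, ht⟩) A fun A' hA' _ q hq => by
    obtain ⟨x', y', h'⟩ := h.reflTransGen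
      (centralOps_permissible hA')
    exact h'.exists_central hq
  exact ⟨A', h1, h3⟩

open Classical in
-- Pivots give injections from left columns to left rows and from central columns to central rows.
-- Left and central bars together are counted by the dimension at 0̂, so both inequalities are
-- equalities; the dimension at 1̂ then settles the right bars.
theorem card_eq (h : M.Realises V x y A) :
    Fintype.card {q // (M.cols.label q).IsLeft} = Fintype.card {p // (M.rows.label p).IsLeft} ∧
    Fintype.card {q // (M.cols.label q).IsCentral} =
      Fintype.card {p // (M.rows.label p).IsCentral} ∧
    Fintype.card {q // (M.cols.label q).IsRight} =
      Fintype.card {p // (M.rows.label p).IsRight} := by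
  obtain ⟨_, -, -, f, hf, -⟩ := h.exists_reduce_left
  obtain ⟨_, -, g, hg, -⟩ := h.exists_reduce_central
  have hl := Fintype.card_le_of_injective f hf
  have hc := Fintype.card_le_of_injective g hg
  have c0 : Fintype.card {q // (M.cols.label q).fst = ⊥} = Nat.card {i // (M.barU i).fst = ⊥} := by
    rw [← Nat.card_eq_fintype_card]
    refine Nat.card_congr ⟨fun q => ⟨M.colBar q.1, q.2⟩, fun i =>
      ⟨M.cols.idx.symm ⟨i.1, notOther_of_fst i.2⟩, ?_⟩, fun q => ?_, fun i => ?_⟩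
    · simpa [EndListing.label] using i.2
    · simp [colBar]
    · simp [colBar]
  have c1 : Fintype.card {q // (M.cols.label q).snd = ⊤} = Nat.card {i // (M.barU i).snd = ⊤} := by
    rw [← Nat.card_eq_fintype_card]
    refine Nat.card_congr ⟨fun q => ⟨M.colBar q.1, q.2⟩, fun i =>
      ⟨M.cols.idx.symm ⟨i.1, notOther_of_snd i.2⟩, ?_⟩, fun q => ?_, fun i => ?_⟩
    · simpa [EndListing.label] using i.2
    · simp [colBar]
    · simp [colBar]
  have r0 : Fintype.card {q // (M.rows.label q).fst = ⊥} = Nat.card {i // (M.barD i).fst = ⊥} := by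
    rw [← Nat.card_eq_fintype_card]
    refine Nat.card_congr ⟨fun q => ⟨M.rowBar q.1, q.2⟩, fun i =>
      ⟨M.rows.idx.symm ⟨i.1, notOther_of_fst i.2⟩, ?_⟩, fun q => ?_, fun i => ?_⟩
    · simpa [EndListing.label] using i.2
    · simp [rowBar]
    · simp [rowBar]
  have r1 : Fintype.card {q // (M.rows.label q).snd = ⊤} = Nat.card {i // (M.barD i).snd = ⊤} := by
    rw [← Nat.card_eq_fintype_card]
    refine Nat.card_congr ⟨fun q => ⟨M.rowBar q.1, q.2⟩, fun i =>
      ⟨M.rows.idx.symm ⟨i.1, notOther_of_snd i.2⟩, ?_⟩, fun q => ?_, fun i => ?_⟩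
    · simpa [EndListing.label] using i.2
    · simp [rowBar]
    · simp [rowBar]
  have e0 := h.endU.card₀.trans h.endD.card₀.symm
  have e1 := h.endU.card₁.trans h.endD.card₁.symm
  rw [← c0, ← r0] at e0
  rw [← c1, ← r1] at e1
  have hfst : ∀ {n : ℕ} (I : Bar n), I.fst = ⊥ ↔ I.IsLeft ∨ I.IsCentral := fun I => by
    unfold Bar.IsLeft Bar.IsCentral; tauto
  have hsnd : ∀ {n : ℕ} (I : Bar n), I.snd = ⊤ ↔ I.IsCentral ∨ I.IsRight := fun I => by
    unfold Bar.IsRight Bar.IsCentral; tauto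
  have a0 := card_subtype_add (fun q => hfst (M.cols.label q)) (fun q h1 h2 => h1.2 h2.2)
  have a1 := card_subtype_add (fun p => hfst (M.rows.label p)) (fun q h1 h2 => h1.2 h2.2)
  have a2 := card_subtype_add (fun q => hsnd (M.cols.label q)) (fun q h1 h2 => h2.1 h1.1)
  have a3 := card_subtype_add (fun p => hsnd (M.rows.label p)) (fun q h1 h2 => h2.1 h1.1)
  simp only [← Nat.card_eq_fintype_card] at *
  omega

open Classical in
theorem exists_centralIdentity (h : M.Realises V x y A) :
    ∃ A' : M.Mat, Relation.ReflTransGen M.CentralOp A A' ∧ M.CentralIdentity A' := by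
  obtain ⟨A', h1, f, hf, hf'⟩ := h.exists_reduce_central
  have hcard := h.card_eq.2.1
  let F := Equiv.ofBijective f ((Fintype.bijective_iff_injective_and_card f).2 ⟨hf, hcard⟩)
  let e : {q // (M.cols.label q).IsCentral} ≃o {p // (M.rows.label p).IsCentral} :=
    (Fintype.orderIsoFinOfCardEq _ hcard).symm.trans (Fintype.orderIsoFinOfCardEq _ rfl)
  -- Reordering the columns by `σ` turns the permutation given by the pivots into the order
  -- isomorphism required of an identity block.
  let σ : Equiv.Perm {q // (M.cols.label q).IsCentral} := e.toEquiv.trans F.symm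
  refine ⟨fun p q => A' p (Equiv.Perm.ofSubtype σ q), h1.trans ?_, e, fun p q => ?_⟩
  · exact reflTransGen_permuteCols A' (fun q => (M.cols.label q).IsCentral)
      (fun s t hs ht => ⟨hs, ht⟩) σ
  · simp only [Equiv.Perm.ofSubtype_apply_coe]
    rw [hf']
    have : f (σ q) = e q := F.apply_symm_apply (e q)
    rw [this]

end Realises

end BlockProblem

/-! ### Clearing beside the central block, and the normal form -/

namespace BlockProblem

variable {k : Type u} [Field k] {n m : ℕ} {M : BlockProblem k n m}

namespace Realises

variable {V : BipathPoset n m ⥤ ModuleCat.{v} k} {x : Fin M.sizeU → ∀ a, (restrictUpper V).obj a}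
  {y : Fin M.sizeD → ∀ a, (restrictLower V).obj a} {A : M.Mat}

/-- Central columns are added to right columns and central rows to left rows, with the entries to be
removed as coefficients. Nothing else changes: the remaining entries of the central rows and columns
that could interfere vanish by `eq_zero`, or their targets are strongly zero. -/
theorem reachable_clearBesideCentral (h : M.Realises V x y A) (hA : M.CentralIdentity A) :
    Relation.ReflTransGen M.Permissible A (M.clearBesideCentral A) := by
  classical
  obtain ⟨e, he⟩ := hA
  let c : Fin M.cols.num → Fin M.cols.num → k := fun s t =>
    if hs : (M.cols.label s).IsCentral then
      if (M.cols.label t).IsRight then - A (e ⟨s, hs⟩).1 t else 0 else 0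
  have h1 := reflTransGen_addCols (M := M)
    (okC := fun s t => M.cols.label s = M.cols.label t ∨
      StrictSub k (M.cols.label s) (M.cols.label t))
    (okR := fun s t => M.rows.label s = M.rows.label t ∨
      StrictSub k (M.rows.label t) (M.rows.label s)) A c
    (fun s t hc => by
      have hs : (M.cols.label s).IsCentral := by by_contra h'; simp [c, h'] at hc
      have ht : (M.cols.label t).IsRight := by by_contra h'; simp [c, h'] at hc
      refine ⟨fun hst => ht.1 (hst ▸ hs.1), eq_or_strictSub_of_le (hs.1.le.trans bot_le)
        (le_top.trans hs.2.ge) (le_top.trans ht.2.ge)⟩)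
    (fun r s t hc => by
      have hs : (M.cols.label s).IsCentral := by by_contra h'; simp [c, h'] at hc
      have hs' : ¬ (M.cols.label s).IsRight := fun h' => h'.1 hs.1
      simp [c, hs'])
  set A₁ : M.Mat := fun p q =>
    if M.StronglyZero p q then A p q else A p q + ∑ s, c s q * A p s with hA₁
  have e1 : ∀ p q, A₁ p q =
      if (M.rows.label p).IsCentral ∧ (M.cols.label q).IsRight then 0 else A p q := by
    intro p q
    by_cases hq : (M.cols.label q).IsRight
    · by_cases hp : (M.rows.label p).IsCentral
      · have hz : ¬ M.StronglyZero p q := fun hz => hz.2 ⟨hp.2, hq.2⟩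
        rw [if_pos ⟨hp, hq⟩]
        simp only [hA₁, if_neg hz]
        rw [Finset.sum_eq_single (e.symm ⟨p, hp⟩).1]
        · have h2 := he ⟨p, hp⟩ (e.symm ⟨p, hp⟩)
          simp only [OrderIso.apply_symm_apply, if_true] at h2
          rw [h2]
          simp [c, (e.symm ⟨p, hp⟩).2, hq]
        · intro s _ hs
          by_cases hs' : (M.cols.label s).IsCentral
          · have h2 := he ⟨p, hp⟩ ⟨s, hs'⟩
            rw [if_neg (fun h3 => hs (by rw [← h3]; simp))] at h2
            simp only at h2
            rw [h2, mul_zero]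
          · simp [c, hs']
        · simp
      · rw [if_neg (fun h' => hp h'.1)]
        by_cases hz : M.StronglyZero p q
        · simp only [hA₁, if_pos hz]
        · simp only [hA₁, if_neg hz]
          rw [Finset.sum_eq_zero, add_zero]
          intro s _
          by_cases hs : (M.cols.label s).IsCentral
          -- In a right column, a row that is neither strongly zero nor central is a right row, and
          -- its entries in central columns vanish.
          · have hp' : (M.rows.label p).snd = ⊤ := by
              by_contra h'
              exact hz ⟨fun h'' => hq.1 h''.2, fun h'' => h' h''.1⟩
            rw [h.eq_zero hs.1 hp' (Or.inl fun h' => hp ⟨h', hp'⟩), mul_zero]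
          · simp [c, hs]
    · rw [if_neg (fun h' => hq h'.2)]
      simp [hA₁, c, hq]
  let d : Fin M.rows.num → Fin M.rows.num → k := fun s t =>
    if hs : (M.rows.label s).IsCentral then
      if (M.rows.label t).IsLeft then - A t (e.symm ⟨s, hs⟩).1 else 0 else 0
  have h2 := reflTransGen_addRows (M := M)
    (okC := fun s t => M.cols.label s = M.cols.label t ∨
      StrictSub k (M.cols.label s) (M.cols.label t))
    (okR := fun s t => M.rows.label s = M.rows.label t ∨
      StrictSub k (M.rows.label t) (M.rows.label s)) A₁ d
    (fun s t hc => by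
      have hs : (M.rows.label s).IsCentral := by by_contra h'; simp [d, h'] at hc
      have ht : (M.rows.label t).IsLeft := by by_contra h'; simp [d, h'] at hc
      refine ⟨fun hst => ht.2 (hst ▸ hs.2), (eq_or_strictSub_of_le (ht.1.le.trans bot_le)
        (hs.1.le.trans bot_le) (le_top.trans hs.2.ge)).imp_left Eq.symm⟩)
    (fun r s t hc => by
      have hs : (M.rows.label s).IsCentral := by by_contra h'; simp [d, h'] at hc
      have hs' : ¬ (M.rows.label s).IsLeft := fun h' => h'.2 hs.2
      simp [d, hs'])
  refine h1.trans (reflTransGen_congr (fun p q => ?_) h2)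
  unfold clearBesideCentral
  by_cases hp : (M.rows.label p).IsLeft
  · have hpc : ¬ (M.rows.label p).IsCentral := fun h' => hp.2 h'.2
    by_cases hq : (M.cols.label q).IsCentral
    · have hz : ¬ M.StronglyZero p q := fun hz => hz.1 ⟨hp.1, hq.1⟩
      rw [if_pos (Or.inr ⟨hp, hq⟩), if_neg hz, e1, if_neg (fun h' => hpc h'.1),
        Finset.sum_eq_single (e ⟨q, hq⟩).1]
      · have h3 := he (e ⟨q, hq⟩) ⟨q, hq⟩
        rw [if_pos rfl] at h3
        simp only at h3
        rw [e1, if_neg (fun h' => h'.2.1 hq.1), h3]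
        simp [d, (e ⟨q, hq⟩).2, hp]
      · intro s _ hs
        by_cases hs' : (M.rows.label s).IsCentral
        · have h3 := he ⟨s, hs'⟩ ⟨q, hq⟩
          rw [if_neg (fun h3 => hs (by rw [h3]))] at h3
          simp only at h3
          rw [e1, if_neg (fun h' => h'.2.1 hq.1), h3, mul_zero]
        · simp [d, hs']
      · simp
    · have hn : ¬ ((M.rows.label p).IsCentral ∧ (M.cols.label q).IsRight ∨
          (M.rows.label p).IsLeft ∧ (M.cols.label q).IsCentral) := by tauto
      rw [if_neg hn]
      by_cases hz : M.StronglyZero p q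
      · rw [if_pos hz, e1, if_neg (fun h' => hpc h'.1)]
      · rw [if_neg hz, e1, if_neg (fun h' => hpc h'.1), Finset.sum_eq_zero, add_zero]
        intro s _
        by_cases hs : (M.rows.label s).IsCentral
        · have hq' : (M.cols.label q).fst = ⊥ := by
            by_contra h'
            exact hz ⟨fun h'' => h' h''.2, fun h'' => hp.2 h''.1⟩
          rw [e1, if_neg (fun h' => h'.2.1 hq'),
            h.eq_zero hq' hs.2 (Or.inr fun h' => hq ⟨hq', h'⟩), mul_zero]
        · simp [d, hs]
  · have h3 : (if M.StronglyZero p q then A₁ p q else A₁ p q + ∑ s, d s p * A₁ s q) = A₁ p q := by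
      simp [d, hp]
    rw [h3, e1]
    simp [hp]

/-- All entries outside of the diagonal blocks vanish. -/
def _root_.BlockProblem.IsBlockDiagonal (A : M.Mat) : Prop :=
  ∀ p q, A p q ≠ 0 → ((M.rows.label p).IsLeft ∧ (M.cols.label q).IsLeft) ∨
    ((M.rows.label p).IsCentral ∧ (M.cols.label q).IsCentral) ∨
    ((M.rows.label p).IsRight ∧ (M.cols.label q).IsRight)

/-- Of the six blocks off the diagonal, two are strongly zero, two vanish by `eq_zero`, and two have
just been cleared. -/
theorem isBlockDiagonal_clearBesideCentral (h : M.Realises V x y A) :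
    M.IsBlockDiagonal (M.clearBesideCentral A) := by
  classical
  intro p q hpq
  unfold clearBesideCentral at hpq
  split_ifs at hpq with h0
  · exact (hpq rfl).elim
  · have hz : ¬ M.StronglyZero p q := fun hz => hpq (h.zero p q hz)
    by_cases hq : (M.cols.label q).fst = ⊥
    · by_cases hp : (M.rows.label p).snd = ⊤
      · by_cases hp' : (M.rows.label p).fst = ⊥
        · by_cases hq' : (M.cols.label q).snd = ⊤
          · exact Or.inr (Or.inl ⟨⟨hp', hp⟩, ⟨hq, hq'⟩⟩)
          · exact (hpq (h.eq_zero hq hp (Or.inr hq'))).elim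
        · exact (hpq (h.eq_zero hq hp (Or.inl hp'))).elim
      · have hp' := (not_other_row p).resolve_right hp
        by_cases hq' : (M.cols.label q).snd = ⊤
        · exact (h0 (Or.inr ⟨⟨hp', hp⟩, ⟨hq, hq'⟩⟩)).elim
        · exact Or.inl ⟨⟨hp', hp⟩, ⟨hq, hq'⟩⟩
    · have hq' := (not_other_col q).resolve_left hq
      have hp : (M.rows.label p).snd = ⊤ := by
        by_contra hp
        exact hz ⟨fun g => hq g.2, fun g => hp g.1⟩
      by_cases hp' : (M.rows.label p).fst = ⊥
      · exact (h0 (Or.inl ⟨⟨hp', hp⟩, ⟨hq, hq'⟩⟩)).elim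
      · exact Or.inr (Or.inr ⟨⟨hp', hp⟩, ⟨hq, hq'⟩⟩)

theorem reachable_and_isNormalForm (h : M.Realises V x y M.initial) {A : M.Mat}
    (hA : M.ProcedureResult A) : M.Reachable A ∧ M.IsNormalForm A := by
  classical
  obtain ⟨A₁, hA₁, hc, hA⟩ := hA
  have r1 : M.Reachable A₁ := centralOps_permissible hA₁
  obtain ⟨x₁, y₁, h1⟩ := h.reflTransGen r1
  have r2 : M.Reachable (M.clearBesideCentral A₁) :=
    Relation.ReflTransGen.trans r1 (h1.reachable_clearBesideCentral hc)
  have d2 := h1.isBlockDiagonal_clearBesideCentral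
  set A₂ := M.clearBesideCentral A₁ with hA₂
  have c2 : ∀ p q, (M.rows.label p).IsCentral → (M.cols.label q).IsCentral → A₂ p q = A₁ p q := by
    intro p q hp hq
    rw [hA₂, clearBesideCentral]
    exact if_neg fun h' => h'.elim (fun h' => h'.2.1 hq.1) fun h' => h'.1.2 hp.2
  obtain ⟨x₂, y₂, h2⟩ := h.reflTransGen r2
  obtain ⟨A₃, r3, e3, fL, hfL, hL⟩ := h2.exists_reduce_left
  have e3 := e3 fun p q hpq => by
    by_contra h0
    rcases d2 p q h0 with h' | h' | h'
    · exact hpq ⟨fun _ => h'.2, fun _ => h'.1⟩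
    · exact hpq ⟨fun g => (g.2 h'.1.2).elim, fun g => (g.2 h'.2.2).elim⟩
    · exact hpq ⟨fun g => (g.2 h'.1.2).elim, fun g => (g.2 h'.2.2).elim⟩
  have off3 : ∀ p q, ¬ ((M.rows.label p).IsLeft ∧ (M.cols.label q).IsLeft) →
      A₃ p q = A₂ p q := fun p q hpq => by
    rw [e3]; exact reduceSubmatrix_of_not_mem A₂ hpq
  obtain ⟨x₃, y₃, h3⟩ := h2.reflTransGen r3
  have d3 : M.IsBlockDiagonal A₃ := fun p q hpq => by
    by_cases h' : (M.rows.label p).IsLeft ∧ (M.cols.label q).IsLeft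
    · exact Or.inl h'
    · exact d2 p q (off3 p q h' ▸ hpq)
  obtain ⟨A₄, r4, e4, fR, hfR, hR⟩ := h3.exists_reduce_right fun p q hpq => by
    by_contra h0
    rcases d3 p q h0 with h' | h' | h'
    · exact hpq ⟨fun g => (h'.1.2 g.2).elim, fun g => (h'.2.2 g.2).elim⟩
    · exact hpq ⟨fun g => (g.1 h'.1.1).elim, fun g => (g.1 h'.2.1).elim⟩
    · exact hpq ⟨fun _ => h'.2, fun _ => h'.1⟩
  have off4 : ∀ p q, ¬ ((M.rows.label p).IsRight ∧ (M.cols.label q).IsRight) →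
      A₄ p q = A₃ p q := fun p q hpq => by
    rw [e4]; exact reduceSubmatrix_of_not_mem A₃ hpq
  have hA4 : A = A₄ := by rw [hA, e4, e3]
  rw [hA4]
  have d4 : M.IsBlockDiagonal A₄ := fun p q hpq => by
    by_cases h' : (M.rows.label p).IsRight ∧ (M.cols.label q).IsRight
    · exact Or.inr (Or.inr h')
    · exact d3 p q (off4 p q h' ▸ hpq)
  have b4 : ∀ p q, (M.rows.label p).IsCentral → (M.cols.label q).IsCentral →
      A₄ p q = A₁ p q := fun p q hp hq => by
    rw [off4 p q (fun h' => h'.2.1 hq.1), off3 p q (fun h' => h'.2.2 hq.2), c2 p q hp hq]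
  have l4 : ∀ (p : {p // (M.rows.label p).IsLeft}) (q : {q // (M.cols.label q).IsLeft}),
      A₄ p.1 q.1 = if fL q = p then 1 else 0 := fun p q => by
    rw [off4 p.1 q.1 (fun h' => h'.2.1 q.2.1), hL]
  refine ⟨(Relation.ReflTransGen.trans r2 r3).trans r4, ?_, ?_⟩
  · obtain ⟨e, he⟩ := hc
    exact ⟨e, fun p q => by rw [b4 _ _ p.2 q.2, he]⟩
  obtain ⟨eC, heC⟩ := hc
  -- Each column is a unit vector inside its diagonal block and, by block diagonality, zero outside;
  -- this combines the three pivot maps into one.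
  have key : ∀ q, ∃ p, (((M.rows.label p).IsLeft ↔ (M.cols.label q).IsLeft) ∧
      ((M.rows.label p).IsCentral ↔ (M.cols.label q).IsCentral) ∧
      ((M.rows.label p).IsRight ↔ (M.cols.label q).IsRight)) ∧
      ∀ p', A₄ p' q = if p = p' then 1 else 0 := by
    intro q
    have hl : ∀ {n : ℕ} (I : Bar n), I.IsLeft → ¬ I.IsCentral ∧ ¬ I.IsRight := fun I hI =>
      ⟨fun h' => hI.2 h'.2, fun h' => hI.2 h'.2⟩
    have hcc : ∀ {n : ℕ} (I : Bar n), I.IsCentral → ¬ I.IsLeft ∧ ¬ I.IsRight := fun I hI =>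
      ⟨fun h' => h'.2 hI.2, fun h' => h'.1 hI.1⟩
    have hr : ∀ {n : ℕ} (I : Bar n), I.IsRight → ¬ I.IsLeft ∧ ¬ I.IsCentral := fun I hI =>
      ⟨fun h' => h'.2 hI.2, fun h' => hI.1 h'.1⟩
    rcases isLeft_or_isCentral_or_isRight_col q with hq | hq | hq
    · refine ⟨fL ⟨q, hq⟩, ?_, fun p' => ?_⟩
      · have := (fL ⟨q, hq⟩).2
        simp [hq, this, hl _ hq, hl _ this]
      · by_cases hp : (M.rows.label p').IsLeft
        · simpa [Subtype.ext_iff] using l4 ⟨p', hp⟩ ⟨q, hq⟩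
        · rw [if_neg (fun h' : (fL ⟨q, hq⟩).1 = p' => hp (h' ▸ (fL ⟨q, hq⟩).2))]
          by_contra h0
          have := d4 p' q h0
          simp [hp, hl _ hq] at this
    · refine ⟨eC ⟨q, hq⟩, ?_, fun p' => ?_⟩
      · have := (eC ⟨q, hq⟩).2
        simp [hq, this, hcc _ hq, hcc _ this]
      · by_cases hp : (M.rows.label p').IsCentral
        · rw [b4 p' q hp hq]
          simpa [Subtype.ext_iff] using heC ⟨p', hp⟩ ⟨q, hq⟩
        · rw [if_neg (fun h' : (eC ⟨q, hq⟩).1 = p' => hp (h' ▸ (eC ⟨q, hq⟩).2))]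
          by_contra h0
          have := d4 p' q h0
          simp [hp, hcc _ hq] at this
    · refine ⟨fR ⟨q, hq⟩, ?_, fun p' => ?_⟩
      · have := (fR ⟨q, hq⟩).2
        simp [hq, this, hr _ hq, hr _ this]
      · by_cases hp : (M.rows.label p').IsRight
        · simpa [Subtype.ext_iff] using hR ⟨p', hp⟩ ⟨q, hq⟩
        · rw [if_neg (fun h' : (fR ⟨q, hq⟩).1 = p' => hp (h' ▸ (fR ⟨q, hq⟩).2))]
          by_contra h0
          have := d4 p' q h0
          simp [hp, hr _ hq] at this
  choose f hf hf' using key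
  have hinj : Function.Injective f := by
    intro q q' hqq
    rcases isLeft_or_isCentral_or_isRight_col q with hq | hq | hq
    · have hq' : (M.cols.label q').IsLeft := (hf q').1.1 (hqq ▸ (hf q).1.2 hq)
      have hp := (hf q).1.2 hq
      have h5 := (l4 ⟨f q, hp⟩ ⟨q, hq⟩).symm.trans (hf' q (f q))
      have h6 := (l4 ⟨f q, hp⟩ ⟨q', hq'⟩).symm.trans (hf' q' (f q))
      simp [hqq.symm] at h5 h6
      exact congrArg Subtype.val (hfL (h5.trans h6.symm))
    · have hq' : (M.cols.label q').IsCentral := (hf q').2.1.1 (hqq ▸ (hf q).2.1.2 hq)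
      have hp := (hf q).2.1.2 hq
      have h5 := ((heC ⟨f q, hp⟩ ⟨q, hq⟩).symm.trans (b4 _ _ hp hq).symm).trans (hf' q (f q))
      have h6 := ((heC ⟨f q, hp⟩ ⟨q', hq'⟩).symm.trans (b4 _ _ hp hq').symm).trans (hf' q' (f q))
      simp [hqq.symm] at h5 h6
      exact congrArg Subtype.val (eC.injective (h5.trans h6.symm))
    · have hq' : (M.cols.label q').IsRight := (hf q').2.2.1 (hqq ▸ (hf q).2.2.2 hq)
      have hp := (hf q).2.2.2 hq
      have h5 := (hR ⟨f q, hp⟩ ⟨q, hq⟩).symm.trans (hf' q (f q))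
      have h6 := (hR ⟨f q, hp⟩ ⟨q', hq'⟩).symm.trans (hf' q' (f q))
      simp [hqq.symm] at h5 h6
      exact congrArg Subtype.val (hfR (h5.trans h6.symm))
  -- Equal sizes of the three blocks make the injective pivot map a bijection.
  have hcard : Fintype.card (Fin M.cols.num) = Fintype.card (Fin M.rows.num) := by
    obtain ⟨k1, k2, k3⟩ := h.card_eq
    have t1 := card_subtype_add (α := Fin M.cols.num) (p := fun _ => True)
      (q := fun q => (M.cols.label q).IsLeft) (r := fun q => (M.cols.label q).IsCentral ∨
        (M.cols.label q).IsRight) (fun q => by simpa using isLeft_or_isCentral_or_isRight_col q)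
      (fun q h1 h2 => h2.elim (fun h2 => h1.2 h2.2) fun h2 => h1.2 h2.2)
    have t2 := card_subtype_add (α := Fin M.cols.num) (fun q => Iff.rfl)
      (q := fun q => (M.cols.label q).IsCentral) (r := fun q => (M.cols.label q).IsRight)
      (fun q h1 h2 => h2.1 h1.1)
    have t3 := card_subtype_add (α := Fin M.rows.num) (p := fun _ => True)
      (q := fun q => (M.rows.label q).IsLeft) (r := fun q => (M.rows.label q).IsCentral ∨
        (M.rows.label q).IsRight) (fun q => by simpa using isLeft_or_isCentral_or_isRight_row q)
      (fun q h1 h2 => h2.elim (fun h2 => h1.2 h2.2) fun h2 => h1.2 h2.2)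
    have t4 := card_subtype_add (α := Fin M.rows.num) (fun q => Iff.rfl)
      (q := fun q => (M.rows.label q).IsCentral) (r := fun q => (M.rows.label q).IsRight)
      (fun q h1 h2 => h2.1 h1.1)
    have u1 : Nat.card {_q : Fin M.cols.num // True} = Nat.card (Fin M.cols.num) :=
      Nat.card_congr (Equiv.subtypeUnivEquiv fun _ => trivial)
    have u2 : Nat.card {_q : Fin M.rows.num // True} = Nat.card (Fin M.rows.num) :=
      Nat.card_congr (Equiv.subtypeUnivEquiv fun _ => trivial)
    simp only [← Nat.card_eq_fintype_card] at *
    omega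
  refine ⟨Equiv.ofBijective f ((Fintype.bijective_iff_injective_and_card f).2 ⟨hinj, hcard⟩), hf,
    fun p q => hf' q p⟩

end Realises

end BlockProblem

/-! ### Gluing interval bases of the two paths -/

section Bipath

variable {n m : ℕ}

theorem upperPath_le_upperPath {a b : PathPoset n} :
    upperPath n m a ≤ upperPath n m b ↔ a ≤ b :=
  WithBot.map_le_iff (WithTop.map Sum.inl)
    (fun {_ _} => WithTop.map_le_iff Sum.inl Sum.inl_le_inl_iff)

theorem lowerPath_le_lowerPath {a b : PathPoset m} :
    lowerPath n m a ≤ lowerPath n m b ↔ a ≤ b :=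
  WithBot.map_le_iff (WithTop.map Sum.inr)
    (fun {_ _} => WithTop.map_le_iff Sum.inr Sum.inr_le_inr_iff)

theorem eq_of_upperPath_le_lowerPath {a : PathPoset n} {b : PathPoset m}
    (h : upperPath n m a ≤ lowerPath n m b) : a = ⊥ ∨ b = ⊤ := by
  rcases a with _ | _ | a
  · exact Or.inl rfl
  · rcases b with _ | _ | b
    · exact absurd h (WithBot.not_coe_le_bot _)
    · exact Or.inr rfl
    · exact absurd (top_le_iff.1 (WithBot.coe_le_coe.1 h)) (WithTop.coe_ne_top)
  · rcases b with _ | _ | b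
    · exact absurd h (WithBot.not_coe_le_bot _)
    · exact Or.inr rfl
    · exact absurd (WithTop.coe_le_coe.1 (WithBot.coe_le_coe.1 h)) Sum.not_inl_le_inr

theorem eq_of_lowerPath_le_upperPath {a : PathPoset m} {b : PathPoset n}
    (h : lowerPath n m a ≤ upperPath n m b) : a = ⊥ ∨ b = ⊤ := by
  rcases a with _ | _ | a
  · exact Or.inl rfl
  · rcases b with _ | _ | b
    · exact absurd h (WithBot.not_coe_le_bot _)
    · exact Or.inr rfl
    · exact absurd (top_le_iff.1 (WithBot.coe_le_coe.1 h)) (WithTop.coe_ne_top)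
  · rcases b with _ | _ | b
    · exact absurd h (WithBot.not_coe_le_bot _)
    · exact Or.inr rfl
    · exact absurd (WithTop.coe_le_coe.1 (WithBot.coe_le_coe.1 h)) Sum.not_inr_le_inl

theorem exists_eq_upperPath_or_lowerPath (a : BipathPoset n m) :
    (∃ u, a = upperPath n m u) ∨ ∃ v, a = lowerPath n m v := by
  rcases a with _ | _ | i | j
  · exact Or.inl ⟨⊥, rfl⟩
  · exact Or.inl ⟨⊤, rfl⟩
  · exact Or.inl ⟨((i : WithTop (Fin n)) : PathPoset n), rfl⟩
  · exact Or.inr ⟨((j : WithTop (Fin m)) : PathPoset m), rfl⟩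

variable {k : Type u} [Field k] {V : BipathPoset n m ⥤ ModuleCat.{v} k}

/-- The section over the bipath poset glued from sections over the two paths. -/
def glueSection (x : ∀ a, (restrictUpper V).obj a) (y : ∀ a, (restrictLower V).obj a) :
    ∀ a, V.obj a
  | none => x ⊥
  | some none => x ⊤
  | some (some (.inl i)) => x ((i : WithTop (Fin n)) : PathPoset n)
  | some (some (.inr j)) => y ((j : WithTop (Fin m)) : PathPoset m)

theorem glueSection_upperPath (x : ∀ a, (restrictUpper V).obj a)
    (y : ∀ a, (restrictLower V).obj a) (a : PathPoset n) :
    glueSection x y (upperPath n m a) = x a := by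
  rcases a with _ | _ | a <;> rfl

theorem glueSection_lowerPath {x : ∀ a, (restrictUpper V).obj a}
    {y : ∀ a, (restrictLower V).obj a} (h₀ : (x ⊥ : V.obj ⊥) = y ⊥) (h₁ : (x ⊤ : V.obj ⊤) = y ⊤)
    (a : PathPoset m) : glueSection x y (lowerPath n m a) = y a := by
  rcases a with _ | _ | a
  · exact h₀
  · exact h₁
  · rfl

theorem linearIndependent_of_dual {ι W : Type*} [AddCommGroup W] [Module k W] (s : Set ι)
    (v : ι → W) (h : ∀ i ∈ s, ∃ f : W →ₗ[k] k, f (v i) = 1 ∧ ∀ j, j ≠ i → f (v j) = 0) :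
    LinearIndependent k (fun i : s => v i) := by
  classical
  rw [linearIndependent_iff']
  intro t g hg i hi
  obtain ⟨f, hf, hf'⟩ := h i.1 i.2
  have := congrArg f hg
  rw [map_sum, Finset.sum_eq_single i, map_smul, hf, map_zero] at this
  · simpa using this
  · intro j _ hj
    rw [map_smul, hf' j.1 (fun e => hj (Subtype.ext e)), smul_zero]
  · exact fun h' => (h' hi).elim

/-- All conditions can be tested on the two paths. Independence is asked for through dual
functionals, so that the coordinates of the bases of the paths apply even though the family contains
sections that vanish on a whole path. -/
theorem isIntervalBasis_glueSection {ι : Type*} {I : ι → PosetInterval (BipathPoset n m)}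
    {x : ι → ∀ a, (restrictUpper V).obj a} {y : ι → ∀ a, (restrictLower V).obj a}
    (h₀ : ∀ i, (x i ⊥ : V.obj ⊥) = y i ⊥) (h₁ : ∀ i, (x i ⊤ : V.obj ⊤) = y i ⊤)
    (zeroU : ∀ i a, upperPath n m a ∉ (I i).carrier → x i a = 0)
    (zeroD : ∀ i a, lowerPath n m a ∉ (I i).carrier → y i a = 0)
    (mapU : ∀ i {a b : PathPoset n} (h : a ≤ b), upperPath n m a ∈ (I i).carrier →
      push (restrictUpper V) h (x i a) = x i b)
    (mapD : ∀ i {a b : PathPoset m} (h : a ≤ b), lowerPath n m a ∈ (I i).carrier →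
      push (restrictLower V) h (y i a) = y i b)
    (coordU : ∀ a i, upperPath n m a ∈ (I i).carrier → ∃ f : (restrictUpper V).obj a →ₗ[k] k,
      f (x i a) = 1 ∧ ∀ j, j ≠ i → f (x j a) = 0)
    (coordD : ∀ a i, lowerPath n m a ∈ (I i).carrier → ∃ f : (restrictLower V).obj a →ₗ[k] k,
      f (y i a) = 1 ∧ ∀ j, j ≠ i → f (y j a) = 0)
    (spanU : ∀ a, Submodule.span k (Set.range fun i => x i a) = ⊤)
    (spanD : ∀ a, Submodule.span k (Set.range fun i => y i a) = ⊤) :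
    IsIntervalBasis V I (fun i => glueSection (x i) (y i)) := by
  have eU : ∀ i a, glueSection (x i) (y i) (upperPath n m a) = x i a := fun i a =>
    glueSection_upperPath _ _ a
  have eD : ∀ i a, glueSection (x i) (y i) (lowerPath n m a) = y i a := fun i a =>
    glueSection_lowerPath (h₀ i) (h₁ i) a
  have gU : ∀ i {a b : PathPoset n} (h : a ≤ b)
      (h' : upperPath n m a ≤ upperPath n m b), upperPath n m a ∈ (I i).carrier →
      push V h' (glueSection (x i) (y i) (upperPath n m a)) =
        glueSection (x i) (y i) (upperPath n m b) := fun i a b h h' hi => by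
    rw [eU, eU]
    exact mapU i h hi
  have gD : ∀ i {a b : PathPoset m} (h : a ≤ b)
      (h' : lowerPath n m a ≤ lowerPath n m b), lowerPath n m a ∈ (I i).carrier →
      push V h' (glueSection (x i) (y i) (lowerPath n m a)) =
        glueSection (x i) (y i) (lowerPath n m b) := fun i a b h h' hi => by
    rw [eD, eD]
    exact mapD i h hi
  refine ⟨fun i a h => ?_, fun i a b h hi => ?_, fun a => ?_, fun a => ?_⟩
  · obtain ⟨u, rfl⟩ | ⟨u, rfl⟩ := exists_eq_upperPath_or_lowerPath a
    · rw [eU]; exact zeroU i u h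
    · rw [eD]; exact zeroD i u h
  · obtain ⟨u, rfl⟩ | ⟨u, rfl⟩ := exists_eq_upperPath_or_lowerPath a <;>
    obtain ⟨w, rfl⟩ | ⟨w, rfl⟩ := exists_eq_upperPath_or_lowerPath b
    · exact gU i (upperPath_le_upperPath.1 h) h hi
    -- A relation between points of different paths starts at 0̂ or ends at 1̂, hence lies in a
    -- single path.
    · obtain rfl | rfl := eq_of_upperPath_le_lowerPath h
      · exact gD i (bot_le : ⊥ ≤ w) h hi
      · exact gU i (le_top : u ≤ ⊤) h hi
    · obtain rfl | rfl := eq_of_lowerPath_le_upperPath h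
      · exact gU i (bot_le : ⊥ ≤ w) h hi
      · exact gD i (le_top : u ≤ ⊤) h hi
    · exact gD i (lowerPath_le_lowerPath.1 h) h hi
  · refine linearIndependent_of_dual {i | a ∈ (I i).carrier}
      (fun i => glueSection (x i) (y i) a) fun i hi => ?_
    obtain ⟨u, rfl⟩ | ⟨u, rfl⟩ := exists_eq_upperPath_or_lowerPath a
    · simp only [eU]
      exact coordU u i hi
    · simp only [eD]
      exact coordD u i hi
  · obtain ⟨u, rfl⟩ | ⟨u, rfl⟩ := exists_eq_upperPath_or_lowerPath a
    · simp only [eU]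
      exact spanU u
    · simp only [eD]
      exact spanD u

end Bipath

/-! ### Glued bars and the output of a normal form -/

namespace BlockProblem

variable {k : Type u} [Field k] {n m : ℕ} {M : BlockProblem k n m}

/-- Two bars of the upper and the lower path can be glued. -/
def Matched (I : Bar n) (J : Bar m) : Prop :=
  (J.IsLeft ↔ I.IsLeft) ∧ (J.IsCentral ↔ I.IsCentral) ∧ (J.IsRight ↔ I.IsRight)

/-- The half of the glued interval contributed by `J` meets the upper path only in end points of the
poset, and by matching these already belong to `I`. -/
theorem upperPath_mem_glue {I : Bar n} {J : Bar m} (h : Matched I J)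
    (hI : I.fst = ⊥ ∨ I.snd = ⊤) (a : PathPoset n) :
    upperPath n m a ∈ (glue I J).carrier ↔ a ∈ I.toInterval.carrier := by
  have key : a ∈ I.toInterval.carrier ↔ I.fst ≤ a ∧ a ≤ I.snd := Iff.rfl
  rw [key, glue]
  split_ifs with hc hl
  · exact ⟨fun _ => ⟨hc.1.le.trans bot_le, le_top.trans hc.2.ge⟩, fun _ => trivial⟩
  · have hJ := h.1.2 hl
    refine ⟨fun ha => ⟨hl.1.le.trans bot_le, ?_⟩, fun ha =>
      Or.inl ⟨bot_le, upperPath_le_upperPath.2 ha.2⟩⟩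
    obtain ha | ha := ha
    · exact upperPath_le_upperPath.1 ha.2
    · obtain rfl | h' := eq_of_upperPath_le_lowerPath ha.2
      · exact bot_le
      · exact (hJ.2 h').elim
  · have hr : I.IsRight := by
      unfold Bar.IsLeft Bar.IsCentral Bar.IsRight at *
      tauto
    have hJ := h.2.2.2 hr
    refine ⟨fun ha => ⟨?_, le_top.trans hr.2.ge⟩, fun ha =>
      Or.inl ⟨upperPath_le_upperPath.2 ha.1, le_top⟩⟩
    obtain ha | ha := ha
    · exact upperPath_le_upperPath.1 ha.1
    · obtain h' | rfl := eq_of_lowerPath_le_upperPath ha.1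
      · exact (hJ.1 h').elim
      · exact le_top

theorem lowerPath_mem_glue {I : Bar n} {J : Bar m} (h : Matched I J)
    (hI : I.fst = ⊥ ∨ I.snd = ⊤) (a : PathPoset m) :
    lowerPath n m a ∈ (glue I J).carrier ↔ a ∈ J.toInterval.carrier := by
  have key : a ∈ J.toInterval.carrier ↔ J.fst ≤ a ∧ a ≤ J.snd := Iff.rfl
  rw [key, glue]
  split_ifs with hc hl
  · have hJ := h.2.1.2 hc
    exact ⟨fun _ => ⟨hJ.1.le.trans bot_le, le_top.trans hJ.2.ge⟩, fun _ => trivial⟩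
  · have hJ := h.1.2 hl
    refine ⟨fun ha => ⟨hJ.1.le.trans bot_le, ?_⟩, fun ha =>
      Or.inr ⟨bot_le, lowerPath_le_lowerPath.2 ha.2⟩⟩
    obtain ha | ha := ha
    · obtain rfl | h' := eq_of_lowerPath_le_upperPath ha.2
      · exact bot_le
      · exact (hl.2 h').elim
    · exact lowerPath_le_lowerPath.1 ha.2
  · have hr : I.IsRight := by
      unfold Bar.IsLeft Bar.IsCentral Bar.IsRight at *
      tauto
    have hJ := h.2.2.2 hr
    refine ⟨fun ha => ⟨?_, le_top.trans hJ.2.ge⟩, fun ha =>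
      Or.inr ⟨lowerPath_le_lowerPath.2 ha.1, le_top⟩⟩
    obtain ha | ha := ha
    · obtain h' | rfl := eq_of_upperPath_le_lowerPath ha.1
      · exact (hr.1 h').elim
      · exact le_top
    · exact lowerPath_le_lowerPath.1 ha.1

/-- A bar of the upper path as an interval of the bipath poset. -/
def upperInterval (m : ℕ) (I : Bar n) : PosetInterval (BipathPoset n m) :=
  .icc (upperPath n m I.fst) (upperPath n m I.snd) ((upperPath n m).monotone I.fst_le_snd)

/-- A bar of the lower path as an interval of the bipath poset. -/
def lowerInterval (n : ℕ) (J : Bar m) : PosetInterval (BipathPoset n m) :=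
  .icc (lowerPath n m J.fst) (lowerPath n m J.snd) ((lowerPath n m).monotone J.fst_le_snd)

theorem upperPath_mem_upperInterval {I : Bar n} {a : PathPoset n} :
    upperPath n m a ∈ (upperInterval m I).carrier ↔ a ∈ I.toInterval.carrier :=
  and_congr upperPath_le_upperPath upperPath_le_upperPath

theorem lowerPath_mem_lowerInterval {J : Bar m} {a : PathPoset m} :
    lowerPath n m a ∈ (lowerInterval n J).carrier ↔ a ∈ J.toInterval.carrier :=
  and_congr lowerPath_le_lowerPath lowerPath_le_lowerPath

theorem lowerPath_notMem_upperInterval {I : Bar n} (hI : I.IsOther) (a : PathPoset m) :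
    lowerPath n m a ∉ (upperInterval m I).carrier := by
  rintro ⟨h1, h2⟩
  obtain h | rfl := eq_of_upperPath_le_lowerPath h1
  · exact hI.1 h
  · exact hI.2 (top_le_iff.1 (upperPath_le_upperPath.1 (h2 : upperPath n m ⊤ ≤ _)))

theorem upperPath_notMem_lowerInterval {J : Bar m} (hJ : J.IsOther) (a : PathPoset n) :
    upperPath n m a ∉ (lowerInterval n J).carrier := by
  rintro ⟨h1, h2⟩
  obtain h | rfl := eq_of_lowerPath_le_upperPath h1
  · exact hJ.1 h
  · exact hJ.2 (top_le_iff.1 (lowerPath_le_lowerPath.1 (h2 : lowerPath n m ⊤ ≤ _)))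

namespace Realises

variable {V : BipathPoset n m ⥤ ModuleCat.{v} k} {x : Fin M.sizeU → ∀ a, (restrictUpper V).obj a}
  {y : Fin M.sizeD → ∀ a, (restrictLower V).obj a} {A : M.Mat}

/-- The matrix equations now say that matched sections agree at 0̂ and 1̂, so they glue. Bars
without 0̂ and 1̂ have sections vanishing at both ends, which extend by zero over the other path. -/
theorem isIntervalBasis (h : M.Realises V x y A) (e : Fin M.cols.num ≃ Fin M.rows.num)
    (he : ∀ q, Matched (M.cols.label q) (M.rows.label (e q)))
    (hA : ∀ p q, A p q = if e q = p then 1 else 0) :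
    IsIntervalBasis V
      (Sum.elim (fun q => glue (M.cols.label q) (M.rows.label (e q)))
        (Sum.elim (fun i : {i // (M.barU i).IsOther} => upperInterval m (M.barU i))
          (fun j : {j // (M.barD j).IsOther} => lowerInterval n (M.barD j))))
      (fun i => glueSection
        ((Sum.elim (fun q => x (M.colBar q)) (Sum.elim (fun i => x i.1) fun _ _ => 0) :
          _ → ∀ a, (restrictUpper V).obj a) i)
        ((Sum.elim (fun q => y (M.rowBar (e q))) (Sum.elim (fun _ _ => 0) fun j => y j.1) :
          _ → ∀ a, (restrictLower V).obj a) i)) := by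
  have hc := fun q => not_other_col (M := M) q
  refine isIntervalBasis_glueSection ?_ ?_ ?_ ?_ ?_ ?_ ?_ ?_ ?_ ?_
  · rintro (q | i | j)
    · change upBot x (M.colBar q) = lowBot y (M.rowBar (e q))
      by_cases hq : (M.cols.label q).fst = ⊥
      · rw [h.bot q hq]
        simp [hA]
      -- The equation at 0̂ covers only columns born there; for right bars both sections are zero.
      · have hr : (M.cols.label q).IsRight := ⟨hq, (hc q).resolve_left hq⟩
        rw [h.endU.zero₀ (M.colBar q) hq, h.row_zero₀ ((he q).2.2.2 hr).1]
    · exact h.endU.zero₀ i.1 i.2.1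
    · exact (h.endD.zero₀ j.1 j.2.1).symm
  · rintro (q | i | j)
    · change upTop x (M.colBar q) = lowTop y (M.rowBar (e q))
      rw [h.top' q]
      simp [hA]
    · exact h.endU.zero₁ i.1 i.2.2
    · exact (h.endD.zero₁ j.1 j.2.2).symm
  · rintro (q | i | j) a ha
    · exact h.basisU.zero _ a (mt (upperPath_mem_glue (he q) (hc q) a).2 ha)
    · exact h.basisU.zero _ a (mt upperPath_mem_upperInterval.2 ha)
    · rfl
  · rintro (q | i | j) a ha
    · exact h.basisD.zero _ a (mt (lowerPath_mem_glue (he q) (hc q) a).2 ha)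
    · rfl
    · exact h.basisD.zero _ a (mt lowerPath_mem_lowerInterval.2 ha)
  · rintro (q | i | j) a b hab ha
    · exact h.basisU.map _ hab ((upperPath_mem_glue (he q) (hc q) a).1 ha)
    · exact h.basisU.map _ hab (upperPath_mem_upperInterval.1 ha)
    · exact map_zero _
  · rintro (q | i | j) a b hab ha
    · exact h.basisD.map _ hab ((lowerPath_mem_glue (he q) (hc q) a).1 ha)
    · exact map_zero _
    · exact h.basisD.map _ hab (lowerPath_mem_lowerInterval.1 ha)
  · have hne : ∀ (q : Fin M.cols.num) (i : {i // (M.barU i).IsOther}), M.colBar q ≠ i.1 :=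
      fun q i hqi => (M.cols.idx q).2 (by
        have := i.2
        rwa [← hqi] at this)
    rintro a (q | i | j) ha
    · refine ⟨h.basisU.coord a (M.colBar q),
        h.basisU.coord_self ((upperPath_mem_glue (he q) (hc q) a).1 ha), ?_⟩
      rintro (q' | i' | j') hj
      · exact h.basisU.coord_of_ne a fun e => hj (congrArg Sum.inl (colBar_injective e.symm))
      · exact h.basisU.coord_of_ne a (hne q i')
      · exact map_zero _
    · refine ⟨h.basisU.coord a i.1,
        h.basisU.coord_self (upperPath_mem_upperInterval.1 ha), ?_⟩
      rintro (q' | i' | j') hj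
      · exact h.basisU.coord_of_ne a (hne q' i).symm
      · exact h.basisU.coord_of_ne a fun e => hj (by rw [Subtype.ext e])
      · exact map_zero _
    · exact (upperPath_notMem_lowerInterval j.2 a ha).elim
  · have hne : ∀ (q : Fin M.cols.num) (j : {j // (M.barD j).IsOther}), M.rowBar (e q) ≠ j.1 :=
      fun q j hqj => (M.rows.idx (e q)).2 (by
        have := j.2
        rwa [← hqj] at this)
    rintro a (q | i | j) ha
    · refine ⟨h.basisD.coord a (M.rowBar (e q)),
        h.basisD.coord_self ((lowerPath_mem_glue (he q) (hc q) a).1 ha), ?_⟩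
      rintro (q' | i' | j') hj
      · exact h.basisD.coord_of_ne a
          fun e' => hj (congrArg Sum.inl (e.injective (rowBar_injective e'.symm)))
      · exact map_zero _
      · exact h.basisD.coord_of_ne a (hne q j')
    · exact (lowerPath_notMem_upperInterval i.2 a ha).elim
    · refine ⟨h.basisD.coord a j.1,
        h.basisD.coord_self (lowerPath_mem_lowerInterval.1 ha), ?_⟩
      rintro (q' | i' | j') hj
      · exact h.basisD.coord_of_ne a (hne q' j).symm
      · exact map_zero _
      · exact h.basisD.coord_of_ne a fun e => hj (by rw [Subtype.ext e])
  · intro a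
    rw [eq_top_iff, ← h.basisU.span a]
    refine Submodule.span_mono ?_
    rintro _ ⟨i, rfl⟩
    by_cases hi : (M.barU i).IsOther
    · exact ⟨.inr (.inl ⟨i, hi⟩), rfl⟩
    · refine ⟨.inl (M.cols.idx.symm ⟨i, hi⟩), ?_⟩
      change x (M.colBar _) a = x i a
      simp only [colBar, Equiv.apply_symm_apply]
  · intro a
    rw [eq_top_iff, ← h.basisD.span a]
    refine Submodule.span_mono ?_
    rintro _ ⟨j, rfl⟩
    by_cases hj : (M.barD j).IsOther
    · exact ⟨.inr (.inr ⟨j, hj⟩), rfl⟩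
    · refine ⟨.inl (e.symm (M.rows.idx.symm ⟨j, hj⟩)), ?_⟩
      change y (M.rowBar (e _)) a = y j a
      simp only [rowBar, Equiv.apply_symm_apply]

open Classical in
theorem univ_map_sumElim {α β γ : Type*} [Fintype α] [Fintype β] (f : α → γ) (g : β → γ) :
    (Finset.univ : Finset (α ⊕ β)).val.map (Sum.elim f g) =
      (Finset.univ : Finset α).val.map f + (Finset.univ : Finset β).val.map g := by
  have h : (Finset.univ : Finset (α ⊕ β)).val =
      (Finset.univ : Finset α).val.map Sum.inl + (Finset.univ : Finset β).val.map Sum.inr := rfl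
  rw [h, Multiset.map_add, Multiset.map_map, Multiset.map_map]
  rfl

open Classical in
theorem univ_subtype_map {α γ : Type*} [Fintype α] (p : α → Prop) (f : α → γ) :
    (Finset.univ : Finset {a // p a}).val.map (fun a => f a.1) =
      (Finset.univ.filter p).val.map f := by
  have h : (Finset.univ : Finset {a // p a}).val.map Subtype.val = (Finset.univ.filter p).val := by
    have := congrArg Finset.val (Finset.subtype_map (s := (Finset.univ : Finset α)) p)
    simpa using this
  rw [← h, Multiset.map_map]
  rfl

theorem isIntervalDecomposition_output (h : M.Realises V x y A) (hA : M.IsNormalForm A) :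
    IsIntervalDecomposition V (M.output A) := by
  classical
  obtain ⟨-, e, he, hA⟩ := hA
  have := (h.isIntervalBasis e he hA).isIntervalDecomposition
  convert this using 1
  rw [univ_map_sumElim, univ_map_sumElim, univ_subtype_map (fun i => (M.barU i).IsOther)
    (fun i => upperInterval m (M.barU i)), univ_subtype_map (fun i => (M.barD i).IsOther)
    (fun i => lowerInterval n (M.barD i)), ← add_assoc, output]
  congr 2
  have h1 : (Finset.univ.filter fun x : Fin M.rows.num × Fin M.cols.num => A x.1 x.2 ≠ 0) =
      Finset.univ.map ⟨fun q => (e q, q), fun q q' h => (Prod.ext_iff.1 h).2⟩ := by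
    ext ⟨p, q⟩
    simp only [Finset.mem_filter, Finset.mem_univ, true_and, hA, Finset.mem_map]
    constructor
    · intro h
      exact ⟨q, Prod.ext (by_contra fun h' => h (if_neg h')) rfl⟩
    · rintro ⟨a, ha⟩
      have h1 : e a = p := congrArg Prod.fst ha
      have h2 : a = q := congrArg Prod.snd ha
      subst h2
      simp [h1]
  have h2 : (Finset.univ.filter fun x : Fin M.rows.num × Fin M.cols.num => A x.1 x.2 ≠ 0).val.map
      (fun x => glue (M.cols.label x.2) (M.rows.label x.1)) =
      Finset.univ.val.map (fun q => glue (M.cols.label q) (M.rows.label (e q))) := by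
    rw [h1, Finset.map_val, Multiset.map_map]
    rfl
  convert h2

end Realises

end BlockProblem

/-! ### Listings and correctness of the reduction -/

/-- Sort lexicographically. For bars containing 0̂ or 1̂ this is the componentwise order: a bar born
strictly later than another does not contain 0̂, so it must end at 1̂. -/
theorem nonempty_endListing {n N : ℕ} (bar : Fin N → Bar n) : Nonempty (EndListing bar) := by
  classical
  let e := (Fintype.equivFin {i : Fin N // ¬ (bar i).IsOther}).symm
  let f : Fin (Fintype.card {i : Fin N // ¬ (bar i).IsOther}) → Lex (PathPoset n × PathPoset n) :=
    fun p => toLex (bar (e p)).toProd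
  refine ⟨⟨_, (Tuple.sort f).trans e, fun p q hpq => ?_⟩⟩
  have h : f (Tuple.sort f p) ≤ f (Tuple.sort f q) := Tuple.monotone_sort f hpq
  obtain h | h := Prod.Lex.le_iff.1 h
  · refine ⟨h.le, ?_⟩
    have h1 : (bar (e (Tuple.sort f q))).fst ≠ ⊥ := ne_bot_of_gt h
    have h2 : (bar (e (Tuple.sort f q))).snd = ⊤ := by
      by_contra h2
      exact (e (Tuple.sort f q)).2 ⟨h1, h2⟩
    exact le_top.trans h2.ge
  · exact ⟨h.1.le, h.2⟩

namespace BlockProblem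

variable {k : Type u} [Field k] {n m : ℕ} {M : BlockProblem k n m}

theorem reduction_correct {V : BipathPoset n m ⥤ ModuleCat.{v} k}
    {x : Fin M.sizeU → ∀ a, (restrictUpper V).obj a}
    {y : Fin M.sizeD → ∀ a, (restrictLower V).obj a}
    (hx : IsIntervalBasis (restrictUpper V) (fun i => (M.barU i).toInterval) x)
    (hy : IsIntervalBasis (restrictLower V) (fun j => (M.barD j).toInterval) y)
    (hLam : ∀ i : Alive M.barU ⊥, upBot x i = ∑ j : Alive M.barD ⊥, M.Lam j i • lowBot y j)
    (hGam : ∀ i : Alive M.barU ⊤, upTop x i = ∑ j : Alive M.barD ⊤, M.Gam j i • lowTop y j) :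
    (∃ A, M.ProcedureResult A) ∧
    (∀ A, M.ProcedureResult A → M.Reachable A ∧ M.IsNormalForm A) ∧
    (∀ A, M.Reachable A → M.IsNormalForm A →
      ∀ D, IsIntervalDecomposition V D ↔ D = M.output A) := by
  have h := realises_initial hx hy hLam hGam
  refine ⟨?_, fun A hA => h.reachable_and_isNormalForm hA, fun A hA hN D => ?_⟩
  · obtain ⟨A₁, h1, h2⟩ := h.exists_centralIdentity
    exact ⟨_, A₁, h1, h2, rfl⟩
  · obtain ⟨x', y', h'⟩ := h.reflTransGen hA
    have hout := h'.isIntervalDecomposition_output hN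
    exact ⟨fun hD => isIntervalDecomposition_unique hD hout, fun hD => hD ▸ hout⟩

end BlockProblem

/-- Turns the matrices of ψφ⁻¹ into the expansions of basis vectors that `realises_initial` asks
for. -/
theorem sum_stdCoord_smul {k : Type u} [Field k] {n : ℕ} {V : PathPoset n ⥤ ModuleCat.{v} k}
    (φ : PathDecomposition V) (a : PathPoset n) [Fintype (Alive φ.bar a)] (x : V.obj a) :
    x = ∑ j : Alive φ.bar a, stdCoord k φ.bar a (φ.iso.equiv a x) j •
      (φ.iso.equiv a).symm (IsIntervalBasis.sumVector k (fun i => (φ.bar i).toInterval) a j.1) := by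
  classical
  let I := fun i => (φ.bar i).toInterval
  have h0 : ∀ {ι : Type} [Fintype ι] [DecidableEq ι] (w : ι → k),
      w = ∑ j, w j • (Pi.single j 1 : ι → k) := fun w => by
    funext l
    simp [Finset.sum_apply, Pi.single_apply]
  have h1 : ∀ w : {i // a ∈ (I i).carrier} → k, IsIntervalBasis.sumObjEquiv I a w =
      ∑ j : Alive φ.bar a, w j • IsIntervalBasis.sumVector k I a j.1 := by
    intro w
    have h2 : w = ∑ j : Alive φ.bar a, w j • (Pi.single j 1 : {i // a ∈ (I i).carrier} → k) :=
      h0 (ι := Alive φ.bar a) w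
    conv_lhs => rw [h2, map_sum]
    refine Finset.sum_congr rfl fun j _ => ?_
    rw [map_smul]
    congr 1
    exact IsIntervalBasis.sumObjEquiv_single (I := I) j
  have h3 := h1 ((IsIntervalBasis.sumObjEquiv I a).symm (φ.iso.equiv a x))
  rw [LinearEquiv.apply_symm_apply] at h3
  have h4 := congrArg (φ.iso.equiv a).symm h3
  rw [LinearEquiv.symm_apply_apply, map_sum] at h4
  refine h4.trans (Finset.sum_congr rfl fun j _ => ?_)
  rw [map_smul]
  rfl

/-! ### Homology classes of cycles -/

section Cycles

variable {k : Type u} [Field k]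

theorem homologyClass_surjective (K : ChainComplex (ModuleCat.{v} k) ℕ) (q : ℕ) :
    Function.Surjective (homologyClass K q) :=
  (ModuleCat.epi_iff_surjective _).1 (inferInstance : Epi (K.homologyπ q))

theorem homologyClass_sum_smul (K : ChainComplex (ModuleCat.{v} k) ℕ) (q : ℕ) {κ : Type}
    [Fintype κ] (y : κ → K.cycles q) (c : κ → k) :
    homologyClass K q (∑ j, c j • y j) = ∑ j, c j • homologyClass K q (y j) := by
  simp [homologyClass, map_sum]

theorem homologyClass_sub (K : ChainComplex (ModuleCat.{v} k) ℕ) (q : ℕ) (y z : K.cycles q) :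
    homologyClass K q (y - z) = homologyClass K q y - homologyClass K q z :=
  map_sub (K.homologyπ q).hom y z

/-- Homology is the cokernel of the map from chains of degree `q + 1` to cycles, so the kernel of
the projection is the space of boundaries. -/
theorem homologyClass_eq_zero_iff (K : ChainComplex (ModuleCat.{v} k) ℕ) (q : ℕ)
    (z : K.cycles q) :
    homologyClass K q z = 0 ↔ z ∈ LinearMap.range (K.toCycles (q + 1) q).hom := by
  have hex := (ShortComplex.mk _ _ (K.toCycles_comp_homologyπ (q + 1) q)).exact_of_g_is_cokernel
    (K.homologyIsCokernel (q + 1) q (by simp))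
  have := hex.moduleCat_range_eq_ker
  change z ∈ LinearMap.ker (K.homologyπ q).hom ↔ _
  rw [← this]

theorem isChangeOfBasis_iff (K : ChainComplex (ModuleCat.{v} k) ℕ) (q : ℕ) {ι κ : Type}
    [Fintype κ] (z : ι → K.cycles q) (y : κ → K.cycles q) (L : Matrix κ ι k) :
    IsChangeOfBasis K q z y L ↔
      ∀ i, homologyClass K q (z i) = ∑ j, L j i • homologyClass K q (y j) := by
  refine forall_congr' fun i => ?_
  rw [← homologyClass_eq_zero_iff, homologyClass_sub, homologyClass_sum_smul, sub_eq_zero]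

theorem exists_isChangeOfBasis (K : ChainComplex (ModuleCat.{v} k) ℕ) (q : ℕ) {ι κ : Type}
    [Fintype κ] (z : ι → K.cycles q) (y : κ → K.cycles q)
    (hy : Submodule.span k (Set.range fun j => homologyClass K q (y j)) = ⊤) :
    ∃ L : Matrix κ ι k, IsChangeOfBasis K q z y L := by
  have h : ∀ i, ∃ c : κ → k, ∑ j, c j • homologyClass K q (y j) = homologyClass K q (z i) :=
    fun i => (Submodule.mem_span_range_iff_exists_fun k).1 (hy ▸ Submodule.mem_top)
  choose c hc using h
  exact ⟨fun j i => c i j, (isChangeOfBasis_iff K q z y _).2 fun i => (hc i).symm⟩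

theorem homologyClass_pushCycle {P : Type*} [PartialOrder P]
    (C : P ⥤ ChainComplex (ModuleCat.{v} k) ℕ) (q : ℕ) {b a : P} (h : b ≤ a)
    (z : (C.obj b).cycles q) : homologyClass (C.obj a) q (pushCycle C q h z) =
      push (chainHomology C q) h (homologyClass (C.obj b) q z) := by
  have := HomologicalComplex.homologyπ_naturality (C.map (homOfLE h)) q
  exact (congrArg (fun f => f.hom z) this).symm

variable {n : ℕ} {C : PathPoset n ⥤ ChainComplex (ModuleCat.{v} k) ℕ} {q : ℕ}

theorem nonempty_cycleDiagram (hfin : ∀ a, FiniteDimensional k ((chainHomology C q).obj a)) :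
    Nonempty (CycleDiagram C q) := by
  obtain ⟨N, bar, z, hz⟩ := exists_bar_isIntervalBasis (chainHomology C q)
  -- Representatives are needed only at the births; their images represent the sections at all later
  -- points.
  choose c hc using fun i => homologyClass_surjective (C.obj (bar i).fst) q (z i (bar i).fst)
  have key : ∀ i a (h : (bar i).fst ≤ a),
      homologyClass (C.obj a) q (pushCycle C q h (c i)) = z i a := fun i a h => by
    rw [homologyClass_pushCycle, hc]
    exact hz.map i h ⟨le_rfl, (bar i).fst_le_snd⟩
  refine ⟨⟨N, bar, c, fun i a h h' => ?_, fun a => ?_, fun a => ?_⟩⟩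
  · rw [key]
    exact hz.zero i a fun h'' => h' h''.2
  · simp only [key]
    exact hz.linInd a
  · simp only [key]
    exact top_le_iff.1 (hz.span_alive a)

open Classical in
/-- The sections of the homology of `C` which belong to the cycles of a diagram. -/
noncomputable def CycleDiagram.homologySection (Z : CycleDiagram C q) (i : Fin Z.size)
    (a : PathPoset n) : (chainHomology C q).obj a :=
  if h : (Z.bar i).fst ≤ a then homologyClass (C.obj a) q (pushCycle C q h (Z.cycle i)) else 0

theorem CycleDiagram.homologySection_of_le (Z : CycleDiagram C q) {i : Fin Z.size} {a : PathPoset n}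
    (h : (Z.bar i).fst ≤ a) :
    Z.homologySection i a = homologyClass (C.obj a) q (pushCycle C q h (Z.cycle i)) :=
  dif_pos h

theorem CycleDiagram.isIntervalBasis (Z : CycleDiagram C q) :
    IsIntervalBasis (chainHomology C q) (fun i => (Z.bar i).toInterval) Z.homologySection where
  zero i a h := by
    by_cases h' : (Z.bar i).fst ≤ a
    · rw [Z.homologySection_of_le h']
      exact Z.dies i a h' fun h'' => h ⟨h', h''⟩
    · exact dif_neg h'
  map i a b h ha := by
    rw [Z.homologySection_of_le ha.1, Z.homologySection_of_le (ha.1.trans h),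
      homologyClass_pushCycle, homologyClass_pushCycle]
    exact push_push ..
  linInd a := by
    have : (fun i : {i // a ∈ (Z.bar i).toInterval.carrier} => Z.homologySection i.1 a) =
      fun i : Alive Z.bar a => homologyClass (C.obj a) q (pushCycle C q i.2.1 (Z.cycle i.1)) :=
      funext fun i => Z.homologySection_of_le i.2.1
    rw [this]
    exact Z.linearIndependent a
  span a := by
    refine top_le_iff.1 ((Z.span a).ge.trans (Submodule.span_mono ?_))
    rintro _ ⟨i, rfl⟩
    exact ⟨i.1, Z.homologySection_of_le i.2.1⟩

end Cycles

/-! ### Transport along isomorphisms, and the main theorem -/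

theorem PersIso.isIntervalDecomposition {k : Type u} [Field k] {P : Type*} [PartialOrder P]
    {V : P ⥤ ModuleCat.{v} k} {W : P ⥤ ModuleCat.{w} k} (φ : PersIso V W)
    {D : Multiset (PosetInterval P)} (h : IsIntervalDecomposition W D) :
    IsIntervalDecomposition V D := by
  obtain ⟨N, I, hI, ⟨ψ⟩⟩ := h
  refine ⟨N, I, hI, ⟨⟨fun a => (φ.equiv a).trans (ψ.equiv a), fun f x => ?_⟩⟩⟩
  rw [LinearEquiv.trans_apply, φ.natural, ψ.natural]
  rfl

/-- The inverse of an isomorphism of persistence modules. -/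
def PersIso.symm {k : Type u} [Field k] {P : Type*} [PartialOrder P]
    {V : P ⥤ ModuleCat.{v} k} {W : P ⥤ ModuleCat.{w} k} (φ : PersIso V W) : PersIso W V where
  equiv a := (φ.equiv a).symm
  natural f x := by
    rw [LinearEquiv.symm_apply_eq, φ.natural, LinearEquiv.apply_symm_apply]

theorem persistenceDiagram_eq {k : Type u} [Field k] {P : Type*} [PartialOrder P]
    {V : P ⥤ ModuleCat.{v} k} {D : Multiset (PosetInterval P)} (h : IsIntervalDecomposition V D) :
    persistenceDiagram V = D := by
  have h' : ∃ D, IsIntervalDecomposition V D := ⟨D, h⟩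
  rw [persistenceDiagram, dif_pos h']
  exact isIntervalDecomposition_unique h'.choose_spec h

theorem mainTheorem1 {k : Type u} [Field k] (n m : ℕ) (hn : 0 < n) (hm : 0 < m) :
    (∀ V : BipathPoset n m ⥤ ModuleCat.{v} k, (∀ a, FiniteDimensional k (V.obj a)) →
      Nonempty (PathDecomposition (restrictUpper V)) ∧
      Nonempty (PathDecomposition (restrictLower V)) ∧
      ∀ (φ : PathDecomposition (restrictUpper V)) (ψ : PathDecomposition (restrictLower V)),
        Nonempty (EndListing φ.bar) ∧ Nonempty (EndListing ψ.bar) ∧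
        ∀ (cols : EndListing φ.bar) (rows : EndListing ψ.bar),
          let M := associatedProblem φ ψ cols rows
          (∃ A, M.ProcedureResult A) ∧
          (∀ A, M.ProcedureResult A → M.Reachable A ∧ M.IsNormalForm A) ∧
          (∀ A, M.Reachable A → M.IsNormalForm A →
            ∀ D, IsIntervalDecomposition V D ↔ D = M.output A)) ∧
    (∀ (S : BipathPoset n m ⥤ TopCat.{w}) (q : ℕ), IsSpaceFiltration S →
      (∀ a, FiniteDimensional k ((persistentHomology k S q).obj a)) →
      ∀ C : ChainModel.{u, v, w} k S q,
        Nonempty (CycleDiagram (restrictUpper C.chains) q) ∧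
        Nonempty (CycleDiagram (restrictLower C.chains) q) ∧
        ∀ (Z : CycleDiagram (restrictUpper C.chains) q)
          (Y : CycleDiagram (restrictLower C.chains) q),
          (∃ Lam, IsChangeOfBasis (C.chains.obj ⊥) q (Z.cycleAt ⊥) (Y.cycleAt ⊥) Lam) ∧
          (∃ Gam, IsChangeOfBasis (C.chains.obj ⊤) q (Z.cycleAt ⊤) (Y.cycleAt ⊤) Gam) ∧
          Nonempty (EndListing Z.bar) ∧ Nonempty (EndListing Y.bar) ∧
          ∀ Lam Gam, IsChangeOfBasis (C.chains.obj ⊥) q (Z.cycleAt ⊥) (Y.cycleAt ⊥) Lam →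
            IsChangeOfBasis (C.chains.obj ⊤) q (Z.cycleAt ⊤) (Y.cycleAt ⊤) Gam →
            ∀ (cols : EndListing Z.bar) (rows : EndListing Y.bar),
              let M := cycleProblem Z Y Lam Gam cols rows
              (∃ A, M.ProcedureResult A) ∧
              (∀ A, M.ProcedureResult A → M.Reachable A ∧ M.IsNormalForm A) ∧
              (∀ A, M.Reachable A → M.IsNormalForm A →
                M.output A = persistenceDiagram (persistentHomology k S q) ∧
                ∀ D, IsIntervalDecomposition (persistentHomology k S q) D ↔ D = M.output A)) := by
  refine ⟨fun V hV => ?_, fun S q _ hfin C => ?_⟩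
  · refine ⟨nonempty_pathDecomposition _ fun a => hV _, nonempty_pathDecomposition _ fun a => hV _,
      fun φ ψ => ⟨nonempty_endListing _, nonempty_endListing _, fun cols rows => ?_⟩⟩
    exact BlockProblem.reduction_correct (M := associatedProblem φ ψ cols rows)
      (IsIntervalBasis.of_persIso φ.iso) (IsIntervalBasis.of_persIso ψ.iso)
      (fun i => sum_stdCoord_smul ψ ⊥ _) (fun i => sum_stdCoord_smul ψ ⊤ _)
  · have hfin' : ∀ a, FiniteDimensional k ((chainHomology C.chains q).obj a) := fun a =>
      haveI := hfin a
      (C.iso.equiv a).symm.finiteDimensional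
    refine ⟨nonempty_cycleDiagram fun a => hfin' _, nonempty_cycleDiagram fun a => hfin' _,
      fun Z Y => ⟨exists_isChangeOfBasis _ q _ _ (Y.span ⊥),
        exists_isChangeOfBasis _ q _ _ (Y.span ⊤),
        nonempty_endListing _, nonempty_endListing _, fun Lam Gam hLam hGam cols rows => ?_⟩⟩
    have h := BlockProblem.reduction_correct (M := cycleProblem Z Y Lam Gam cols rows)
      (V := chainHomology C.chains q) Z.isIntervalBasis Y.isIntervalBasis
      (fun i => by
        refine (Z.homologySection_of_le i.2.1).trans ?_
        refine ((isChangeOfBasis_iff _ q _ _ _).1 hLam i).trans ?_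
        exact Finset.sum_congr rfl fun j _ => congrArg _ (Y.homologySection_of_le j.2.1).symm)
      (fun i => by
        refine (Z.homologySection_of_le i.2.1).trans ?_
        refine ((isChangeOfBasis_iff _ q _ _ _).1 hGam i).trans ?_
        exact Finset.sum_congr rfl fun j _ => congrArg _ (Y.homologySection_of_le j.2.1).symm)
    refine ⟨h.1, h.2.1, fun A hA hN => ?_⟩
    -- The reduction was applied to the homology of the chain model; its natural isomorphism with
    -- singular homology preserves interval decompositions in both directions.
    have key : ∀ D, IsIntervalDecomposition (persistentHomology k S q) D ↔
        D = (cycleProblem Z Y Lam Gam cols rows).output A := fun D =>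
      Iff.trans ⟨C.iso.isIntervalDecomposition, C.iso.symm.isIntervalDecomposition⟩
        (h.2.2 A hA hN D)
    exact ⟨(persistenceDiagram_eq ((key _).2 rfl)).symm, key⟩
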